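/- **Setting.** Let $(X,d)$ be a locally compact metric space with countable basis, and let $\Gamma$ be a unimodular topological group whose topology is given by a left-invariant metric $d_\Gamma$ with precompact balls; $|\cdot|$ denotes a Haar measure. Assume $\Gamma$ is amenable, i.e. there are compact nonempty sets $I_n\subset\Gamma$ such that for every nonempty compact $C\subset\Gamma$ and $\varepsilon>0$, $|I_n\triangle CI_n|<\varepsilon|I_n|$ for all large $n$. Let $\Gamma$ act continuously by isometries on $X$, and let $F'\subset X$ be a countable union of compact sets with compact closure such that each $x\in X$ lies in $\gamma F'$ for exactly one $\gamma=:\Phi(x)\in\Gamma$, and such that for some $a\ge1$, $b\ge0$ and all $x,y\in X$ $$\tfrac1a d_\Gamma(\Phi(x),\Phi(y))-b\le d(x,y)\le a\,d_\Gamma(\Phi(x),\Phi(y))+b .$$ Let $K$ be a compact Hausdorff space (for example a compactification of $\mathbb C$). Let $\tilde{\mathcal D}$ be the set of pairs $\omega=(A,h)$ with $A\subset X$, $d(x,y)\ge1$ for distinct $x,y\in A$, and $h:A\times A\to K$. It carries the vague topology, i.e. the coarsest one for which all maps $(A,h)\mapsto\sum_{x,y\in A}\varphi(x,y,h(x,y))$,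 $\varphi\in C_c(X\times X\times K)$, are continuous, and the action $\gamma(A,h)=(\gamma A,h(\gamma^{-1}\cdot,\gamma^{-1}\cdot))$. Write $X(\omega)=A$. Let $\mu$ be a $\Gamma$-invariant Borel probability measure on $\tilde{\mathcal D}$ with topological support $\Omega$; assume $\mu(\Omega)=1$ (automatic if $K$ is metrizable) and that $X(\omega)\ne\emptyset$ for some $\omega\in\Omega$. Put $m(\Lambda)=\int\#(\Lambda\cap X(\omega))\,d\mu(\omega)$ and let $\operatorname{dens}(m)=m(IF')/|I|$, which is the same for all compact $I\subset\Gamma$ with $|I|>0$. Consider families $T=(T_\omega)$ of bounded operators on $\ell^2(X(\omega))$ with matrix elements $T_\omega(x,y)=\langle\delta_x,T_\omega\delta_y\rangle$, and let functions $s_\gamma:X\to\{z\in\mathbb C:|z|=1\}$, $\gamma\in\Gamma$, be given. Let $\mathcal N$ be the set of those $T$ which are measurable (for all $f,g\in C_c(X)$ the function $\omega\mapsto\sum_{x,y\in X(\omega)}f(x)T_\omega(x,y)g(y)$ is $\mu$-measurable), bounded ($\sup_{\omega\in\Omega}\|T_\omega\|<\infty$) and equivariant: $s_\gamma(x)\,T_{\gamma\omega}(\gamma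 x,\gamma y)\,\overline{s_\gamma(y)}=T_\omega(x,y)$ for all $\gamma\in\Gamma$, $\omega\in\Omega$, $x,y\in X(\omega)$. Such a $T$ defines a decomposable operator on $\int^\oplus_\Omega\ell^2(X(\omega))\,d\mu(\omega)$. For $T\in\mathcal N$ put $$\tau_u(T)=\frac1{\operatorname{dens}(m)}\int\operatorname{Tr}(uT_\omega)\,d\mu(\omega),\qquad \operatorname{Tr}(uT_\omega)=\sum_{x\in X(\omega)}u(x)T_\omega(x,x),$$ where $u:X\to\mathbb R$ is admissible, i.e. bounded, measurable, of compact support, with $\int_\Gamma u(\gamma^{-1}x)\,d\gamma=1$ for all $x\in X$. We say that $H$ satisfies (A) if $H\in\mathcal N$, $H_\omega$ is selfadjoint for $\mu$-almost every $\omega$, and $H$ has finite hopping range: there is $R<\infty$ such that $H_\omega(x,y)=0$ whenever $\omega\in\Omega$, $x,y\in X(\omega)$ and $d(x,y)\ge R$. (The basic example is a compactification $K$ of $\mathbb C$ and $H_\omega(x,y)=h(x,y)$ for $\omega=(A,h)\in\Omega$.) **Theorem 2.2.** Let $H$ satisfy (A) and let $\lambda\in\mathbb R$. Let $P_{comp,\omega}$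 be the orthogonal projection of $\ell^2(X(\omega))$ onto the closed linear span of the compactly (i.e. finitely) supported $v\in\ell^2(X(\omega))$ with $(H_\omega-\lambda)v=0$. Then $P_{comp}=(P_{comp,\omega})$ belongs to $\mathcal N$, and $$E_H(\{\lambda\})=P_{comp},\qquad\text{i.e.}\qquad E_{H_\omega}(\{\lambda\})=P_{comp,\omega}\ \text{ for $\mu$-almost every }\omega,$$ where $E_T$ denotes the spectral family of a selfadjoint operator $T$. Moreover, there is exactly one locally finite Borel measure $\nu_H$ on $\mathbb R$ such that, for all $\varphi\in C_c(\mathbb R)$ and all admissible $u$, $\omega\mapsto\operatorname{Tr}(u\varphi(H_\omega))$ is $\mu$-integrable and $\int\varphi\,d\nu_H=\tau_u(\varphi(H))$. The measure $\nu_H$ is finite, and the jump at $\lambda$ of the integrated density of states $N_H(t)=\nu_H((-\infty,t])$ is the equivariant dimension of the range of $P_{comp}$: for every admissible $u$, $\omega\mapsto\operatorname{Tr}(uP_{comp,\omega})$ is $\mu$-integrable and $$N_H(\lambda)-\lim_{t\uparrow\lambda}N_H(t)=\tau_u(P_{comp}).$$ No ergodicity of $\mu$ is assumed. -/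

import Mathlib

open MeasureTheory Filter Topology
open scoped Pointwise symmDiff ENNReal NNReal CompactlySupported ComplexConjugate

noncomputable section

namespace DiscreteHamiltonian

/-! ### Groups -/

/-- A Folner sequence: compact nonempty sets `I n` such that, for every nonempty compact `C` and
every `ε > 0`, one has `|I n ∆ C (I n)| < ε |I n|` for all large `n`. -/
structure IsFolnerSequence {Γ : Type*} [Group Γ] [TopologicalSpace Γ] [MeasurableSpace Γ]
    (haar : Measure Γ) (I : ℕ → Set Γ) : Prop where
  isCompact : ∀ n, IsCompact (I n)
  nonempty : ∀ n, (I n).Nonempty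
  small : ∀ C : Set Γ, IsCompact C → C.Nonempty → ∀ ε : ℝ, 0 < ε →
    ∀ᶠ n in atTop, haar (I n ∆ (C * I n)) < ENNReal.ofReal ε * haar (I n)

/-- Amenability of a (second countable) locally compact group: a Folner sequence exists. -/
def IsAmenable {Γ : Type*} [Group Γ] [TopologicalSpace Γ] [MeasurableSpace Γ]
    (haar : Measure Γ) : Prop :=
  ∃ I : ℕ → Set Γ, IsFolnerSequence haar I

/-- `F'` is a fundamental domain with compact closure, a countable union of compact sets, such
that the map `Φ` sending `x` to the unique `γ` with `x ∈ γ F'` is a rough isometry. -/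
structure IsRoughFundamentalDomain (Γ : Type*) {X : Type*} [Group Γ] [MetricSpace Γ]
    [MetricSpace X] [MulAction Γ X] (F' : Set X) : Prop where
  existsUnique : ∀ x : X, ∃! γ : Γ, x ∈ γ • F'
  isCompact_closure : IsCompact (closure F')
  isSigmaCompact : IsSigmaCompact F'
  rough : ∃ a b : ℝ, 1 ≤ a ∧ 0 ≤ b ∧ ∀ (x y : X) (α β : Γ), x ∈ α • F' → y ∈ β • F' →
    1 / a * dist α β - b ≤ dist x y ∧ dist x y ≤ a * dist α β + b

/-! ### Configurations -/

/-- Pairs `(A, h)` with `A ⊆ X` uniformly discrete (distinct points have distance at least `1`)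
and `h : A × A → K`. In the basic example `K` is a compactification of `ℂ`, and `h` is the matrix of
an operator on `ℓ²(A)`. -/
structure Config (X K : Type*) [MetricSpace X] where
  /-- the set `X(ω)` -/
  carrier : Set X
  one_le_dist : ∀ x ∈ carrier, ∀ y ∈ carrier, x ≠ y → 1 ≤ dist x y
  /-- the function `h` -/
  mark : carrier → carrier → K

variable {Γ X K : Type*} [MetricSpace X]

/-- `∑_{x, y ∈ A} φ(x, y, h(x, y))`; only finitely many terms are nonzero if `φ` has compact
support. -/
def Config.pairSum [TopologicalSpace K] (ω : Config X K) (φ : C_c(X × X × K, ℂ)) : ℂ :=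
  ∑ᶠ p : ω.carrier × ω.carrier, φ (p.1, p.2, ω.mark p.1 p.2)

/-- The vague topology: `(A, h)` is identified with the counting measure
`∑_{x, y ∈ A} δ_{(x, y, h(x, y))}` on `X × X × K`. -/
instance [TopologicalSpace K] : TopologicalSpace (Config X K) :=
  TopologicalSpace.induced Config.pairSum inferInstance

instance [TopologicalSpace K] : MeasurableSpace (Config X K) := borel _

instance [TopologicalSpace K] : BorelSpace (Config X K) := ⟨rfl⟩

/-- The action `γ (A, h) = (γ A, γ h)` with `(γ h)(x, y) = h(γ⁻¹ x, γ⁻¹ y)`. -/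
instance [Group Γ] [MulAction Γ X] [IsIsometricSMul Γ X] : SMul Γ (Config X K) where
  smul γ ω :=
    { carrier := γ • ω.carrier
      one_le_dist := by
        rintro _ ⟨x, hx, rfl⟩ _ ⟨y, hy, rfl⟩ hxy
        have := ω.one_le_dist x hx y hy (fun h => hxy (by rw [h]))
        simpa [dist_smul] using this
      mark := fun x y =>
        ω.mark ⟨γ⁻¹ • (x : X), Set.mem_smul_set_iff_inv_smul_mem.1 x.2⟩
          ⟨γ⁻¹ • (y : X), Set.mem_smul_set_iff_inv_smul_mem.1 y.2⟩ }

/-- The point `γ x` of `γ ω`, for a point `x` of `ω`. -/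
def Config.smulPoint [Group Γ] [MulAction Γ X] [IsIsometricSMul Γ X] (ω : Config X K) (γ : Γ)
    (x : ω.carrier) : (γ • ω).carrier :=
  ⟨γ • (x : X), Set.smul_mem_smul_set x.2⟩

/-- The measure `m(Λ) = ∫ ω(Λ) dμ(ω)`, where `ω(Λ)` is the number of points of `Λ ∩ X(ω)`. -/
def intensity [TopologicalSpace K] (μ : Measure (Config X K)) (Λ : Set X) : ℝ≥0∞ :=
  ∫⁻ ω, ((Λ ∩ ω.carrier).encard : ℝ≥0∞) ∂μ

/-- The density `dens(m) = m(I F') / |I|`. This does not depend on the compact set `I` of positive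
measure; here `I` is the closed unit ball around the identity. -/
def density [TopologicalSpace K] [Group Γ] [MetricSpace Γ] [MeasurableSpace Γ] [MulAction Γ X]
    (haar : Measure Γ) (F' : Set X) (μ : Measure (Config X K)) : ℝ :=
  (intensity μ (Metric.closedBall (1 : Γ) 1 • F') / haar (Metric.closedBall (1 : Γ) 1)).toReal

/-- The functions `u` of compact support with `∫ u(γ⁻¹ x) dγ = 1` for all `x`. -/
structure IsAdmissible [Group Γ] [MeasurableSpace Γ] [MulAction Γ X] [MeasurableSpace X]
    (haar : Measure Γ) (u : X → ℝ) : Prop where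
  measurable : Measurable u
  bounded : ∃ C : ℝ, ∀ x, |u x| ≤ C
  hasCompactSupport : HasCompactSupport u
  integral_eq_one : ∀ x : X, ∫ γ : Γ, u (γ⁻¹ • x) ∂haar = 1

/-! ### Fields of operators -/

/-- The Hilbert space `ℓ²(X(ω))`. -/
abbrev Config.ell2 (ω : Config X K) : Type _ := lp (fun _ : ω.carrier => ℂ) 2

open Classical in
/-- The matrix element `T(x, y) = ⟨δ_x, T δ_y⟩`. -/
def Config.entry (ω : Config X K) (T : ω.ell2 →L[ℂ] ω.ell2) (x y : ω.carrier) : ℂ :=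
  (T (lp.single 2 y (1 : ℂ)) : ω.carrier → ℂ) x

variable (X K) in
/-- A family `T = (T_ω)` of bounded operators on the spaces `ℓ²(X(ω))`. -/
abbrev OperatorField : Type _ := ∀ ω : Config X K, ω.ell2 →L[ℂ] ω.ell2

/-- Measurability of the field `ω ↦ T_ω` over the direct integral `∫ ℓ²(X(ω)) dμ(ω)`, whose
measurable structure is generated by the sections `ω ↦ g|_{X(ω)}` with `g ∈ C_c(X)`. -/
def IsMeasurableField [TopologicalSpace K] (μ : Measure (Config X K)) (T : OperatorField X K) :
    Prop :=
  ∀ f g : C_c(X, ℂ), AEMeasurable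
    (fun ω : Config X K => ∑ᶠ p : ω.carrier × ω.carrier,
      f p.1 * ω.entry (T ω) p.1 p.2 * g p.2) μ

/-- The basic example of a measurable field: `K` is a compactification of `ℂ` by `ι`, and `H_ω` is,
for `ω = (A, h)`, the operator with matrix `h`, bounded uniformly in `ω`. -/
theorem isMeasurableField_of_mark [TopologicalSpace K] [CompactSpace K] [T2Space K] {ι : ℂ → K}
    (hι : IsDenseEmbedding ι) (μ : Measure (Config X K)) (hμ : ∀ᵐ ω ∂μ, ω ∈ μ.support)
    (H : OperatorField X K) (C : ℝ) (hC : ∀ ω ∈ μ.support, ‖H ω‖ ≤ C)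
    (hH : ∀ ω ∈ μ.support, ∀ x y : ω.carrier, ω.mark x y = ι (ω.entry (H ω) x y)) :
    IsMeasurableField μ H := by
  classical
  intro f g
  have hcont : Continuous (fun z : Metric.closedBall (0 : ℂ) C => ι z) :=
    hι.continuous.comp continuous_subtype_val
  have hemb : Topology.IsClosedEmbedding (fun z : Metric.closedBall (0 : ℂ) C => ι z) :=
    hcont.isClosedEmbedding (hι.injective.comp Subtype.val_injective)
  obtain ⟨χ, hχ⟩ := ContinuousMap.exists_extension hemb
    (⟨fun z => (z : ℂ), continuous_subtype_val⟩ : C(Metric.closedBall (0 : ℂ) C, ℂ))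
  have hχ' : ∀ z : ℂ, ‖z‖ ≤ C → χ (ι z) = z := fun z hz => by
    simpa using DFunLike.congr_fun hχ (⟨z, by simpa using hz⟩ : Metric.closedBall (0 : ℂ) C)
  let φ : C_c(X × X × K, ℂ) :=
    { toFun := fun p => f p.1 * χ p.2.2 * g p.2.1
      continuous_toFun := by fun_prop
      hasCompactSupport' := by
        refine HasCompactSupport.intro (f.hasCompactSupport.isCompact.prod
          (g.hasCompactSupport.isCompact.prod isCompact_univ)) ?_
        rintro ⟨x, y, k⟩ hp
        by_cases hx : x ∈ tsupport f
        · have hy : y ∉ tsupport g := fun hy => hp ⟨hx, hy, trivial⟩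
          simp [image_eq_zero_of_notMem_tsupport hy]
        · simp [image_eq_zero_of_notMem_tsupport hx] }
  have h0 : Continuous (Config.pairSum : Config X K → C_c(X × X × K, ℂ) → ℂ) :=
    continuous_induced_dom
  have hm : Continuous (fun ω : Config X K => ω.pairSum φ) := continuous_pi_iff.1 h0 φ
  refine ⟨_, hm.measurable, ?_⟩
  filter_upwards [hμ] with ω hω
  refine finsum_congr fun p => ?_
  have hb : ‖ω.entry (H ω) p.1 p.2‖ ≤ C := by
    refine le_trans (lp.norm_apply_le_norm (by simp) _ _) ?_
    refine le_trans ((H ω).le_opNorm _) ?_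
    rw [lp.norm_single (by simp)]
    simpa using hC ω hω
  simp [φ, hH ω hω, hχ' _ hb]

/-- Bounded decomposable operators that are equivariant with respect to the functions `s γ`;
`Ω` is the topological support of `μ`. -/
structure IsEquivariantField [TopologicalSpace K] [Group Γ] [MulAction Γ X] [IsIsometricSMul Γ X]
    (μ : Measure (Config X K)) (s : Γ → X → Circle) (T : OperatorField X K) : Prop where
  measurable : IsMeasurableField μ T
  bounded : ∃ C : ℝ, ∀ ω ∈ μ.support, ‖T ω‖ ≤ C
  equivariant : ∀ (γ : Γ), ∀ ω ∈ μ.support, ∀ x y : ω.carrier,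
    (s γ x : ℂ) * (γ • ω).entry (T (γ • ω)) (ω.smulPoint γ x) (ω.smulPoint γ y) *
      conj (s γ y : ℂ) = ω.entry (T ω) x y

/-- Bounded, selfadjoint, decomposable, equivariant operators of finite hopping range. -/
structure ConditionA [TopologicalSpace K] [Group Γ] [MulAction Γ X] [IsIsometricSMul Γ X]
    (μ : Measure (Config X K)) (s : Γ → X → Circle) (H : OperatorField X K) : Prop
    extends IsEquivariantField μ s H where
  selfAdjoint : ∀ᵐ ω ∂μ, IsSelfAdjoint (H ω)
  finiteRange : ∃ R : ℝ, ∀ ω ∈ μ.support, ∀ x y : ω.carrier,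
    R ≤ dist (x : X) y → ω.entry (H ω) x y = 0

/-- `Tr(u T) = ∑_x u(x) T(x, x)`, a finite sum if `u` has compact support. -/
def Config.trace (ω : Config X K) (u : X → ℝ) (T : ω.ell2 →L[ℂ] ω.ell2) : ℂ :=
  ∑ᶠ x : ω.carrier, (u x : ℂ) * ω.entry T x x

/-- `τ(T) = dens(m)⁻¹ ∫ Tr(u T_ω) dμ(ω)`. If `T` is an equivariant field of orthogonal
projections, this is the equivariant dimension of its range. -/
def tau [TopologicalSpace K] [Group Γ] [MetricSpace Γ] [MeasurableSpace Γ] [MulAction Γ X]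
    (haar : Measure Γ) (F' : Set X) (μ : Measure (Config X K)) (u : X → ℝ)
    (T : OperatorField X K) : ℂ :=
  (density haar F' μ : ℂ)⁻¹ * ∫ ω, ω.trace u (T ω) ∂μ

/-! ### Spectral projections and the integrated density of states -/

section Spectral

variable {V : Type*} [NormedAddCommGroup V] [InnerProductSpace ℂ V] [CompleteSpace V]

/-- The operator `φ(T)`, for `T` selfadjoint and `φ ∈ C_c(ℝ)` (continuous functional calculus). -/
def applyFun (φ : C_c(ℝ, ℝ)) (T : V →L[ℂ] V) : V →L[ℂ] V := cfc (φ : ℝ → ℝ) T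

/-- The positive functional `φ ↦ ⟨v, φ(T) v⟩` on `C_c(ℝ)`. -/
def spectralFunctional (T : V →L[ℂ] V) (v : V) : C_c(ℝ, ℝ) →ₚ[ℝ] ℝ :=
  PositiveLinearMap.mk₀
    { toFun := fun φ => (inner ℂ v (applyFun φ T v)).re
      map_add' := fun φ ψ => by
        have h : applyFun (φ + ψ) T = applyFun φ T + applyFun ψ T :=
          cfc_add T (φ : ℝ → ℝ) ψ φ.continuous.continuousOn ψ.continuous.continuousOn
        rw [h]
        simp
      map_smul' := fun c φ => by
        have h : applyFun (c • φ) T = c • applyFun φ T :=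
          cfc_smul c (φ : ℝ → ℝ) T φ.continuous.continuousOn
        rw [h]
        simp [inner_smul_right_eq_smul] }
    (fun φ hφ => by
      have h : 0 ≤ applyFun φ T := cfc_nonneg (fun x _ => hφ x)
      have h2 := ((ContinuousLinearMap.nonneg_iff_isPositive _).1 h).inner_nonneg_right v
      exact (Complex.le_def.1 h2).1)

/-- The spectral measure `B ↦ ⟨v, E_T(B) v⟩` of a selfadjoint operator `T` at the vector `v`: the
measure with `∫ φ = ⟨v, φ(T) v⟩` for `φ ∈ C_c(ℝ)`. -/
def spectralMeasure (T : V →L[ℂ] V) (v : V) : Measure ℝ :=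
  RealRMK.rieszMeasure (spectralFunctional T v)

open Classical in
/-- The spectral projection `E_T(B)` of a selfadjoint operator `T`: the unique bounded operator `P`
such that `⟨v, P v⟩` is the spectral measure of `B` at `v`, for every `v`. -/
def spectralProjection (T : V →L[ℂ] V) (B : Set ℝ) : V →L[ℂ] V :=
  if h : ∃ P : V →L[ℂ] V, ∀ v, inner ℂ v (P v) = ((spectralMeasure T v).real B : ℂ)
  then h.choose else 0

end Spectral

/-- The linear span of the finitely supported `v ∈ ℓ²(X(ω))` with `(T - lam) v = 0`. As `X(ω)` is
discrete, finite support is the same as compact support. -/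
def Config.compSpan (ω : Config X K) (T : ω.ell2 →L[ℂ] ω.ell2) (lam : ℝ) :
    Submodule ℂ ω.ell2 :=
  Submodule.span ℂ {v : ω.ell2 |
    (Function.support (v : ω.carrier → ℂ)).Finite ∧ T v - (lam : ℂ) • v = 0}

/-- The field `P_comp`: `P_{comp, ω}` is the orthogonal projection onto the closed span of the
compactly supported solutions of `(H_ω - lam) v = 0`. -/
def compProjection (H : OperatorField X K) (lam : ℝ) : OperatorField X K :=
  fun ω => (ω.compSpan (H ω) lam).topologicalClosure.starProjection

/-- `ν` is the density of states measure of `H`: the measure with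
`∫ φ dν = dens(m)⁻¹ ∫ Tr(u φ(H_ω)) dμ(ω)` for all `φ ∈ C_c(ℝ)` and all admissible `u`. -/
structure IsDensityOfStates [TopologicalSpace K] [Group Γ] [MetricSpace Γ] [MeasurableSpace Γ]
    [MulAction Γ X] [MeasurableSpace X] (haar : Measure Γ) (F' : Set X)
    (μ : Measure (Config X K)) (H : OperatorField X K) (ν : Measure ℝ) : Prop where
  locallyFinite : IsLocallyFiniteMeasure ν
  integrable : ∀ u : X → ℝ, IsAdmissible haar u → ∀ φ : C_c(ℝ, ℝ),
    Integrable (fun ω => ω.trace u (applyFun φ (H ω))) μ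
  integral_eq : ∀ u : X → ℝ, IsAdmissible haar u → ∀ φ : C_c(ℝ, ℝ),
    ((∫ t, φ t ∂ν : ℝ) : ℂ) = tau haar F' μ u (fun ω => applyFun φ (H ω))

/-- The distribution function `t ↦ ν((-∞, t])`. -/
def distribution (ν : Measure ℝ) (t : ℝ) : ℝ := ν.real (Set.Iic t)

end DiscreteHamiltonian

end

/-! Fix λ and split ker(H_ω − λ) into the closed span of the finitely supported solutions and its
orthogonal complement `nonCompact`, with projection Q_ω. The heart of the matter is that Q_ω = 0
almost surely.

Take a window L and a set B containing both sides of its R-boundary, each with finitely many points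
of X(ω). If v in the range of Q_ω vanishes on B, then finite hopping range makes the truncation 1_L
v an eigenvector again. It is finitely supported, hence orthogonal to v, so v vanishes on L. Thus
the values on B determine those on L, and linear algebra bounds the sum of Q_ω(x,x) over L by the
number of points in B (`sum_entry_starProjection_le`, `sum_entry_nonCompact_le`). Integrating over μ
turns both sides into Γ-invariant measures on X, and such a measure gives J F' a mass proportional
to |J| (`measure_smul_mul`). For Folner sets the boundary is a negligible fraction of the window, so
the mean measure of Q is zero (`starProjection_nonCompact_ae_eq_zero`). Only means are compared,
never individual configurations, which is why ergodicity plays no role.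

The spectral side rests on tent functions decreasing to the indicator of {λ}. Applied to H_ω they
converge strongly to the projection onto ker(H_ω − λ) (`tendsto_contFun_tent`); this identifies
E_H({λ}) and, by dominated convergence, the atom of ν_H at λ.

The measure ν_H comes from the Riesz–Markov theorem. Its functional does not depend on u because,
for an invariant measure on X, an exchange of integrals (`lintegral_mul_groupAverage`) sees only the
group average of u, which is 1.

Measurability takes most of the remaining work. Fields are tested on Borel functions instead of
continuous ones, so that a countable partition of X into cells with at most one point each can
replace a measurable enumeration of X(ω). -/

noncomputable section

namespace DiscreteHamiltonian

/-! ### Points of a configuration, unit vectors, and cells with at most one point. -/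

section ConfigBasics

variable {X K : Type*} [MetricSpace X]

namespace Config

theorem eq_of_dist_lt_one (ω : Config X K) {x y : ω.carrier} (h : dist (x : X) y < 1) : x = y := by
  by_contra hne
  exact absurd (ω.one_le_dist x x.2 y y.2 (fun h => hne (Subtype.ext h))) (not_le.2 h)

/-- The number of points of a configuration in a compact set is bounded uniformly. -/
theorem exists_encard_le {S : Set X} (hS : IsCompact S) :
    ∃ N : ℕ, ∀ ω : Config X K, (((↑) : ω.carrier → X) ⁻¹' S).encard ≤ N := by
  -- A ball of radius 1/2 contains at most one point of any configuration, so the number of covering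
  -- balls is a bound valid for all ω.
  obtain ⟨t, -, htf, hcov⟩ := hS.finite_cover_balls (e := 1 / 2) (by norm_num)
  refine ⟨t.ncard, fun ω => ?_⟩
  have hc : ∀ x : ω.carrier, ∃ c : X, (x : X) ∈ S → c ∈ t ∧ dist (x : X) c < 1 / 2 := fun x => by
    by_cases hx : (x : X) ∈ S
    · obtain ⟨c, hc, hxc⟩ : ∃ c ∈ t, dist (x : X) c < 1 / 2 := by simpa using hcov hx
      exact ⟨c, fun _ => ⟨hc, hxc⟩⟩
    · exact ⟨x, fun h => absurd h hx⟩
  choose c hc using hc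
  rw [htf.cast_ncard_eq]
  refine Set.encard_le_encard_of_injOn (f := c) (fun x hx => (hc x hx).1) fun x hx y hy hxy => ?_
  refine ω.eq_of_dist_lt_one ?_
  have h1 := (hc x hx).2
  have h2 := (hc y hy).2
  rw [← hxy] at h2
  linarith [dist_triangle_right (x : X) y (c x)]

theorem finite_preimage (ω : Config X K) {S : Set X} (hS : IsCompact S) :
    (((↑) : ω.carrier → X) ⁻¹' S).Finite := by
  obtain ⟨N, hN⟩ := exists_encard_le (K := K) hS
  exact Set.finite_of_encard_le_coe (hN ω)

theorem finite_support (ω : Config X K) {E : Type*} [Zero E] {f : X → E}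
    (hf : HasCompactSupport f) : (Function.support fun x : ω.carrier => f x).Finite :=
  (ω.finite_preimage hf).subset fun _ hx => subset_tsupport f hx

open Classical in
/-- The unit vector `δ_x`. -/
def delta (ω : Config X K) (x : ω.carrier) : ω.ell2 := lp.single 2 x (1 : ℂ)

theorem inner_delta_left (ω : Config X K) (x : ω.carrier) (v : ω.ell2) :
    inner ℂ (ω.delta x) v = v x := by
  classical
  rw [delta, lp.inner_single_left]
  simp

theorem inner_delta_right (ω : Config X K) (x : ω.carrier) (v : ω.ell2) :
    inner ℂ v (ω.delta x) = conj (v x) := by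
  rw [← inner_conj_symm, inner_delta_left]

theorem entry_eq_inner (ω : Config X K) (T : ω.ell2 →L[ℂ] ω.ell2) (x y : ω.carrier) :
    ω.entry T x y = inner ℂ (ω.delta x) (T (ω.delta y)) := by
  rw [inner_delta_left]; rfl

theorem entry_eq_apply (ω : Config X K) (T : ω.ell2 →L[ℂ] ω.ell2) (x y : ω.carrier) :
    ω.entry T x y = T (ω.delta y) x := rfl

theorem delta_apply_self (ω : Config X K) (x : ω.carrier) : ω.delta x x = 1 := by
  classical
  simp [delta]

theorem delta_apply_ne (ω : Config X K) {x y : ω.carrier} (h : y ≠ x) : ω.delta x y = 0 := by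
  classical
  exact lp.single_apply_ne 2 x _ h

theorem norm_delta (ω : Config X K) (x : ω.carrier) : ‖ω.delta x‖ = 1 := by
  classical
  rw [delta, lp.norm_single (by simp)]
  simp

theorem norm_entry_le (ω : Config X K) (T : ω.ell2 →L[ℂ] ω.ell2) (x y : ω.carrier) :
    ‖ω.entry T x y‖ ≤ ‖T‖ := by
  rw [entry_eq_inner]
  refine (norm_inner_le_norm _ _).trans ?_
  rw [norm_delta, one_mul]
  simpa [norm_delta] using T.le_opNorm (ω.delta y)

theorem hasSum_delta (ω : Config X K) (v : ω.ell2) : HasSum (fun x => v x • ω.delta x) v := by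
  classical
  convert! lp.hasSum_single (by simp) v using 2 with x
  rw [delta, ← lp.single_smul]
  simp

/-- The restriction of a function on `X` to a configuration, as an element of `ℓ²`. -/
def restr (ω : Config X K) (f : X → ℂ) : ω.ell2 :=
  open Classical in
  if h : Memℓp (fun x : ω.carrier => f x) 2 then (⟨fun x => f x, h⟩ : lp (fun _ : ω.carrier => ℂ) 2)
  -- Never reached for compactly supported `f`, whose restriction has finite support.
  else 0

theorem restr_apply (ω : Config X K) {f : X → ℂ} (hf : HasCompactSupport f) (x : ω.carrier) :
    ω.restr f x = f x := by
  have h : Memℓp (fun x : ω.carrier => f x) 2 :=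
    Memℓp.of_exponent_ge (memℓp_zero (ω.finite_support hf)) (by simp)
  rw [restr, dif_pos h]

theorem restr_eq_sum (ω : Config X K) {f : X → ℂ} (hf : HasCompactSupport f)
    {t : Finset ω.carrier} (ht : ∀ x : ω.carrier, (x : X) ∈ tsupport f → x ∈ t) :
    ω.restr f = ∑ x ∈ t, f x • ω.delta x := by
  have h := ω.hasSum_delta (ω.restr f)
  simp only [ω.restr_apply hf] at h
  refine h.unique (hasSum_sum_of_ne_finset_zero fun x hx => ?_)
  rw [image_eq_zero_of_notMem_tsupport fun h => hx (ht x h), zero_smul]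

theorem inner_restr_eq_sum (ω : Config X K) {f : X → ℂ} (hf : HasCompactSupport f)
    {t : Finset ω.carrier} (ht : ∀ x : ω.carrier, (x : X) ∈ tsupport f → x ∈ t) (v : ω.ell2) :
    inner ℂ (ω.restr f) v = ∑ x ∈ t, conj (f x) * v x := by
  rw [ω.restr_eq_sum hf ht, sum_inner]
  simp [inner_smul_left, inner_delta_left]

/-- Rewrites the sums that define `IsMeasurableField` as a sesquilinear form; conjugating `f`
compensates for the conjugate-linear first slot. -/
theorem finsum_entry_eq_inner (ω : Config X K) (T : ω.ell2 →L[ℂ] ω.ell2) {f g : X → ℂ}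
    (hf : HasCompactSupport f) (hg : HasCompactSupport g) :
    ∑ᶠ p : ω.carrier × ω.carrier, f p.1 * ω.entry T p.1 p.2 * g p.2 =
      inner ℂ (ω.restr (fun x => conj (f x))) (T (ω.restr g)) := by
  classical
  have hf' : HasCompactSupport (fun x => conj (f x)) := hf.comp_left (map_zero _)
  have hs : tsupport (fun x => conj (f x)) = tsupport f := by
    simp [tsupport, Function.support]
  set t := (ω.finite_preimage hf).toFinset
  set s := (ω.finite_preimage hg).toFinset
  rw [ω.restr_eq_sum hg (t := s) (by simp [s]), map_sum, inner_sum,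
    finsum_eq_sum_of_support_subset (s := t ×ˢ s), Finset.sum_product_right]
  · refine Finset.sum_congr rfl fun y _ => ?_
    rw [ω.inner_restr_eq_sum hf' (t := t) (by simp [t, hs])]
    refine Finset.sum_congr rfl fun x _ => ?_
    simp [entry_eq_apply]
    ring
  · rintro ⟨x, y⟩ hp
    have h1 : f x ≠ 0 := fun h => hp (by simp [h])
    have h2 : g y ≠ 0 := fun h => hp (by simp [h])
    simp [t, s, subset_tsupport f h1, subset_tsupport g h2]

end Config

/-- A countable measurable partition of `X` into relatively compact cells that contain at most one
point of each configuration. -/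
structure IsCellPartition [MeasurableSpace X] (V : ℕ → Set X) : Prop where
  measurable : ∀ j, MeasurableSet (V j)
  disjoint : Pairwise (Function.onFun Disjoint V)
  iUnion_eq : ⋃ j, V j = Set.univ
  isCompact_closure : ∀ j, IsCompact (closure (V j))
  dist_lt_one : ∀ j, ∀ x ∈ V j, ∀ y ∈ V j, dist x y < 1

-- Balls of radius at most 1/2 with compact closed ball cover X; a countable subcover is made
-- disjoint. Since every cell meets each configuration in at most one point, the cells index the
-- points of all configurations simultaneously.
variable (X) in
theorem exists_isCellPartition [LocallyCompactSpace X] [SecondCountableTopology X]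
    [MeasurableSpace X] [BorelSpace X] : ∃ V : ℕ → Set X, IsCellPartition V := by
  have h1 : ∀ x : X, ∃ r > 0, r ≤ 1 / 2 ∧ IsCompact (Metric.closedBall x r) := fun x => by
    obtain ⟨S, hS, hx⟩ := exists_compact_mem_nhds x
    obtain ⟨r, hr, hrS⟩ := Metric.nhds_basis_closedBall.mem_iff.1 hx
    refine ⟨min r (1 / 2), by positivity, min_le_right _ _,
      hS.of_isClosed_subset Metric.isClosed_closedBall
        ((Metric.closedBall_subset_closedBall (min_le_left _ _)).trans hrS)⟩
  choose r hr0 hr1 hr2 using h1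
  rcases isEmpty_or_nonempty X with hX | hX
  · exact ⟨fun _ => ∅, fun _ => MeasurableSet.empty, fun _ _ _ => by simp [Function.onFun],
      Set.eq_univ_of_forall fun x => isEmptyElim x, by simp, by simp⟩
  obtain ⟨t, htc, htU⟩ := TopologicalSpace.countable_cover_nhds
    (fun x : X => Metric.ball_mem_nhds x (hr0 x))
  have hne : t.Nonempty := by
    by_contra h
    rw [Set.not_nonempty_iff_eq_empty] at h
    subst h
    simp [Set.empty_ne_univ] at htU
  obtain ⟨c, rfl⟩ := htc.exists_eq_range hne
  set U : ℕ → Set X := fun n => Metric.ball (c n) (r (c n))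
  have hsub : ∀ j, disjointed U j ⊆ Metric.ball (c j) (r (c j)) := fun j => disjointed_le U j
  refine ⟨disjointed U, ?_, disjoint_disjointed U, ?_, ?_, ?_⟩
  · exact fun j => MeasurableSet.disjointed (fun n => Metric.isOpen_ball.measurableSet) j
  · rw [iUnion_disjointed]
    simpa using htU
  · exact fun j => (hr2 (c j)).of_isClosed_subset isClosed_closure
      (closure_minimal ((hsub j).trans Metric.ball_subset_closedBall) Metric.isClosed_closedBall)
  · intro j x hx y hy
    have h1 := Metric.mem_ball.1 (hsub j hx)
    have h2 := Metric.mem_ball.1 (hsub j hy)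
    linarith [dist_triangle_right x y (c j), hr1 (c j)]

theorem hasCompactSupport_indicator {S : Set X} (hS : IsCompact (closure S)) {E : Type*} [Zero E]
    (f : X → E) : HasCompactSupport (S.indicator f) :=
  hS.of_isClosed_subset (isClosed_tsupport _) (closure_mono Set.support_indicator_subset)

namespace Config

/-- The restriction of the indicator function of a set with at most one point. -/
theorem restr_indicator_eq_delta (ω : Config X K) {S : Set X} (hc : IsCompact (closure S))
    (hS : ∀ x ∈ S, ∀ y ∈ S, dist x y < 1) {z : ω.carrier} (hz : (z : X) ∈ S) :
    ω.restr (S.indicator 1) = ω.delta z := by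
  ext x
  rw [ω.restr_apply (hasCompactSupport_indicator hc _)]
  by_cases hx : x = z
  · subst hx
    simp [hz, delta_apply_self]
  · have : (x : X) ∉ S := fun h => hx (ω.eq_of_dist_lt_one (hS _ h _ hz))
    simp [this, ω.delta_apply_ne hx]

theorem restr_indicator_eq_zero (ω : Config X K) {S : Set X} (hc : IsCompact (closure S))
    (hS : ∀ z : ω.carrier, (z : X) ∉ S) : ω.restr (S.indicator 1) = 0 := by
  ext x
  rw [ω.restr_apply (hasCompactSupport_indicator hc _)]
  simp [hS x]

/-- Parseval's identity, with the sum over the points of the configuration replaced by the sum over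
the cells of a partition. -/
theorem hasSum_cells [MeasurableSpace X] (ω : Config X K) {V : ℕ → Set X}
    (hV : IsCellPartition V) (v w : ω.ell2) :
    HasSum (fun j => inner ℂ v (ω.restr ((V j).indicator 1)) *
      inner ℂ (ω.restr ((V j).indicator 1)) w) (inner ℂ v w) := by
  have hcell : ∀ x : ω.carrier, ∃ j, (x : X) ∈ V j := fun x => by
    simpa using hV.iUnion_eq.ge (Set.mem_univ (x : X))
  choose c hc using hcell
  -- Cells without a point contribute zero, so the sum over cells is the sum over points, reindexed
  -- along the injection `c`.
  have hinj : Function.Injective c := fun x y hxy =>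
    ω.eq_of_dist_lt_one (hV.dist_lt_one _ _ (hc x) _ (hxy ▸ hc y))
  rw [← hinj.hasSum_iff]
  · refine (lp.hasSum_inner v w).congr_fun fun x => ?_
    rw [Function.comp_apply, ω.restr_indicator_eq_delta (hV.isCompact_closure _)
      (hV.dist_lt_one _) (hc x),
      inner_delta_left, inner_delta_right, RCLike.inner_apply, mul_comm]
  · intro j hj
    rw [ω.restr_indicator_eq_zero (hV.isCompact_closure _), inner_zero_right, zero_mul]
    intro z hz
    refine hj ⟨z, ?_⟩
    by_contra hne
    exact Set.disjoint_left.1 (hV.disjoint hne) (hc z) hz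

end Config

end ConfigBasics

/-! ### From continuous to Borel test functions. -/

section Measurability

variable {X K : Type*} [MetricSpace X]

theorem Config.tendsto_finsum_mul (ω : Config X K) {S : Set X} (hS : IsCompact S)
    (c : ω.carrier → ℂ) {f : ℕ → X → ℂ} {g : X → ℂ} (hf : ∀ n, ∀ x ∉ S, f n x = 0)
    (hg : ∀ x ∉ S, g x = 0) (h : ∀ x, Tendsto (fun n => f n x) atTop (𝓝 (g x))) :
    Tendsto (fun n => ∑ᶠ x : ω.carrier, f n x * c x) atTop (𝓝 (∑ᶠ x : ω.carrier, g x * c x)) := by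
  have key : ∀ u : X → ℂ, (∀ x ∉ S, u x = 0) →
      ∑ᶠ x : ω.carrier, u x * c x = ∑ x ∈ (ω.finite_preimage hS).toFinset, u x * c x := by
    intro u hu
    refine finsum_eq_sum_of_support_subset _ fun x hx => ?_
    simp only [Set.Finite.coe_toFinset, Set.mem_preimage]
    by_contra hxS
    exact hx (by simp [hu _ hxS])
  rw [key g hg]
  simp only [fun n => key (f n) (hf n)]
  exact tendsto_finsetSum _ fun x _ => (h x).mul_const _

theorem Config.finsum_add_mul (ω : Config X K) (c : ω.carrier → ℂ) {f g : X → ℂ}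
    (hf : HasCompactSupport f) (hg : HasCompactSupport g) :
    ∑ᶠ x : ω.carrier, (f x + g x) * c x =
      ∑ᶠ x : ω.carrier, f x * c x + ∑ᶠ x : ω.carrier, g x * c x := by
  rw [← finsum_add_distrib]
  · simp only [add_mul]
  · exact (ω.finite_support hf).subset fun x hx h => hx (by simp [h])
  · exact (ω.finite_support hg).subset fun x hx h => hx (by simp [h])

theorem exists_compactlySupported_eq_one [LocallyCompactSpace X] {S : Set X} (hS : IsCompact S) :
    ∃ f : C_c(X, ℂ), ∀ x ∈ S, f x = 1 := by
  obtain ⟨f, hf, -, hc, -⟩ := exists_continuous_one_zero_of_isCompact hS isClosed_empty (by simp)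
  refine ⟨⟨⟨fun x => (f x : ℂ), by fun_prop⟩, hc.comp_left (g := ((↑) : ℝ → ℂ)) (by simp)⟩, ?_⟩
  intro x hx
  have := hf hx
  simp_all

theorem _root_.HasCompactSupport.conj {f : X → ℂ} (hf : HasCompactSupport f) :
    HasCompactSupport fun x => conj (f x) := hf.comp_left (map_zero _)

theorem Config.inner_restr_left (ω : Config X K) {f : X → ℂ} (hf : HasCompactSupport f)
    (v : ω.ell2) : inner ℂ (ω.restr f) v = ∑ᶠ x : ω.carrier, conj (f x) * v x := by
  rw [ω.inner_restr_eq_sum hf (t := (ω.finite_preimage hf).toFinset) (by simp)]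
  refine (finsum_eq_sum_of_support_subset _ fun x hx => ?_).symm
  have : f x ≠ 0 := fun h => hx (by simp [h])
  simp [subset_tsupport f this]

theorem Config.inner_restr_right (ω : Config X K) {f : X → ℂ} (hf : HasCompactSupport f)
    (v : ω.ell2) : inner ℂ v (ω.restr f) = ∑ᶠ x : ω.carrier, f x * conj (v x) := by
  rw [← inner_conj_symm, ω.inner_restr_eq_sum hf (t := (ω.finite_preimage hf).toFinset) (by simp),
    map_sum]
  simp only [map_mul, Complex.conj_conj]
  refine (finsum_eq_sum_of_support_subset _ fun x hx => ?_).symm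
  have : f x ≠ 0 := fun h => hx (by simp [h])
  simp [subset_tsupport f this]

/-- Passage to the limit in a random complex measure carried by the points of the configuration. -/
theorem aemeasurable_finsum_of_tendsto [TopologicalSpace K] {μ : Measure (Config X K)}
    {c : ∀ ω : Config X K, ω.carrier → ℂ} {S : Set X} (hS : IsCompact S) {v : ℕ → X → ℂ}
    {w : X → ℂ} (hv : ∀ n, ∀ x ∉ S, v n x = 0) (hw : ∀ x ∉ S, w x = 0)
    (hvw : ∀ x, Tendsto (fun n => v n x) atTop (𝓝 (w x)))
    (h : ∀ n, AEMeasurable (fun ω => ∑ᶠ x : ω.carrier, v n x * c ω x) μ) :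
    AEMeasurable (fun ω => ∑ᶠ x : ω.carrier, w x * c ω x) μ :=
  aemeasurable_of_tendsto_metrizable_ae atTop h (Eventually.of_forall fun ω =>
    ω.tendsto_finsum_mul hS (c ω) hv hw hvw)

theorem _root_.hasSum_indicator_iUnion {X : Type*} {B : ℕ → Set X}
    (hd : Pairwise (Function.onFun Disjoint B)) (x : X) :
    HasSum (fun i => (B i).indicator (1 : X → ℂ) x) ((⋃ i, B i).indicator (1 : X → ℂ) x) := by
  by_cases hx : x ∈ ⋃ i, B i
  · obtain ⟨i, hi⟩ := Set.mem_iUnion.1 hx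
    rw [Set.indicator_of_mem hx, ← Set.indicator_of_mem hi (1 : X → ℂ)]
    exact hasSum_single i fun j hj => Set.indicator_of_notMem
      (fun hxj => Set.disjoint_left.1 (hd hj) hxj hi) _
  · have : (fun i => (B i).indicator (1 : X → ℂ) x) = fun _ => 0 := funext fun i =>
      Set.indicator_of_notMem (fun hi => hx (Set.mem_iUnion.2 ⟨i, hi⟩)) _
    rw [Set.indicator_of_notMem hx, this]
    exact hasSum_zero

/-- Distinct points are at distance at least 1, so max(0, 1 − d(x,y)) agrees with the indicator of
the diagonal on X(ω) × X(ω). The matrix elements of the identity are therefore pair sums of a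
continuous test function. -/
theorem isMeasurableField_one [TopologicalSpace K] [CompactSpace K] [T2Space K]
    {μ : Measure (Config X K)} : IsMeasurableField μ (fun _ : Config X K => 1) := by
  intro f g
  let φ : C_c(X × X × K, ℂ) :=
    { toFun := fun p => f p.1 * ((max 0 (1 - dist p.1 p.2.1) : ℝ) : ℂ) * g p.2.1
      continuous_toFun := by fun_prop
      hasCompactSupport' := by
        refine HasCompactSupport.intro (f.hasCompactSupport.isCompact.prod
          (g.hasCompactSupport.isCompact.prod isCompact_univ)) ?_
        rintro ⟨x, y, k⟩ hp
        by_cases hx : x ∈ tsupport f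
        · have hy : y ∉ tsupport g := fun hy => hp ⟨hx, hy, trivial⟩
          simp [image_eq_zero_of_notMem_tsupport hy]
        · simp [image_eq_zero_of_notMem_tsupport hx] }
  have h0 : Continuous (Config.pairSum : Config X K → C_c(X × X × K, ℂ) → ℂ) :=
    continuous_induced_dom
  have hm : Continuous (fun ω : Config X K => ω.pairSum φ) := continuous_pi_iff.1 h0 φ
  refine hm.measurable.aemeasurable.congr (Eventually.of_forall fun ω => ?_)
  refine finsum_congr fun p => ?_
  obtain ⟨x, y⟩ := p
  by_cases hxy : x = y
  · subst hxy
    simp [φ, Config.entry_eq_apply, ω.delta_apply_self]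
  · have h1 : 1 ≤ dist (x : X) y := ω.one_le_dist _ x.2 _ y.2 fun h => hxy (Subtype.ext h)
    simp [φ, Config.entry_eq_apply, ω.delta_apply_ne hxy, h1]

variable [MeasurableSpace X] [BorelSpace X] [TopologicalSpace K] {μ : Measure (Config X K)}

/-- A Dynkin class argument starting from closed sets, whose indicators are limits of thickened
indicators. The factor `f₀` keeps all sums finite, so that complements and limits are legitimate. -/
theorem aemeasurable_finsum_indicator {c : ∀ ω : Config X K, ω.carrier → ℂ}
    (h : ∀ f : C_c(X, ℂ), AEMeasurable (fun ω => ∑ᶠ x : ω.carrier, f x * c ω x) μ)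
    (f₀ : C_c(X, ℂ)) {B : Set X} (hB : MeasurableSet B) :
    AEMeasurable (fun ω => ∑ᶠ x : ω.carrier, (B.indicator 1 x * f₀ x) * c ω x) μ := by
  have hcs : ∀ v : X → ℂ, HasCompactSupport fun x => v x * f₀ x := fun v =>
    f₀.hasCompactSupport.mul_left
  have hz : ∀ v : X → ℂ, ∀ x ∉ tsupport f₀, v x * f₀ x = 0 := fun v x hx => by
    simp [image_eq_zero_of_notMem_tsupport hx]
  induction B, hB using MeasurableSpace.induction_on_inter
    ((BorelSpace.measurable_eq (α := X)).trans borel_eq_generateFrom_isClosed)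
    isPiSystem_isClosed with
  | empty => simp
  | basic F hF =>
    have hF : IsClosed F := hF
    refine aemeasurable_finsum_of_tendsto f₀.hasCompactSupport
      (v := fun n x => (((thickenedIndicator (δ := 1 / ((n : ℝ) + 1)) (by positivity) F x :
        ℝ≥0) : ℝ) : ℂ) * f₀ x) (fun n => hz _) (hz _) (fun x => ?_) fun n => ?_
    · have h1 := thickenedIndicator_tendsto_indicator_closure
        (δseq := fun n : ℕ => 1 / ((n : ℝ) + 1)) (fun n => by positivity)
        tendsto_one_div_add_atTop_nhds_zero_nat F
      rw [hF.closure_eq] at h1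
      have h2 := (Complex.continuous_ofReal.comp NNReal.continuous_coe).tendsto _ |>.comp
        (tendsto_pi_nhds.1 h1 x)
      have h3 : (Complex.ofReal ∘ NNReal.toReal) (F.indicator (fun _ => 1) x) =
          F.indicator 1 x := by
        by_cases hx : x ∈ F <;> simp [hx]
      rw [h3] at h2
      exact h2.mul_const _
    · exact h ⟨⟨fun x => (((thickenedIndicator (δ := 1 / ((n : ℝ) + 1)) (by positivity) F x :
        ℝ≥0) : ℝ) : ℂ) * f₀ x, by fun_prop⟩, hcs _⟩
  | compl B hB ih =>
    have : ∀ ω : Config X K, ∑ᶠ x : ω.carrier, (Bᶜ.indicator 1 x * f₀ x) * c ω x =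
        ∑ᶠ x : ω.carrier, f₀ x * c ω x -
          ∑ᶠ x : ω.carrier, (B.indicator 1 x * f₀ x) * c ω x := fun ω => by
      rw [eq_sub_iff_add_eq, ← ω.finsum_add_mul (c ω) (hcs _) (hcs _)]
      refine finsum_congr fun x => ?_
      by_cases hx : (x : X) ∈ B <;> simp [hx]
    simp only [this]
    exact (h f₀).sub ih
  | iUnion B hd hB ih =>
    refine aemeasurable_finsum_of_tendsto f₀.hasCompactSupport
      (v := fun n x => (∑ i ∈ Finset.range n, (B i).indicator 1 x) * f₀ x)
      (fun n => hz (fun x => ∑ i ∈ Finset.range n, (B i).indicator 1 x)) (hz _)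
      (fun x => (hasSum_indicator_iUnion hd x).tendsto_sum_nat.mul_const _) fun n => ?_
    induction n with
    | zero => simp
    | succ n ihn =>
      refine (ihn.add (ih n)).congr (Eventually.of_forall fun ω => ?_)
      simp only [Pi.add_apply]
      rw [← ω.finsum_add_mul (c ω) (hcs fun x => ∑ i ∈ Finset.range n, (B i).indicator 1 x)
        (hcs _)]
      refine finsum_congr fun x => ?_
      rw [Finset.sum_range_succ]
      ring

/-- Measurability of a field of operators, tested on Borel functions. -/
def IsBorelField (μ : Measure (Config X K)) (T : OperatorField X K) : Prop :=
  ∀ f g : X → ℂ, Measurable f → Measurable g → HasCompactSupport f → HasCompactSupport g →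
    AEMeasurable (fun ω => inner ℂ (ω.restr f) (T ω (ω.restr g))) μ

theorem IsBorelField.isMeasurableField {T : OperatorField X K} (hT : IsBorelField μ T) :
    IsMeasurableField μ T := by
  intro f g
  simp only [fun ω : Config X K => ω.finsum_entry_eq_inner (T ω) f.hasCompactSupport
    g.hasCompactSupport]
  exact hT _ _ (by fun_prop) (by fun_prop) f.hasCompactSupport.conj g.hasCompactSupport

variable [LocallyCompactSpace X]

/-- A random complex measure carried by the points of the configuration is measurable if it is
measurable on continuous functions. -/
theorem aemeasurable_finsum_of_compactlySupported {c : ∀ ω : Config X K, ω.carrier → ℂ}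
    (h : ∀ f : C_c(X, ℂ), AEMeasurable (fun ω => ∑ᶠ x : ω.carrier, f x * c ω x) μ)
    {u : X → ℂ} (hu : Measurable u) (huc : HasCompactSupport u) :
    AEMeasurable (fun ω => ∑ᶠ x : ω.carrier, u x * c ω x) μ := by
  -- The cutoff confines the approximating simple functions to one compact set. It equals 1 on the
  -- support of `u`, so nothing is lost in the limit.
  obtain ⟨f₀, hf₀⟩ := exists_compactlySupported_eq_one huc
  have hcs : ∀ v : X → ℂ, HasCompactSupport fun x => v x * f₀ x := fun v =>
    f₀.hasCompactSupport.mul_left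
  have hz : ∀ v : X → ℂ, ∀ x ∉ tsupport f₀, v x * f₀ x = 0 := fun v x hx => by
    simp [image_eq_zero_of_notMem_tsupport hx]
  have hsimple : ∀ v : SimpleFunc X ℂ,
      AEMeasurable (fun ω => ∑ᶠ x : ω.carrier, (v x * f₀ x) * c ω x) μ := by
    intro v
    induction v using SimpleFunc.induction with
    | const a hB =>
      rename_i B
      refine ((aemeasurable_finsum_indicator h f₀ hB).const_mul a).congr
        (Eventually.of_forall fun ω => ?_)
      beta_reduce
      rw [mul_finsum]
      refine finsum_congr fun x => ?_
      by_cases hx : (x : X) ∈ B <;> simp [hx, mul_assoc]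
    | add _ hv hw =>
      rename_i v w _
      refine (hv.add hw).congr (Eventually.of_forall fun ω => ?_)
      simp only [Pi.add_apply]
      rw [← ω.finsum_add_mul (c ω) (hcs _) (hcs _)]
      exact finsum_congr fun x => by simp [add_mul]
  refine aemeasurable_finsum_of_tendsto (S := tsupport f₀)
    (v := fun n x => hu.stronglyMeasurable.approx n x * f₀ x) f₀.hasCompactSupport
    (fun n => hz _) (fun x hx => ?_) (fun x => ?_) fun n => hsimple _
  · by_contra hne
    have := hf₀ x (subset_tsupport u hne)
    rw [image_eq_zero_of_notMem_tsupport hx] at this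
    exact zero_ne_one this
  · by_cases hx : x ∈ tsupport u
    · simpa [hf₀ x hx] using hu.stronglyMeasurable.tendsto_approx x
    · simpa [image_eq_zero_of_notMem_tsupport hx] using
        (hu.stronglyMeasurable.tendsto_approx x).mul_const (f₀ x)

/-- The two test functions are enlarged one at a time: first `g`, with `f` continuous and the
operator moved to the left slot by its adjoint, then `f` with `g` already Borel. -/
theorem IsMeasurableField.isBorelField {T : OperatorField X K} (hT : IsMeasurableField μ T) :
    IsBorelField μ T := by
  have h1 : ∀ (f g : X → ℂ), Measurable g → HasCompactSupport g → Continuous f →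
      HasCompactSupport f → AEMeasurable (fun ω => inner ℂ (ω.restr f) (T ω (ω.restr g))) μ := by
    intro f g hg hgc hf hfc
    simp only [← ContinuousLinearMap.adjoint_inner_left]
    simp only [fun ω : Config X K => ω.inner_restr_right hgc]
    refine aemeasurable_finsum_of_compactlySupported (fun g' => ?_) hg hgc
    simp only [← fun ω : Config X K => ω.inner_restr_right g'.hasCompactSupport,
      ContinuousLinearMap.adjoint_inner_left]
    have := hT ⟨⟨fun x => conj (f x), by fun_prop⟩, hfc.conj⟩ g'
    refine this.congr (Eventually.of_forall fun ω => ?_)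
    beta_reduce
    rw [Config.finsum_entry_eq_inner ω (T ω) (CompactlySupportedContinuousMap.hasCompactSupport _)
      g'.hasCompactSupport]
    simp
  intro f g hf hg hfc hgc
  simp only [fun ω : Config X K => ω.inner_restr_left hfc]
  refine aemeasurable_finsum_of_compactlySupported (u := fun x => conj (f x))
    (fun f' => ?_) (by fun_prop) hfc.conj
  have := h1 (fun x => conj (f' x)) g hg hgc (by fun_prop) f'.hasCompactSupport.conj
  simpa only [fun ω : Config X K => ω.inner_restr_left f'.hasCompactSupport.conj,
    Complex.conj_conj] using this

end Measurability

/-! ### Functional calculus and the eigenprojection as a limit of tent functions. -/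

section Spectral

theorem mem_ker_sub_smul_one {V : Type*} [NormedAddCommGroup V] [InnerProductSpace ℂ V]
    {T : V →L[ℂ] V} {lam : ℝ} {v : V} :
    v ∈ (T - (lam : ℂ) • 1).ker ↔ T v = (lam : ℂ) • v := by
  simp [sub_eq_zero]

variable {V W : Type*} [NormedAddCommGroup V] [InnerProductSpace ℂ V] [CompleteSpace V]
  [NormedAddCommGroup W] [InnerProductSpace ℂ W] [CompleteSpace W]

/-- The operator `φ(T)`, for `T` selfadjoint and `φ : ℝ → ℝ` continuous. -/
def contFun (φ : ℝ → ℝ) (T : V →L[ℂ] V) : V →L[ℂ] V := cfc φ T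

theorem applyFun_eq_contFun (φ : C_c(ℝ, ℝ)) (T : V →L[ℂ] V) : applyFun φ T = contFun φ T := rfl

theorem applyFun_add (φ ψ : C_c(ℝ, ℝ)) (T : V →L[ℂ] V) :
    applyFun (φ + ψ) T = applyFun φ T + applyFun ψ T :=
  cfc_add T (φ : ℝ → ℝ) ψ φ.continuous.continuousOn ψ.continuous.continuousOn

theorem applyFun_smul (c : ℝ) (φ : C_c(ℝ, ℝ)) (T : V →L[ℂ] V) :
    applyFun (c • φ) T = (c : ℂ) • applyFun φ T := by
  rw [Complex.coe_smul]
  exact cfc_smul c (φ : ℝ → ℝ) T φ.continuous.continuousOn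

theorem abs_le_norm_of_mem_spectrum {T : V →L[ℂ] V} {x : ℝ} (hx : x ∈ spectrum ℝ T) :
    |x| ≤ ‖T‖ :=
  (spectrum.norm_le_norm_mul_of_mem hx).trans
    (mul_le_of_le_one_right (norm_nonneg _) ContinuousLinearMap.norm_id_le)

/-- The spectrum lies in [−C, C], so uniform approximation there gives convergence in norm. One
sequence of polynomials serves all operators with norm at most C. -/
theorem tendsto_aeval_contFun {T : V →L[ℂ] V} (hT : IsSelfAdjoint T) {C : ℝ} (hC : ‖T‖ ≤ C)
    {φ : ℝ → ℝ} (hφ : Continuous φ) {p : ℕ → Polynomial ℝ}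
    (hp : ∀ n : ℕ, ∀ x ∈ Set.Icc (-C) C, |(p n).eval x - φ x| < 1 / ((n : ℝ) + 1)) :
    Tendsto (fun n => Polynomial.aeval T (p n)) atTop (𝓝 (contFun φ T)) := by
  rw [tendsto_iff_norm_sub_tendsto_zero]
  refine squeeze_zero (fun _ => norm_nonneg _) (fun n => ?_)
    tendsto_one_div_add_atTop_nhds_zero_nat
  rw [contFun, ← cfc_polynomial (p n) T hT, ← cfc_sub _ _ T (by fun_prop) hφ.continuousOn]
  refine norm_cfc_le (by positivity) fun x hx => ?_
  exact (hp n x (abs_le.1 ((abs_le_norm_of_mem_spectrum hx).trans hC))).le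

/-- No selfadjointness is required here or in the next two statements: on other operators `cfc`
takes the value 0. -/
theorem contFun_nonneg {φ : ℝ → ℝ} (hφ : ∀ x, 0 ≤ φ x) (T : V →L[ℂ] V) : 0 ≤ contFun φ T :=
  cfc_nonneg fun x _ => hφ x

theorem norm_contFun_le {φ : ℝ → ℝ} {c : ℝ} (hc : ∀ x, |φ x| ≤ c) (T : V →L[ℂ] V) :
    ‖contFun φ T‖ ≤ c :=
  norm_cfc_le ((abs_nonneg _).trans (hc 0)) fun x _ => hc x

theorem isSelfAdjoint_contFun (φ : ℝ → ℝ) (T : V →L[ℂ] V) : IsSelfAdjoint (contFun φ T) :=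
  cfc_predicate φ T

theorem contFun_sub {φ ψ : ℝ → ℝ} (hφ : Continuous φ) (hψ : Continuous ψ) (T : V →L[ℂ] V) :
    contFun (fun x => φ x - ψ x) T = contFun φ T - contFun ψ T :=
  cfc_sub φ ψ T hφ.continuousOn hψ.continuousOn

/-- Conjugation by a unitary is a continuous star-algebra equivalence, and the functional calculus
commutes with such maps. -/
theorem contFun_conj (U : V ≃ₗᵢ[ℂ] W) {φ : ℝ → ℝ} (hφ : Continuous φ) {T : V →L[ℂ] V}
    (hT : IsSelfAdjoint T) {S : W →L[ℂ] W} (hS : ∀ v, S (U v) = U (T v)) (v : V) :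
    contFun φ S (U v) = U (contFun φ T v) := by
  have hST : S = U.conjStarAlgEquiv T := by
    ext w
    simp [← hS]
  have hcont : Continuous U.conjStarAlgEquiv := by
    refine Continuous.congr (f := fun A : V →L[ℂ] V =>
      (U : V →L[ℂ] W) ∘L A ∘L (U.symm : W →L[ℂ] V)) ?_ fun A => rfl
    exact continuous_const.clm_comp (continuous_id.clm_comp continuous_const)
  have h := StarAlgHomClass.map_cfc (S := ℂ) U.conjStarAlgEquiv φ T hφ.continuousOn hcont hT
    (hT.map _)
  rw [contFun, hST, ← h]
  simp [contFun]

/-- The orthogonal projection onto the kernel of `T - lam`. -/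
def eigenProjection (T : V →L[ℂ] V) (lam : ℝ) : V →L[ℂ] V :=
  (T - (lam : ℂ) • 1).ker.starProjection

/-- Tent functions that decrease to the indicator function of a point. -/
def tent (lam : ℝ) (n : ℕ) : C_c(ℝ, ℝ) where
  toFun t := max 0 (1 - ((n : ℝ) + 1) * |t - lam|)
  continuous_toFun := by fun_prop
  hasCompactSupport' := by
    refine HasCompactSupport.intro (isCompact_closedBall lam 1) fun t ht => ?_
    rw [Metric.mem_closedBall, Real.dist_eq, not_le] at ht
    refine max_eq_left ?_
    nlinarith [(Nat.cast_nonneg n : (0 : ℝ) ≤ n), ht]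

theorem tent_apply (lam : ℝ) (n : ℕ) (t : ℝ) :
    tent lam n t = max 0 (1 - ((n : ℝ) + 1) * |t - lam|) := rfl

theorem tent_nonneg (lam : ℝ) (n : ℕ) (t : ℝ) : 0 ≤ tent lam n t := le_max_left _ _

theorem tent_le_one (lam : ℝ) (n : ℕ) (t : ℝ) : tent lam n t ≤ 1 := by
  rw [tent_apply]
  refine max_le zero_le_one ?_
  have : 0 ≤ ((n : ℝ) + 1) * |t - lam| := by positivity
  linarith

theorem abs_tent_le_one (lam : ℝ) (n : ℕ) (t : ℝ) : |tent lam n t| ≤ 1 := by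
  rw [abs_of_nonneg (tent_nonneg _ _ _)]
  exact tent_le_one _ _ _

theorem abs_tent_mul_le (lam : ℝ) (n : ℕ) (t : ℝ) :
    |tent lam n t * (t - lam)| ≤ 1 / ((n : ℝ) + 1) := by
  have hn : (0 : ℝ) < (n : ℝ) + 1 := by positivity
  rw [abs_mul, abs_of_nonneg (tent_nonneg _ _ _), le_div_iff₀ hn]
  by_cases h : ((n : ℝ) + 1) * |t - lam| ≤ 1
  · nlinarith [tent_nonneg lam n t, tent_le_one lam n t, abs_nonneg (t - lam),
      mul_nonneg hn.le (abs_nonneg (t - lam))]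
  · rw [tent_apply, max_eq_left (by linarith)]
    simp

theorem sq_one_sub_tent_le (lam : ℝ) (n : ℕ) (t : ℝ) :
    (1 - tent lam n t) * (1 - tent lam n t) ≤ ((n : ℝ) + 1) ^ 2 * ((t - lam) * (t - lam)) := by
  have h1 : 1 - tent lam n t ≤ ((n : ℝ) + 1) * |t - lam| := by
    rw [tent_apply]
    linarith [le_max_right 0 (1 - ((n : ℝ) + 1) * |t - lam|)]
  have h2 : 0 ≤ 1 - tent lam n t := by linarith [tent_le_one lam n t]
  calc _ ≤ (((n : ℝ) + 1) * |t - lam|) * (((n : ℝ) + 1) * |t - lam|) :=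
        mul_le_mul h1 h1 h2 (h2.trans h1)
    _ = _ := by
      rw [← abs_mul_abs_self (t - lam)]
      ring

theorem tendsto_tent (lam t : ℝ) :
    Tendsto (fun n => tent lam n t) atTop (𝓝 (({lam} : Set ℝ).indicator 1 t)) := by
  by_cases h : t = lam
  · subst h
    simp [tent_apply]
  · have h0 : 0 < |t - lam| := abs_pos.2 (sub_ne_zero.2 h)
    rw [Set.indicator_of_notMem (s := {lam}) h]
    obtain ⟨N, hN⟩ := exists_nat_gt (1 / |t - lam|)
    refine tendsto_const_nhds.congr' ?_
    filter_upwards [eventually_ge_atTop N] with n hn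
    rw [tent_apply, max_eq_left]
    rw [div_lt_iff₀ h0] at hN
    have : (N : ℝ) ≤ n := by exact_mod_cast hn
    nlinarith

theorem tendsto_integral_tent (ν : Measure ℝ) [IsLocallyFiniteMeasure ν] (lam : ℝ) :
    Tendsto (fun n => ∫ t, tent lam n t ∂ν) atTop (𝓝 (ν.real {lam})) := by
  rw [← integral_indicator_one (measurableSet_singleton lam)]
  refine tendsto_integral_of_dominated_convergence (fun t => tent lam 0 t)
    (fun n => (tent lam n).continuous.aestronglyMeasurable)
    ((tent lam 0).continuous.integrable_of_hasCompactSupport (tent lam 0).hasCompactSupport)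
    (fun n => Eventually.of_forall fun t => ?_) (Eventually.of_forall fun t => tendsto_tent lam t)
  rw [Real.norm_of_nonneg (tent_nonneg _ _ _), tent_apply, tent_apply]
  refine max_le_max le_rfl ?_
  have : (0 : ℝ) ≤ n * |t - lam| := by positivity
  push_cast
  linarith

/-- By `sq_one_sub_tent_le`, ‖(1 − tent)(T) v‖² ≤ (n+1)² ‖(T − λ) v‖², and the right side is zero.
-/
theorem contFun_tent_apply_of_eigenvector {T : V →L[ℂ] V} (hT : IsSelfAdjoint T) {lam : ℝ} (n : ℕ)
    {v : V} (hv : T v = (lam : ℂ) • v) : contFun (tent lam n) T v = v := by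
  set c : ℝ := (n : ℝ) + 1
  set A := contFun (fun t => 1 - tent lam n t) T with hA
  set B := contFun (fun t => t - lam) T with hB
  have hcA : Continuous fun t => 1 - tent lam n t := by fun_prop
  have hcB : Continuous fun t : ℝ => t - lam := by fun_prop
  have hA' : A = 1 - contFun (tent lam n) T := by
    rw [hA, contFun_sub (φ := fun _ => 1) (ψ := tent lam n) continuous_const
      (tent lam n).continuous]
    congr 1
    exact cfc_const_one ℝ T
  have hB' : B = T - (lam : ℂ) • 1 := by
    rw [hB, contFun_sub (φ := fun t => t) (ψ := fun _ => lam) continuous_id continuous_const]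
    congr 1
    · exact cfc_id' ℝ T
    · rw [contFun, cfc_const lam T, Algebra.algebraMap_eq_smul_one, Complex.coe_smul]
  have hBv : B v = 0 := by simp [hB', hv]
  have hle : A * A ≤ (c ^ 2) • (B * B) := by
    have e1 : A * A = cfc (fun t => (1 - tent lam n t) * (1 - tent lam n t)) T :=
      (cfc_mul _ _ T hcA.continuousOn hcA.continuousOn).symm
    have e2 : (c ^ 2) • (B * B) = cfc (fun t => c ^ 2 • ((t - lam) * (t - lam))) T := by
      rw [cfc_smul _ _ T (by fun_prop), cfc_mul _ _ T hcB.continuousOn hcB.continuousOn]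
      rfl
    rw [e1, e2]
    exact cfc_mono (fun t _ => sq_one_sub_tent_le lam n t) (by fun_prop) (by fun_prop)
  have h := ((ContinuousLinearMap.nonneg_iff_isPositive _).1
    (sub_nonneg.2 hle)).re_inner_nonneg_right v
  have hAsa : IsSelfAdjoint A := isSelfAdjoint_contFun _ T
  have hAA : inner ℂ v (A (A v)) = ((‖A v‖ ^ 2 : ℝ) : ℂ) := by
    rw [← ContinuousLinearMap.adjoint_inner_left, ← ContinuousLinearMap.star_eq_adjoint,
      hAsa.star_eq, inner_self_eq_norm_sq_to_K]
    push_cast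
    rfl
  have h3 : ‖A v‖ ^ 2 ≤ 0 := by
    have h4 : ((c ^ 2) • (B * B) - A * A) v = - A (A v) := by simp [hBv]
    have h5 : RCLike.re (((‖A v‖ ^ 2 : ℝ)) : ℂ) = ‖A v‖ ^ 2 := Complex.ofReal_re _
    rw [h4, inner_neg_right, hAA, map_neg, h5] at h
    linarith
  have h5 : A v = 0 := by
    rw [← norm_eq_zero]
    exact pow_eq_zero_iff two_ne_zero |>.1 (le_antisymm h3 (sq_nonneg _))
  rw [hA'] at h5
  have : v - contFun (tent lam n) T v = 0 := by simpa using h5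
  exact (sub_eq_zero.1 this).symm

theorem norm_contFun_tent_le (T : V →L[ℂ] V) (lam : ℝ) (n : ℕ) : ‖contFun (tent lam n) T‖ ≤ 1 :=
  norm_contFun_le (abs_tent_le_one lam n) T

/-- On ker(T − λ) every tent acts as the identity. The orthogonal complement is the closure of the
range of T − λ, where the limit is zero because tent(T)(T − λ) has norm at most 1/(n+1) and the
tents are contractions. -/
theorem tendsto_contFun_tent {T : V →L[ℂ] V} (hT : IsSelfAdjoint T) (lam : ℝ) (v : V) :
    Tendsto (fun n => contFun (tent lam n) T v) atTop (𝓝 (eigenProjection T lam v)) := by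
  have hD : ContinuousLinearMap.adjoint (T - (lam : ℂ) • 1) = T - (lam : ℂ) • 1 := by
    rw [← ContinuousLinearMap.star_eq_adjoint, star_sub, hT.star_eq, star_smul]
    simp
  have hrange : ∀ w : V, Tendsto (fun n => contFun (tent lam n) T ((T - (lam : ℂ) • 1) w)) atTop
      (𝓝 0) := fun w => by
    have h1 : ∀ n, ‖contFun (tent lam n) T * (T - (lam : ℂ) • 1)‖ ≤ 1 / ((n : ℝ) + 1) := fun n => by
      have e : contFun (tent lam n) T * (T - (lam : ℂ) • 1) =
          contFun (fun t => tent lam n t * (t - lam)) T := by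
        rw [contFun, contFun, cfc_mul (tent lam n) _ T (tent lam n).continuous.continuousOn
          (by fun_prop), cfc_sub _ _ T (by fun_prop) (by fun_prop), cfc_id' ℝ T, cfc_const lam T,
          Algebra.algebraMap_eq_smul_one, Complex.coe_smul]
      rw [e]
      exact norm_contFun_le (abs_tent_mul_le lam n) T
    refine squeeze_zero_norm (a := fun n : ℕ => 1 / ((n : ℝ) + 1) * ‖w‖) (fun n => ?_) ?_
    · exact (ContinuousLinearMap.le_opNorm (contFun (tent lam n) T * (T - (lam : ℂ) • 1)) w).trans
        (mul_le_mul_of_nonneg_right (h1 n) (norm_nonneg _))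
    · simpa using tendsto_one_div_add_atTop_nhds_zero_nat.mul_const ‖w‖
  have horth : ∀ w ∈ (T - (lam : ℂ) • 1).kerᗮ,
      Tendsto (fun n => contFun (tent lam n) T w) atTop (𝓝 0) := by
    intro w hw
    -- Selfadjointness of T − λ turns the complement of its kernel into the closure of its range.
    rw [ContinuousLinearMap.orthogonal_ker, hD] at hw
    rw [Metric.tendsto_atTop]
    intro ε hε
    obtain ⟨_, ⟨u, rfl⟩, hu⟩ := Metric.mem_closure_iff.1 hw (ε / 2) (by positivity)
    obtain ⟨N, hN⟩ := Metric.tendsto_atTop.1 (hrange u) (ε / 2) (by positivity)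
    refine ⟨N, fun n hn => ?_⟩
    have h1 := hN n hn
    rw [dist_zero_right] at h1 ⊢
    rw [dist_eq_norm] at hu
    have h2 : ‖contFun (tent lam n) T (w - (T - (lam : ℂ) • 1) u)‖ < ε / 2 := by
      refine lt_of_le_of_lt
        (ContinuousLinearMap.le_of_opNorm_le _ (norm_contFun_tent_le T lam n) _) ?_
      rw [one_mul]
      exact hu
    rw [map_sub] at h2
    calc _ = ‖(contFun (tent lam n) T w - contFun (tent lam n) T ((T - (lam : ℂ) • 1) u)) +
          contFun (tent lam n) T ((T - (lam : ℂ) • 1) u)‖ := by rw [sub_add_cancel]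
      _ ≤ _ := norm_add_le _ _
      _ < ε := by linarith
  have h1 : ∀ n, contFun (tent lam n) T (eigenProjection T lam v) +
      contFun (tent lam n) T (v - eigenProjection T lam v) = contFun (tent lam n) T v := fun n => by
    rw [← map_add, add_sub_cancel]
  simp only [← h1]
  have hmem : T (eigenProjection T lam v) = (lam : ℂ) • eigenProjection T lam v :=
    mem_ker_sub_smul_one.1 (Submodule.starProjection_apply_mem _ v)
  simp only [contFun_tent_apply_of_eigenvector hT _ hmem]
  have h2 := (tendsto_const_nhds (x := eigenProjection T lam v)).add
    (horth _ (Submodule.sub_starProjection_mem_orthogonal v))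
  rwa [add_zero] at h2

/-- Both quadratic forms are limits of ⟨v, tent(T) v⟩. A bounded operator on a complex space is
determined by its quadratic form, so the operator chosen in `spectralProjection` is the
eigenprojection. -/
theorem spectralProjection_singleton {T : V →L[ℂ] V} (hT : IsSelfAdjoint T) (lam : ℝ) :
    spectralProjection T {lam} = eigenProjection T lam := by
  have key : ∀ v, inner ℂ v (eigenProjection T lam v) =
      ((spectralMeasure T v).real {lam} : ℂ) := fun v => by
    have h1 : Tendsto (fun n => ((∫ t, tent lam n t ∂(spectralMeasure T v) : ℝ) : ℂ)) atTop
        (𝓝 ((spectralMeasure T v).real {lam} : ℂ)) := by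
      have : IsLocallyFiniteMeasure (spectralMeasure T v) := by
        unfold spectralMeasure
        infer_instance
      exact (Complex.continuous_ofReal.tendsto _).comp (tendsto_integral_tent _ lam)
    have h2 : Tendsto (fun n => inner ℂ v (contFun (tent lam n) T v)) atTop
        (𝓝 (inner ℂ v (eigenProjection T lam v))) :=
      tendsto_const_nhds.inner (tendsto_contFun_tent hT lam v)
    refine tendsto_nhds_unique (h2.congr fun n => ?_) h1
    rw [spectralMeasure, RealRMK.integral_rieszMeasure]
    have hpos := ((ContinuousLinearMap.nonneg_iff_isPositive _).1
      (contFun_nonneg (tent_nonneg lam n) T)).inner_nonneg_right v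
    exact (Complex.eq_re_of_ofReal_le hpos)
  have hex : ∃ P : V →L[ℂ] V, ∀ v, inner ℂ v (P v) = ((spectralMeasure T v).real {lam} : ℂ) :=
    ⟨_, key⟩
  rw [spectralProjection, dif_pos hex]
  have h := hex.choose_spec
  refine ContinuousLinearMap.coe_injective ((ext_inner_map _ _).1 fun v => ?_)
  rw [← inner_conj_symm, ← inner_conj_symm (_ : V) v]
  congr 1
  exact (h v).trans (key v).symm

end Spectral

/-! ### Measurable fields are closed under algebra, limits and functional calculus. -/

section FieldAlgebra

variable {X K : Type*} [MetricSpace X] [MeasurableSpace X] [TopologicalSpace K]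
  {μ : Measure (Config X K)}

namespace IsBorelField

variable {S T : OperatorField X K}

theorem congr_ae (hT : IsBorelField μ T) (h : ∀ᵐ ω ∂μ, T ω = S ω) : IsBorelField μ S := by
  intro f g hf hg hfc hgc
  refine (hT f g hf hg hfc hgc).congr ?_
  filter_upwards [h] with ω hω
  rw [hω]

/-- A pointwise weak limit of measurable fields is measurable. -/
theorem of_tendsto {F : ℕ → OperatorField X K} (hF : ∀ n, IsBorelField μ (F n))
    (h : ∀ᵐ ω ∂μ, ∀ v w : ω.ell2,
      Tendsto (fun n => inner ℂ v (F n ω w)) atTop (𝓝 (inner ℂ v (T ω w)))) :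
    IsBorelField μ T := by
  intro f g hf hg hfc hgc
  refine aemeasurable_of_tendsto_metrizable_ae atTop (fun n => hF n f g hf hg hfc hgc) ?_
  filter_upwards [h] with ω hω
  exact hω _ _

theorem add (hS : IsBorelField μ S) (hT : IsBorelField μ T) :
    IsBorelField μ (fun ω => S ω + T ω) := by
  intro f g hf hg hfc hgc
  simp only [add_apply, inner_add_right]
  exact (hS f g hf hg hfc hgc).add (hT f g hf hg hfc hgc)

theorem sub (hS : IsBorelField μ S) (hT : IsBorelField μ T) :
    IsBorelField μ (fun ω => S ω - T ω) := by
  intro f g hf hg hfc hgc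
  simp only [sub_apply, inner_sub_right]
  exact (hS f g hf hg hfc hgc).sub (hT f g hf hg hfc hgc)

theorem smul (c : ℂ) (hT : IsBorelField μ T) : IsBorelField μ (fun ω => c • T ω) := by
  intro f g hf hg hfc hgc
  simp only [smul_apply, inner_smul_right]
  exact (hT f g hf hg hfc hgc).const_mul c

theorem adjoint (hT : IsBorelField μ T) :
    IsBorelField μ (fun ω => ContinuousLinearMap.adjoint (T ω)) := by
  intro f g hf hg hfc hgc
  have := Complex.continuous_conj.measurable.comp_aemeasurable (hT g f hg hf hgc hfc)
  refine this.congr (Eventually.of_forall fun ω => ?_)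
  simp [ContinuousLinearMap.adjoint_inner_right]

variable [LocallyCompactSpace X] [BorelSpace X]

theorem one [CompactSpace K] [T2Space K] : IsBorelField μ (fun _ => 1) :=
  isMeasurableField_one.isBorelField

variable [SecondCountableTopology X]

/-- A matrix element of the product is an inner product ⟨S* f, T g⟩; Parseval over cells expands it
into a countable series of products of measurable functions. -/
theorem mul (hS : IsBorelField μ S) (hT : IsBorelField μ T) :
    IsBorelField μ (fun ω => S ω * T ω) := by
  obtain ⟨V, hV⟩ := exists_isCellPartition X
  intro f g hf hg hfc hgc
  have hVc : ∀ j, HasCompactSupport ((V j).indicator (1 : X → ℂ)) := fun j =>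
    hasCompactSupport_indicator (hV.isCompact_closure j) _
  have hVm : ∀ j, Measurable ((V j).indicator (1 : X → ℂ)) := fun j =>
    measurable_one.indicator (hV.measurable j)
  refine aemeasurable_of_tendsto_metrizable_ae atTop (fun n =>
    Finset.aemeasurable_fun_sum (Finset.range n) fun j _ =>
      (hS f ((V j).indicator 1) hf (hVm j) hfc (hVc j)).mul
        (hT ((V j).indicator 1) g (hVm j) hg (hVc j) hgc)) (Eventually.of_forall fun ω => ?_)
  have h := ω.hasSum_cells hV (ContinuousLinearMap.adjoint (S ω) (ω.restr f)) (T ω (ω.restr g))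
  simp only [ContinuousLinearMap.adjoint_inner_left] at h
  exact h.tendsto_sum_nat

variable [CompactSpace K] [T2Space K]

theorem aeval (hT : IsBorelField μ T) (p : Polynomial ℝ) :
    IsBorelField μ (fun ω => Polynomial.aeval (T ω) p) := by
  have hs : ∀ (ω : Config X K) (a : ℝ) (A : ω.ell2 →L[ℂ] ω.ell2), a • A = (a : ℂ) • A :=
    fun ω a A => (Complex.coe_smul a A).symm
  induction p using Polynomial.induction_on' with
  | add p q hp hq =>
    simp only [map_add]
    exact hp.add hq
  | monomial n a =>
    simp only [Polynomial.aeval_monomial, ← Algebra.smul_def, hs]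
    refine smul _ ?_
    induction n with
    | zero => simpa using one
    | succ n ih =>
      simp only [pow_succ]
      exact ih.mul hT

theorem contFun (hT : IsBorelField μ T) (hsa : ∀ᵐ ω ∂μ, IsSelfAdjoint (T ω)) {C : ℝ}
    (hC : ∀ᵐ ω ∂μ, ‖T ω‖ ≤ C) {φ : ℝ → ℝ} (hφ : Continuous φ) :
    IsBorelField μ (fun ω => contFun φ (T ω)) := by
  have hp : ∀ n : ℕ, ∃ p : Polynomial ℝ, ∀ x ∈ Set.Icc (-C) C,
      |p.eval x - φ x| < 1 / ((n : ℝ) + 1) :=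
    fun n => exists_polynomial_near_of_continuousOn _ _ _ hφ.continuousOn _ (by positivity)
  choose p hp using hp
  refine of_tendsto (fun n => hT.aeval (p n)) ?_
  filter_upwards [hsa, hC] with ω h1 h2 v w
  exact ((continuous_const (y := v)).inner
    (ContinuousLinearMap.apply ℂ _ w).continuous).tendsto _ |>.comp
      (tendsto_aeval_contFun h1 h2 hφ hp)

/-- The eigenprojection is a weak limit of tents of T, each of them a measurable field. -/
theorem eigenProjection (hT : IsBorelField μ T) (hsa : ∀ᵐ ω ∂μ, IsSelfAdjoint (T ω)) {C : ℝ}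
    (hC : ∀ᵐ ω ∂μ, ‖T ω‖ ≤ C) (lam : ℝ) : IsBorelField μ (fun ω => eigenProjection (T ω) lam) := by
  refine of_tendsto (fun n => hT.contFun hsa hC (tent lam n).continuous) ?_
  filter_upwards [hsa] with ω h1 v w
  exact tendsto_const_nhds.inner (tendsto_contFun_tent h1 lam w)

end IsBorelField

end FieldAlgebra

/-! ### Measurability of the projection onto compactly supported solutions. -/

section CompactlySupportedSolutions

theorem ker_adjoint_mul_self_add {V : Type*} [NormedAddCommGroup V] [InnerProductSpace ℂ V]
    [CompleteSpace V] (A B : V →L[ℂ] V) :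
    (ContinuousLinearMap.adjoint A * A + ContinuousLinearMap.adjoint B * B).ker =
      A.ker ⊓ B.ker := by
  ext v
  simp only [Submodule.mem_inf, LinearMap.mem_ker, ContinuousLinearMap.coe_coe]
  constructor
  · intro h
    have h1 : inner ℂ v ((ContinuousLinearMap.adjoint A * A +
        ContinuousLinearMap.adjoint B * B) v) = ((‖A v‖ ^ 2 + ‖B v‖ ^ 2 : ℝ) : ℂ) := by
      rw [add_apply, inner_add_right, ContinuousLinearMap.mul_def, ContinuousLinearMap.mul_def,
        ContinuousLinearMap.comp_apply, ContinuousLinearMap.comp_apply,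
        ContinuousLinearMap.adjoint_inner_right, ContinuousLinearMap.adjoint_inner_right,
        inner_self_eq_norm_sq_to_K, inner_self_eq_norm_sq_to_K]
      push_cast
      rfl
    rw [h, inner_zero_right] at h1
    have h2 : ‖A v‖ ^ 2 + ‖B v‖ ^ 2 = 0 := by exact_mod_cast h1.symm
    have hA := sq_nonneg ‖A v‖
    have hB := sq_nonneg ‖B v‖
    exact ⟨norm_eq_zero.1 (pow_eq_zero_iff two_ne_zero |>.1 (by linarith)),
      norm_eq_zero.1 (pow_eq_zero_iff two_ne_zero |>.1 (by linarith))⟩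
  · rintro ⟨h1, h2⟩
    simp [h1, h2]

variable {X K : Type*} [MetricSpace X]

/-- The vectors of `ℓ²(X(ω))` that vanish outside `S`. -/
def Config.supportedOn (ω : Config X K) (S : Set X) : Submodule ℂ ω.ell2 where
  carrier := {v | ∀ x : ω.carrier, (x : X) ∉ S → v x = 0}
  zero_mem' := fun x _ => rfl
  add_mem' := fun {v w} hv hw x hx => by
    rw [lp.coeFn_add, Pi.add_apply, hv x hx, hw x hx, add_zero]
  smul_mem' := fun c v hv x hx => by
    rw [lp.coeFn_smul, Pi.smul_apply, hv x hx, smul_zero]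

theorem Config.mem_supportedOn {ω : Config X K} {S : Set X} {v : ω.ell2} :
    v ∈ ω.supportedOn S ↔ ∀ x : ω.carrier, (x : X) ∉ S → v x = 0 := Iff.rfl

instance (ω : Config X K) (S : Set X) : CompleteSpace (ω.supportedOn S) := by
  refine IsClosed.completeSpace_coe (hs := ?_)
  have : (ω.supportedOn S : Set ω.ell2) =
      ⋂ x : ω.carrier, ⋂ _ : (x : X) ∉ S, {v | inner ℂ (ω.delta x) v = 0} := by
    ext v
    simp [Config.mem_supportedOn, Config.inner_delta_left]
  rw [this]
  exact isClosed_iInter fun x => isClosed_iInter fun _ =>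
    isClosed_eq (by fun_prop) continuous_const

theorem Config.starProjection_supportedOn_restr (ω : Config X K) (S : Set X) {f : X → ℂ}
    (hf : HasCompactSupport f) :
    (ω.supportedOn S).starProjection (ω.restr f) = ω.restr (S.indicator f) := by
  have hf' : HasCompactSupport (S.indicator f) :=
    hf.mono (Set.support_indicator.trans_subset Set.inter_subset_right)
  have hmem : ω.restr (S.indicator f) ∈ ω.supportedOn S := fun x hx => by
    rw [ω.restr_apply hf', Set.indicator_of_notMem hx]
  refine Submodule.eq_starProjection_of_mem_of_inner_eq_zero hmem fun w hw => ?_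
  rw [lp.inner_eq_tsum]
  refine (tsum_congr fun x => ?_).trans tsum_zero
  rw [lp.coeFn_sub, Pi.sub_apply, ω.restr_apply hf, ω.restr_apply hf']
  by_cases hx : (x : X) ∈ S
  · simp [hx]
  · simp [hw x hx]

/-- The solutions of `(T - lam) v = 0` that vanish outside `S`. -/
def Config.solutionsOn (ω : Config X K) (T : ω.ell2 →L[ℂ] ω.ell2) (lam : ℝ) (S : Set X) :
    Submodule ℂ ω.ell2 :=
  (T - (lam : ℂ) • 1).ker ⊓ ω.supportedOn S

/-- An intersection of two kernels becomes the kernel of a single positive operator, to which the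
measurability of eigenprojections applies at eigenvalue 0. -/
theorem Config.solutionsOn_eq_ker (ω : Config X K) (T : ω.ell2 →L[ℂ] ω.ell2) (lam : ℝ)
    (S : Set X) : ω.solutionsOn T lam S =
      (ContinuousLinearMap.adjoint (T - (lam : ℂ) • 1) * (T - (lam : ℂ) • 1) +
        ContinuousLinearMap.adjoint (1 - (ω.supportedOn S).starProjection) *
          (1 - (ω.supportedOn S).starProjection)).ker := by
  rw [ker_adjoint_mul_self_add, solutionsOn]
  congr 1
  ext v
  simp only [LinearMap.mem_ker, ContinuousLinearMap.coe_coe, sub_apply,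
    one_apply_eq_self, sub_eq_zero]
  rw [eq_comm, Submodule.starProjection_eq_self_iff]

instance (ω : Config X K) (T : ω.ell2 →L[ℂ] ω.ell2) (lam : ℝ) (S : Set X) :
    CompleteSpace (ω.solutionsOn T lam S) := by
  rw [ω.solutionsOn_eq_ker]
  infer_instance

/-- A finite set lies in some member of the exhaustion, and conversely a compact set contains only
finitely many points of ω. This replaces the span by an increasing union of closed subspaces. -/
theorem Config.compSpan_eq_iSup (ω : Config X K) (T : ω.ell2 →L[ℂ] ω.ell2) (lam : ℝ)
    (E : CompactExhaustion X) : ω.compSpan T lam = ⨆ n, ω.solutionsOn T lam (E n) := by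
  apply le_antisymm
  · rw [compSpan, Submodule.span_le]
    rintro v ⟨hv, hTv⟩
    obtain ⟨n, hn⟩ := E.exists_superset_of_isCompact (hv.image ((↑) : ω.carrier → X)).isCompact
    refine Submodule.mem_iSup_of_mem n ⟨mem_ker_sub_smul_one.2 (sub_eq_zero.1 hTv), ?_⟩
    intro x hx
    by_contra hne
    exact hx (hn ⟨x, hne, rfl⟩)
  · refine iSup_le fun n v hv => Submodule.subset_span ⟨?_, ?_⟩
    · refine (ω.finite_preimage (E.isCompact n)).subset fun x hx => ?_
      by_contra hxn
      exact hx (hv.2 x hxn)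
    · exact sub_eq_zero.2 (mem_ker_sub_smul_one.1 hv.1)

theorem norm_sub_smul_one_le {V : Type*} [NormedAddCommGroup V] [InnerProductSpace ℂ V]
    (T : V →L[ℂ] V) (c : ℂ) : ‖T - c • 1‖ ≤ ‖T‖ + ‖c‖ := by
  refine (norm_sub_le _ _).trans (add_le_add_right ?_ _)
  rw [norm_smul]
  exact mul_le_of_le_one_right (norm_nonneg _) ContinuousLinearMap.norm_id_le

theorem norm_adjoint_mul_self_le {V : Type*} [NormedAddCommGroup V] [InnerProductSpace ℂ V]
    [CompleteSpace V] {A : V →L[ℂ] V} {C : ℝ} (hA : ‖A‖ ≤ C) :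
    ‖ContinuousLinearMap.adjoint A * A‖ ≤ C * C := by
  refine (norm_mul_le _ _).trans ?_
  rw [LinearIsometryEquiv.norm_map]
  exact mul_le_mul hA hA (norm_nonneg _) ((norm_nonneg _).trans hA)

variable [MeasurableSpace X] [TopologicalSpace K] {μ : Measure (Config X K)}
  [LocallyCompactSpace X] [BorelSpace X] [CompactSpace K] [T2Space K]

theorem isBorelField_starProjection_supportedOn {S : Set X} (hS : MeasurableSet S) :
    IsBorelField μ (fun ω => (ω.supportedOn S).starProjection) := by
  intro f g hf hg hfc hgc
  simp only [fun ω : Config X K => ω.starProjection_supportedOn_restr S hgc]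
  exact IsBorelField.one f (S.indicator g) hf (hg.indicator hS) hfc
    (hgc.mono (Set.support_indicator.trans_subset Set.inter_subset_right))

variable [SecondCountableTopology X]

theorem IsBorelField.starProjection_solutionsOn {H : OperatorField X K} (hH : IsBorelField μ H)
    {C : ℝ} (hC : ∀ᵐ ω ∂μ, ‖H ω‖ ≤ C) (lam : ℝ) {S : Set X} (hS : MeasurableSet S) :
    IsBorelField μ (fun ω => (ω.solutionsOn (H ω) lam S).starProjection) := by
  have hA := hH.sub (IsBorelField.one.smul (lam : ℂ))
  have hB := IsBorelField.one.sub (isBorelField_starProjection_supportedOn (μ := μ) hS)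
  have hG := ((hA.adjoint.mul hA).add (hB.adjoint.mul hB)).eigenProjection
    -- The first summand bounds A*A for A = H − λ, the second B*B for B = 1 − P_S.
    (C := (C + |lam|) * (C + |lam|) + (1 + 1) * (1 + 1)) (Eventually.of_forall fun ω => ?_) ?_ 0
  · refine hG.congr_ae (Eventually.of_forall fun ω => ?_)
    simp only [DiscreteHamiltonian.eigenProjection, Complex.ofReal_zero, zero_smul, sub_zero,
      ω.solutionsOn_eq_ker]
  · exact (IsSelfAdjoint.star_mul_self _).add (IsSelfAdjoint.star_mul_self _)
  · filter_upwards [hC] with ω hω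
    refine (norm_add_le _ _).trans (add_le_add (norm_adjoint_mul_self_le ?_)
      (norm_adjoint_mul_self_le ?_))
    · refine (norm_sub_smul_one_le _ _).trans ?_
      simpa using hω
    · exact (norm_sub_le _ _).trans (add_le_add ContinuousLinearMap.norm_id_le
        (Submodule.starProjection_norm_le _))

/-- Projections onto increasing closed subspaces converge strongly to the projection onto the
closure of their union. -/
theorem IsBorelField.compProjection {H : OperatorField X K} (hH : IsBorelField μ H)
    {C : ℝ} (hC : ∀ᵐ ω ∂μ, ‖H ω‖ ≤ C) (lam : ℝ) : IsBorelField μ (compProjection H lam) := by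
  let E : CompactExhaustion X := default
  refine of_tendsto (fun n => hH.starProjection_solutionsOn hC lam (E.isCompact n).measurableSet)
    (Eventually.of_forall fun ω v w => ?_)
  have hmono : Monotone fun n => ω.solutionsOn (H ω) lam (E n) := fun m n hmn =>
    inf_le_inf_left _ fun v hv x hx => hv x fun h => hx (E.subset hmn h)
  have h := Submodule.starProjection_tendsto_closure_iSup _ hmono w
  simp only [← ω.compSpan_eq_iSup] at h
  exact tendsto_const_nhds.inner h

end CompactlySupportedSolutions

/-! ### Equivariance as intertwining by a unitary. -/

section Equivariance

theorem memℓp_mul_comp_equiv {α β : Type*} (e : β ≃ α) (c : β → Circle)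
    (v : lp (fun _ : α => ℂ) 2) : Memℓp (fun b : β => (c b : ℂ) * v (e b)) 2 := by
  refine memℓp_gen ?_
  have h1 := (e.summable_iff).2 ((lp.memℓp v).summable (by simp))
  refine h1.congr fun b => ?_
  rw [norm_mul, Circle.norm_coe, one_mul]
  rfl

/-- The unitary map between `ℓ²` spaces given by a bijection of the index sets and a phase. -/
def twist {α β : Type*} (e : α ≃ β) (c : α → Circle) :
    lp (fun _ : α => ℂ) 2 ≃ₗᵢ[ℂ] lp (fun _ : β => ℂ) 2 where
  toFun v := ⟨fun b => (((c (e.symm b))⁻¹ : Circle) : ℂ) * v (e.symm b),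
    memℓp_mul_comp_equiv e.symm (fun b => (c (e.symm b))⁻¹) v⟩
  invFun w := ⟨fun a => (c a : ℂ) * w (e a), memℓp_mul_comp_equiv e c w⟩
  map_add' v w := lp.ext (funext fun b => mul_add _ _ _)
  map_smul' r v := lp.ext (funext fun b => mul_left_comm _ _ _)
  left_inv v := by
    ext a
    simp
  right_inv w := by
    ext b
    simp
  norm_map' v := by
    rw [lp.norm_eq_tsum_rpow (by simp), lp.norm_eq_tsum_rpow (by simp)]
    congr 1
    refine Eq.trans (tsum_congr fun b => ?_) (e.symm.tsum_eq _)
    change ‖(((c (e.symm b))⁻¹ : Circle) : ℂ) * v (e.symm b)‖ ^ _ = _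
    rw [norm_mul, Circle.norm_coe, one_mul]

theorem twist_apply {α β : Type*} (e : α ≃ β) (c : α → Circle) (v : lp (fun _ : α => ℂ) 2)
    (a : α) : twist e c v (e a) = conj (c a : ℂ) * v a := by
  change (((c (e.symm (e a)))⁻¹ : Circle) : ℂ) * v (e.symm (e a)) = _
  rw [e.symm_apply_apply, Circle.coe_inv_eq_conj]

variable {Γ X K : Type*} [MetricSpace X] [Group Γ] [MulAction Γ X] [IsIsometricSMul Γ X]

namespace Config

/-- The bijection `x ↦ γ x` from the points of `ω` to the points of `γ ω`. -/
def pointEquiv (ω : Config X K) (γ : Γ) : ω.carrier ≃ (γ • ω).carrier where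
  toFun := ω.smulPoint γ
  invFun y := ⟨γ⁻¹ • (y : X), Set.mem_smul_set_iff_inv_smul_mem.1 y.2⟩
  left_inv x := Subtype.ext (inv_smul_smul γ (x : X))
  right_inv y := Subtype.ext (smul_inv_smul γ (y : X))

/-- The unitary map `ℓ²(X(ω)) → ℓ²(X(γ ω))` that implements equivariance. -/
def transport (ω : Config X K) (s : Γ → X → Circle) (γ : Γ) : ω.ell2 ≃ₗᵢ[ℂ] (γ • ω).ell2 :=
  twist (ω.pointEquiv γ) fun x => s γ x

variable (ω : Config X K) (s : Γ → X → Circle) (γ : Γ)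

theorem transport_apply (v : ω.ell2) (x : ω.carrier) :
    ω.transport s γ v (ω.smulPoint γ x) = conj (s γ x : ℂ) * v x :=
  twist_apply (ω.pointEquiv γ) _ v x

theorem transport_delta (x : ω.carrier) :
    ω.transport s γ (ω.delta x) = conj (s γ x : ℂ) • (γ • ω).delta (ω.smulPoint γ x) := by
  ext y
  obtain ⟨y, rfl⟩ := (ω.pointEquiv γ).surjective y
  rw [lp.coeFn_smul, Pi.smul_apply, smul_eq_mul]
  change ω.transport s γ (ω.delta x) (ω.smulPoint γ y) = _ * ((γ • ω).delta (ω.smulPoint γ x)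
    (ω.smulPoint γ y))
  rw [transport_apply]
  by_cases h : y = x
  · subst h
    simp [delta_apply_self]
  · have h' : ω.smulPoint γ y ≠ ω.smulPoint γ x := (ω.pointEquiv γ).injective.ne h
    rw [ω.delta_apply_ne h, (γ • ω).delta_apply_ne h', mul_zero, mul_zero]

theorem finite_support_transport (v : ω.ell2) :
    (Function.support (ω.transport s γ v : (γ • ω).carrier → ℂ)).Finite ↔
      (Function.support (v : ω.carrier → ℂ)).Finite := by
  have : Function.support (v : ω.carrier → ℂ) =
      ω.pointEquiv γ ⁻¹' Function.support (ω.transport s γ v : (γ • ω).carrier → ℂ) := by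
    ext x
    change v x ≠ 0 ↔ ω.transport s γ v (ω.smulPoint γ x) ≠ 0
    rw [transport_apply]
    simp
  rw [this]
  exact ⟨fun h => h.preimage (ω.pointEquiv γ).injective.injOn,
    fun h => h.of_preimage (ω.pointEquiv γ).surjective⟩

/-- Both sides say the same on unit vectors, where the phases cancel by |s| = 1; continuity and the
expansion in unit vectors do the rest. The operator form passes at once to kernels, closed spans and
functional calculus. -/
theorem equivariant_iff {T : ω.ell2 →L[ℂ] ω.ell2} {T' : (γ • ω).ell2 →L[ℂ] (γ • ω).ell2} :
    (∀ x y : ω.carrier, (s γ x : ℂ) * (γ • ω).entry T' (ω.smulPoint γ x) (ω.smulPoint γ y) *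
      conj (s γ y : ℂ) = ω.entry T x y) ↔
    ∀ v, T' (ω.transport s γ v) = ω.transport s γ (T v) := by
  have hs : ∀ x : X, conj (s γ x : ℂ) * (s γ x : ℂ) = 1 := fun x => by
    rw [mul_comm, Complex.mul_conj, Circle.normSq_coe, Complex.ofReal_one]
  constructor
  · intro h v
    have hd : ∀ y, T' (ω.transport s γ (ω.delta y)) = ω.transport s γ (T (ω.delta y)) := by
      intro y
      ext x
      obtain ⟨x, rfl⟩ := (ω.pointEquiv γ).surjective x
      change T' _ (ω.smulPoint γ x) = ω.transport s γ _ (ω.smulPoint γ x)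
      rw [transport_apply, transport_delta, ← entry_eq_apply, ← h x y, map_smul, lp.coeFn_smul,
        Pi.smul_apply, smul_eq_mul, ← entry_eq_apply]
      linear_combination (-(conj (s γ y : ℂ)) * (γ • ω).entry T' (ω.smulPoint γ x)
        (ω.smulPoint γ y)) * hs x
    have h1 := (ω.hasSum_delta v).mapL
      (T' ∘L ((ω.transport s γ : ω.ell2 →L[ℂ] (γ • ω).ell2)))
    have h2 := (ω.hasSum_delta v).mapL
      (((ω.transport s γ : ω.ell2 →L[ℂ] (γ • ω).ell2)) ∘L T)
    refine h1.unique (h2.congr_fun fun x => ?_)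
    simp [hd]
  · intro h x y
    have h1 := congrArg (fun w => w (ω.smulPoint γ x)) (h (ω.delta y))
    simp only [transport_apply, transport_delta, map_smul, lp.coeFn_smul, Pi.smul_apply,
      smul_eq_mul, ← entry_eq_apply] at h1
    linear_combination (s γ x : ℂ) * h1 + (ω.entry T x y) * hs x

end Config

theorem starProjection_apply_isometryEquiv {V W : Type*} [NormedAddCommGroup V]
    [InnerProductSpace ℂ V] [NormedAddCommGroup W] [InnerProductSpace ℂ W] (U : V ≃ₗᵢ[ℂ] W)
    {S : Submodule ℂ V} {S' : Submodule ℂ W} [S.HasOrthogonalProjection]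
    [S'.HasOrthogonalProjection] (h : ∀ v, v ∈ S ↔ U v ∈ S') (v : V) :
    S'.starProjection (U v) = U (S.starProjection v) := by
  refine Submodule.eq_starProjection_of_mem_of_inner_eq_zero
    ((h _).1 (Submodule.starProjection_apply_mem _ _)) fun w hw => ?_
  obtain ⟨w, rfl⟩ := U.surjective w
  rw [← map_sub, LinearIsometryEquiv.inner_map_map]
  exact Submodule.starProjection_inner_eq_zero _ _ ((h w).2 hw)

namespace Config

variable (ω : Config X K) (s : Γ → X → Circle) (γ : Γ)
  {T : ω.ell2 →L[ℂ] ω.ell2} {T' : (γ • ω).ell2 →L[ℂ] (γ • ω).ell2}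

theorem apply_transport_eq_smul_iff (h : ∀ v, T' (ω.transport s γ v) = ω.transport s γ (T v))
    (lam : ℂ) (v : ω.ell2) :
    T' (ω.transport s γ v) = lam • ω.transport s γ v ↔ T v = lam • v := by
  rw [h, ← map_smul, (ω.transport s γ).injective.eq_iff]

theorem eigenProjection_transport (h : ∀ v, T' (ω.transport s γ v) = ω.transport s γ (T v))
    (lam : ℝ) (v : ω.ell2) : eigenProjection T' lam (ω.transport s γ v) =
      ω.transport s γ (eigenProjection T lam v) := by
  refine starProjection_apply_isometryEquiv _ (fun v => ?_) v
  rw [mem_ker_sub_smul_one, mem_ker_sub_smul_one, ω.apply_transport_eq_smul_iff s γ h]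

theorem compSpan_transport (h : ∀ v, T' (ω.transport s γ v) = ω.transport s γ (T v))
    (lam : ℝ) : (γ • ω).compSpan T' lam =
      (ω.compSpan T lam).map (ω.transport s γ).toLinearEquiv.toLinearMap := by
  rw [compSpan, compSpan, Submodule.map_span]
  congr 1
  ext w
  obtain ⟨v, rfl⟩ := (ω.transport s γ).surjective w
  rw [Set.mem_image]
  constructor
  · rintro ⟨h1, h2⟩
    refine ⟨v, ⟨(ω.finite_support_transport s γ v).1 h1, ?_⟩, rfl⟩
    exact sub_eq_zero.2 ((ω.apply_transport_eq_smul_iff s γ h _ _).1 (sub_eq_zero.1 h2))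
  · rintro ⟨v', ⟨h1, h2⟩, hv⟩
    obtain rfl : v' = v := (ω.transport s γ).injective hv
    exact ⟨(ω.finite_support_transport s γ v').2 h1,
      sub_eq_zero.2 ((ω.apply_transport_eq_smul_iff s γ h _ _).2 (sub_eq_zero.1 h2))⟩

theorem compProjection_transport (h : ∀ v, T' (ω.transport s γ v) = ω.transport s γ (T v))
    (lam : ℝ) (v : ω.ell2) :
    ((γ • ω).compSpan T' lam).topologicalClosure.starProjection (ω.transport s γ v) =
      ω.transport s γ ((ω.compSpan T lam).topologicalClosure.starProjection v) := by
  refine starProjection_apply_isometryEquiv _ (fun v => ?_) v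
  rw [← SetLike.mem_coe, ← SetLike.mem_coe, Submodule.topologicalClosure_coe,
    Submodule.topologicalClosure_coe, ω.compSpan_transport s γ h, Submodule.map_coe]
  change _ ↔ _ ∈ closure ((ω.transport s γ).toHomeomorph '' _)
  rw [← (ω.transport s γ).toHomeomorph.image_closure]
  exact ((ω.transport s γ).injective.mem_set_image).symm

end Config

/-- If a field of operators commutes with translations, its diagonal is invariant. -/
theorem Config.entry_smulPoint (ω : Config X K) {s : Γ → X → Circle} {γ : Γ}
    {T : ω.ell2 →L[ℂ] ω.ell2} {T' : (γ • ω).ell2 →L[ℂ] (γ • ω).ell2}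
    (h : ∀ v, T' (ω.transport s γ v) = ω.transport s γ (T v)) (x : ω.carrier) :
    (γ • ω).entry T' (ω.smulPoint γ x) (ω.smulPoint γ x) = ω.entry T x x := by
  have h1 := (ω.equivariant_iff s γ).2 h x x
  have hs : (s γ x : ℂ) * conj (s γ x : ℂ) = 1 := by
    rw [Complex.mul_conj, Circle.normSq_coe, Complex.ofReal_one]
  linear_combination h1 - (γ • ω).entry T' (ω.smulPoint γ x) (ω.smulPoint γ x) * hs

variable [TopologicalSpace K] {μ : Measure (Config X K)} {s : Γ → X → Circle}

theorem IsEquivariantField.apply_transport {T : OperatorField X K}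
    (hT : IsEquivariantField μ s T) (γ : Γ) {ω : Config X K} (hω : ω ∈ μ.support) (v : ω.ell2) :
    T (γ • ω) (ω.transport s γ v) = ω.transport s γ (T ω v) :=
  (ω.equivariant_iff s γ).1 (hT.equivariant γ ω hω) v

end Equivariance

/-! ### Translations preserve μ. -/

section Action

variable {Γ X K : Type*} [MetricSpace X] [Group Γ] [MulAction Γ X] [IsIsometricSMul Γ X]
  [TopologicalSpace K]

/-- Translation of a test function on `X × X × K`. -/
def translateTest (γ : Γ) (φ : C_c(X × X × K, ℂ)) : C_c(X × X × K, ℂ) where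
  toFun p := φ (γ • p.1, γ • p.2.1, p.2.2)
  continuous_toFun := by fun_prop
  hasCompactSupport' :=
    φ.hasCompactSupport.comp_homeomorph ((Homeomorph.smul γ).prodCongr
      ((Homeomorph.smul γ).prodCongr (Homeomorph.refl K)))

theorem Config.pairSum_smul (ω : Config X K) (γ : Γ) (φ : C_c(X × X × K, ℂ)) :
    (γ • ω).pairSum φ = ω.pairSum (translateTest γ φ) := by
  symm
  refine finsum_eq_of_bijective _ ((ω.pointEquiv γ).prodCongr (ω.pointEquiv γ)).bijective ?_
  rintro ⟨x, y⟩
  change φ (γ • (x : X), γ • (y : X), ω.mark x y) = φ (γ • (x : X), γ • (y : X),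
    ω.mark ((ω.pointEquiv γ).symm (ω.pointEquiv γ x)) ((ω.pointEquiv γ).symm (ω.pointEquiv γ y)))
  rw [Equiv.symm_apply_apply, Equiv.symm_apply_apply]

/-- The topology is induced by the pair sums, so the translation is moved to the test function. Only
measurability of each single translation is needed later. -/
theorem Config.continuous_smul (γ : Γ) : Continuous fun ω : Config X K => γ • ω := by
  rw [continuous_induced_rng, continuous_pi_iff]
  intro φ
  have h : Continuous (Config.pairSum : Config X K → C_c(X × X × K, ℂ) → ℂ) :=
    continuous_induced_dom
  refine (continuous_pi_iff.1 h (translateTest γ φ)).congr fun ω => ?_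
  exact (ω.pairSum_smul γ φ).symm

theorem measurePreserving_config_smul {μ : Measure (Config X K)}
    [SMulInvariantMeasure Γ (Config X K) μ] (γ : Γ) :
    MeasurePreserving (fun ω : Config X K => γ • ω) μ μ := by
  have hm := (Config.continuous_smul (X := X) (K := K) γ).measurable
  refine ⟨hm, Measure.ext fun s hs => ?_⟩
  rw [Measure.map_apply hm hs]
  exact SMulInvariantMeasure.measure_preimage_smul γ hs

end Action

/-! ### Diagonal measures of positive fields and their mean. -/

section DiagonalMeasure

variable {X K : Type*} [MetricSpace X] [MeasurableSpace X]

/-- The measure `∑ₓ T(x, x) δ_x` of a positive operator `T` on `ℓ²(X(ω))`. -/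
def Config.diagMeasure (ω : Config X K) (T : ω.ell2 →L[ℂ] ω.ell2) : Measure X :=
  -- Negative diagonal entries would be cut off by `ENNReal.ofReal`; the weights are faithful for
  -- positive `T`.
  Measure.sum fun x : ω.carrier => ENNReal.ofReal (ω.entry T x x).re • Measure.dirac (x : X)

theorem Config.lintegral_diagMeasure (ω : Config X K) (T : ω.ell2 →L[ℂ] ω.ell2) {f : X → ℝ≥0∞}
    (hf : Measurable f) : ∫⁻ x, f x ∂(ω.diagMeasure T) =
      ∑' x : ω.carrier, ENNReal.ofReal (ω.entry T x x).re * f x := by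
  rw [diagMeasure, lintegral_sum_measure]
  refine tsum_congr fun x => ?_
  rw [lintegral_smul_measure, lintegral_dirac' _ hf, smul_eq_mul]

theorem Config.lintegral_diagMeasure_eq_sum (ω : Config X K) (T : ω.ell2 →L[ℂ] ω.ell2)
    {f : X → ℝ≥0∞} (hf : Measurable f) {t : Finset ω.carrier}
    (ht : ∀ x : ω.carrier, f x ≠ 0 → x ∈ t) : ∫⁻ x, f x ∂(ω.diagMeasure T) =
      ∑ x ∈ t, ENNReal.ofReal (ω.entry T x x).re * f x := by
  rw [ω.lintegral_diagMeasure T hf]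
  refine tsum_eq_sum fun x hx => ?_
  by_contra h
  exact hx (ht x fun h0 => h (by rw [h0, mul_zero]))

theorem Config.diagMeasure_le (ω : Config X K) {T : ω.ell2 →L[ℂ] ω.ell2} {C : ℝ}
    (hC : ‖T‖ ≤ C) {S : Set X} (hS : MeasurableSet S) :
    ω.diagMeasure T S ≤ ENNReal.ofReal C * (((↑) : ω.carrier → X) ⁻¹' S).encard := by
  rw [← lintegral_indicator_one hS, ω.lintegral_diagMeasure T (measurable_one.indicator hS),
    mul_comm, ← ENNReal.tsum_set_const,
    tsum_subtype (((↑) : ω.carrier → X) ⁻¹' S) fun _ => ENNReal.ofReal C]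
  refine ENNReal.tsum_le_tsum fun x => ?_
  by_cases hx : (x : X) ∈ S
  · rw [Set.indicator_of_mem hx, Set.indicator_of_mem (s := ((↑) : ω.carrier → X) ⁻¹' S) hx]
    simp only [Pi.one_apply, mul_one]
    exact ENNReal.ofReal_le_ofReal (((Complex.re_le_norm _).trans (ω.norm_entry_le T x x)).trans hC)
  · simp [hx]

/-- On a set with at most one point of ω, the mass is a single matrix element against the restricted
indicator. This is the link between diagonal measures and `IsBorelField`. -/
theorem Config.diagMeasure_cell (ω : Config X K) (T : ω.ell2 →L[ℂ] ω.ell2) {S : Set X}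
    (hS : MeasurableSet S) (hc : IsCompact (closure S)) (hd : ∀ x ∈ S, ∀ y ∈ S, dist x y < 1) :
    ω.diagMeasure T S =
      ENNReal.ofReal (inner ℂ (ω.restr (S.indicator 1)) (T (ω.restr (S.indicator 1)))).re := by
  rw [← lintegral_indicator_one hS, ω.lintegral_diagMeasure T (measurable_one.indicator hS)]
  by_cases h : ∃ z : ω.carrier, (z : X) ∈ S
  · obtain ⟨z, hz⟩ := h
    rw [ω.restr_indicator_eq_delta hc hd hz, ← entry_eq_inner, tsum_eq_single z]
    · simp [hz]
    · intro x hx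
      have : (x : X) ∉ S := fun h => hx (ω.eq_of_dist_lt_one (hd _ h _ hz))
      simp [this]
  · push Not at h
    rw [ω.restr_indicator_eq_zero hc h]
    simp [h]

variable [LocallyCompactSpace X] [SecondCountableTopology X] [BorelSpace X] [TopologicalSpace K]
  {μ : Measure (Config X K)} {T : OperatorField X K}

theorem IsBorelField.aemeasurable_diagMeasure (hT : IsBorelField μ T) {B : Set X}
    (hB : MeasurableSet B) : AEMeasurable (fun ω => ω.diagMeasure (T ω) B) μ := by
  obtain ⟨V, hV⟩ := exists_isCellPartition X
  have hm : ∀ j, MeasurableSet (B ∩ V j) := fun j => hB.inter (hV.measurable j)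
  have hc : ∀ j, IsCompact (closure (B ∩ V j)) := fun j =>
    (hV.isCompact_closure j).of_isClosed_subset isClosed_closure
      (closure_mono Set.inter_subset_right)
  have hsum : ∀ ω : Config X K, ω.diagMeasure (T ω) B =
      ∑' j, ω.diagMeasure (T ω) (B ∩ V j) := fun ω => by
    rw [← measure_iUnion (fun i j hij => ?_) hm, ← Set.inter_iUnion, hV.iUnion_eq, Set.inter_univ]
    exact (hV.disjoint hij).mono Set.inter_subset_right Set.inter_subset_right
  simp only [hsum]
  refine AEMeasurable.tsum fun j => ?_
  simp only [fun ω : Config X K => ω.diagMeasure_cell (T ω) (hm j) (hc j)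
    fun x hx y hy => hV.dist_lt_one j x hx.2 y hy.2]
  exact (Complex.measurable_re.comp_aemeasurable (hT _ _ (measurable_one.indicator (hm j))
    (measurable_one.indicator (hm j)) (hasCompactSupport_indicator (hc j) _)
    (hasCompactSupport_indicator (hc j) _))).ennreal_ofReal

theorem IsBorelField.aemeasurable_lintegral_diagMeasure (hT : IsBorelField μ T) {f : X → ℝ≥0∞}
    (hf : Measurable f) : AEMeasurable (fun ω => ∫⁻ x, f x ∂(ω.diagMeasure (T ω))) μ := by
  refine Measurable.ennreal_induction
    (motive := fun f => AEMeasurable (fun ω => ∫⁻ x, f x ∂(ω.diagMeasure (T ω))) μ)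
    (fun c s hs => ?_) (fun f g _ hf hg ihf ihg => ?_) (fun f hf hmono ih => ?_) hf
  · simp only [lintegral_indicator_const hs]
    exact (hT.aemeasurable_diagMeasure hs).const_mul c
  · simp only [Pi.add_apply, lintegral_add_left hf]
    exact ihf.add ihg
  · simp only [fun ω : Config X K => lintegral_iSup (μ := ω.diagMeasure (T ω)) hf hmono]
    exact AEMeasurable.iSup ih

/-- The mean of the random measures `∑ₓ T_ω(x, x) δ_x`. -/
theorem IsBorelField.exists_meanMeasure (hT : IsBorelField μ T) :
    ∃ m : Measure X, ∀ f : X → ℝ≥0∞, Measurable f →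
      ∫⁻ x, f x ∂m = ∫⁻ ω, ∫⁻ x, f x ∂(ω.diagMeasure (T ω)) ∂μ := by
  let m : Measure X := Measure.ofMeasurable (fun B _ => ∫⁻ ω, ω.diagMeasure (T ω) B ∂μ) (by simp)
    fun B hB hd => by
      simp only [fun ω : Config X K => measure_iUnion (μ := ω.diagMeasure (T ω)) hd hB]
      exact lintegral_tsum fun i => hT.aemeasurable_diagMeasure (hB i)
  have hm : ∀ B, MeasurableSet B → m B = ∫⁻ ω, ω.diagMeasure (T ω) B ∂μ := fun B hB =>
    Measure.ofMeasurable_apply B hB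
  refine ⟨m, fun f hf => ?_⟩
  refine Measurable.ennreal_induction (motive := fun f =>
      ∫⁻ x, f x ∂m = ∫⁻ ω, ∫⁻ x, f x ∂(ω.diagMeasure (T ω)) ∂μ)
    (fun c s hs => ?_) (fun f g _ hf hg ihf ihg => ?_) (fun f hf hmono ih => ?_) hf
  · simp only [lintegral_indicator_const hs, hm s hs]
    rw [lintegral_const_mul'' _ (hT.aemeasurable_diagMeasure hs)]
  · simp only [Pi.add_apply, lintegral_add_left hf]
    rw [ihf, ihg, lintegral_add_left' (hT.aemeasurable_lintegral_diagMeasure hf)]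
  · simp only [fun ω : Config X K => lintegral_iSup (μ := ω.diagMeasure (T ω)) hf hmono]
    rw [lintegral_iSup hf hmono, lintegral_iSup'
      (fun n => hT.aemeasurable_lintegral_diagMeasure (hf n))
      (Eventually.of_forall fun ω i j hij => lintegral_mono (hmono hij))]
    simp only [ih]

/-- The mean of the random measures `∑ₓ T_ω(x, x) δ_x`. -/
def IsBorelField.meanMeasure (hT : IsBorelField μ T) : Measure X := hT.exists_meanMeasure.choose

theorem IsBorelField.lintegral_meanMeasure (hT : IsBorelField μ T) {f : X → ℝ≥0∞}
    (hf : Measurable f) :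
    ∫⁻ x, f x ∂hT.meanMeasure = ∫⁻ ω, ∫⁻ x, f x ∂(ω.diagMeasure (T ω)) ∂μ :=
  hT.exists_meanMeasure.choose_spec f hf

theorem IsBorelField.meanMeasure_apply (hT : IsBorelField μ T) {B : Set X}
    (hB : MeasurableSet B) : hT.meanMeasure B = ∫⁻ ω, ω.diagMeasure (T ω) B ∂μ := by
  rw [← lintegral_indicator_one hB, hT.lintegral_meanMeasure (measurable_one.indicator hB)]
  simp only [lintegral_indicator_one hB]

theorem IsBorelField.meanMeasure_lt_top [IsFiniteMeasure μ] (hT : IsBorelField μ T) {C : ℝ}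
    (hC : ∀ᵐ ω ∂μ, ‖T ω‖ ≤ C) {S : Set X} (hS : IsCompact S) : hT.meanMeasure S < ∞ := by
  obtain ⟨N, hN⟩ := Config.exists_encard_le (K := K) hS
  rw [hT.meanMeasure_apply hS.measurableSet]
  calc _ ≤ ∫⁻ _, ENNReal.ofReal C * (N : ℝ≥0∞) ∂μ := by
        refine lintegral_mono_ae ?_
        filter_upwards [hC] with ω hω
        refine (ω.diagMeasure_le hω hS.measurableSet).trans (mul_le_mul_right ?_ _)
        exact_mod_cast hN ω
    _ < ∞ := by
        rw [lintegral_const]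
        exact ENNReal.mul_lt_top (ENNReal.mul_lt_top ENNReal.ofReal_lt_top (by simp))
          (measure_lt_top μ _)

/-- The diagonal of a field of operators is invariant under translations. -/
def IsDiagInvariant (Γ : Type*) [Group Γ] [MulAction Γ X] [IsIsometricSMul Γ X]
    (μ : Measure (Config X K)) (T : OperatorField X K) : Prop :=
  ∀ γ : Γ, ∀ᵐ ω ∂μ, ∀ x : ω.carrier,
    (γ • ω).entry (T (γ • ω)) (ω.smulPoint γ x) (ω.smulPoint γ x) = ω.entry (T ω) x x

/-- Invariance of μ replaces ω by γω; relabelling the points of γω by those of ω then uses the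
invariance of the diagonal. -/
theorem IsBorelField.lintegral_meanMeasure_smul {Γ : Type*} [Group Γ] [MulAction Γ X]
    [IsIsometricSMul Γ X] [SMulInvariantMeasure Γ (Config X K) μ] (hT : IsBorelField μ T)
    (hinv : IsDiagInvariant Γ μ T) (γ : Γ) {f : X → ℝ≥0∞} (hf : Measurable f) :
    ∫⁻ x, f (γ • x) ∂hT.meanMeasure = ∫⁻ x, f x ∂hT.meanMeasure := by
  have hγ : Measurable fun x : X => f (γ • x) := hf.comp (continuous_const_smul γ).measurable
  have hpres := measurePreserving_config_smul (μ := μ) γ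
  have hF := hT.aemeasurable_lintegral_diagMeasure hf
  rw [hT.lintegral_meanMeasure hγ, hT.lintegral_meanMeasure hf]
  have h1 : ∫⁻ ω, ∫⁻ x, f x ∂(ω.diagMeasure (T ω)) ∂μ =
      ∫⁻ ω : Config X K, ∫⁻ x, f x ∂((γ • ω).diagMeasure (T (γ • ω))) ∂μ := by
    conv_lhs => rw [← hpres.map_eq]
    exact lintegral_map' (by rwa [hpres.map_eq]) hpres.measurable.aemeasurable
  rw [h1]
  refine lintegral_congr_ae ?_
  filter_upwards [hinv γ] with ω hω
  rw [ω.lintegral_diagMeasure _ hγ, (γ • ω).lintegral_diagMeasure _ hf,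
    ← (ω.pointEquiv γ).tsum_eq]
  refine tsum_congr fun x => ?_
  rw [← hω x]
  rfl

end DiagonalMeasure

/-! ### Averaging over the group: invariant measures on X and their densities. -/

section GroupAverage

/-- On a unimodular group, Haar measure is invariant under inversion. -/
theorem isInvInvariant_of_unimodular {Γ : Type*} [Group Γ] [TopologicalSpace Γ]
    [IsTopologicalGroup Γ] [LocallyCompactSpace Γ] [SecondCountableTopology Γ]
    [MeasurableSpace Γ] [BorelSpace Γ] (haar : Measure Γ) [haar.IsHaarMeasure]
    [haar.IsMulRightInvariant] : haar.IsInvInvariant := by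
  constructor
  -- Right invariance makes the inverted measure left invariant, hence a multiple c of Haar measure;
  -- inverting twice gives c² = 1.
  let c : ℝ≥0∞ := Measure.haarScalarFactor haar.inv haar
  have hc : haar.inv = c • haar := Measure.isMulLeftInvariant_eq_smul haar.inv haar
  have h2 : Measure.map Inv.inv (Measure.map Inv.inv haar) = c ^ 2 • haar := by
    rw [← Measure.inv_def haar, hc, Measure.map_smul, ← Measure.inv_def haar, hc, smul_smul,
      pow_two]
  have μeq : haar = c ^ 2 • haar := by
    rw [Measure.map_map continuous_inv.measurable continuous_inv.measurable] at h2
    simpa only [inv_involutive, Function.Involutive.comp_self, Measure.map_id] using h2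
  have K : TopologicalSpace.PositiveCompacts Γ := Classical.arbitrary _
  have h3 : c ^ 2 * haar K = 1 ^ 2 * haar K := by
    conv_rhs => rw [μeq]
    simp
  have h4 : c ^ 2 = 1 ^ 2 :=
    (ENNReal.mul_left_inj (Measure.measure_pos_of_nonempty_interior _ K.interior_nonempty).ne'
      K.isCompact.measure_lt_top.ne).1 h3
  have h5 : c = 1 := (ENNReal.pow_right_strictMono two_ne_zero).injective h4
  rw [hc, h5, one_smul]

/-- The additive form of the normalization, which avoids subtraction in `ℝ≥0∞`. Integrability is
implied by the integral being 1, as a Bochner integral is 0 otherwise. -/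
theorem IsAdmissible.lintegral_posPart {Γ X : Type*} [Group Γ] [MulAction Γ X]
    [MetricSpace X] [MeasurableSpace X] [MeasurableSpace Γ] (haar : Measure Γ) {u : X → ℝ}
    (hu : IsAdmissible haar u) (x : X) :
    ∫⁻ γ : Γ, ENNReal.ofReal (u (γ⁻¹ • x)) ∂haar =
      ∫⁻ γ : Γ, ENNReal.ofReal (-u (γ⁻¹ • x)) ∂haar + 1 := by
  have h1 := hu.integral_eq_one x
  have hint : Integrable (fun γ : Γ => u (γ⁻¹ • x)) haar := by
    by_contra h
    rw [integral_undef h] at h1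
    exact zero_ne_one h1
  rw [integral_eq_lintegral_pos_part_sub_lintegral_neg_part hint, sub_eq_iff_eq_add] at h1
  have hp := hint.lintegral_lt_top.ne
  have hn : ∫⁻ γ : Γ, ENNReal.ofReal (-u (γ⁻¹ • x)) ∂haar ≠ ∞ := hint.neg.lintegral_lt_top.ne
  rw [← ENNReal.toReal_eq_toReal_iff' hp (ENNReal.add_ne_top.2 ⟨hn, ENNReal.one_ne_top⟩), h1,
    ENNReal.toReal_add hn ENNReal.one_ne_top, ENNReal.toReal_one, add_comm]

section FundamentalDomain

variable {Γ X : Type*} [Group Γ] [MetricSpace Γ] [MetricSpace X] [MulAction Γ X] {F' : Set X}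

namespace IsRoughFundamentalDomain

theorem mem_smul_iff (hF' : IsRoughFundamentalDomain Γ F') {α : Γ} {x : X} (hx : x ∈ α • F')
    (L : Set Γ) : x ∈ L • F' ↔ α ∈ L := by
  constructor
  · rintro ⟨β, hβ, y, hy, rfl⟩
    rwa [(hF'.existsUnique (β • y)).unique hx (Set.smul_mem_smul_set hy)]
  · intro hα
    obtain ⟨y, hy, rfl⟩ := hx
    exact Set.smul_mem_smul hα hy

theorem isCompact_smul_closure [ContinuousSMul Γ X] (hF' : IsRoughFundamentalDomain Γ F')
    {J : Set Γ} (hJ : IsCompact J) : IsCompact (J • closure F') := by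
  rw [← Set.image_smul_prod]
  exact (hJ.prod hF'.isCompact_closure).image continuous_smul

theorem measurableSet_smul [ContinuousSMul Γ X] [MeasurableSpace X] [BorelSpace X]
    (hF' : IsRoughFundamentalDomain Γ F') {J : Set Γ} (hJ : IsCompact J) :
    MeasurableSet (J • F') := by
  obtain ⟨C, hC, hCF⟩ := hF'.isSigmaCompact
  rw [← hCF, Set.smul_iUnion]
  refine MeasurableSet.iUnion fun n => IsCompact.measurableSet ?_
  rw [← Set.image_smul_prod]
  exact (hJ.prod (hC n)).image continuous_smul

/-- For x in α F', the point γ⁻¹x lies in L F' exactly when γ lies in α L⁻¹, whose measure is |L| by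
left and inversion invariance. -/
theorem lintegral_indicator_smul [ContinuousSMul Γ X] [MeasurableSpace X] [BorelSpace X]
    [MeasurableSpace Γ] [BorelSpace Γ] [IsTopologicalGroup Γ]
    (hF' : IsRoughFundamentalDomain Γ F') (haar : Measure Γ) [haar.IsMulLeftInvariant]
    [haar.IsInvInvariant] {L : Set Γ} (hL : MeasurableSet (L • F')) (x : X) :
    ∫⁻ γ : Γ, (L • F').indicator 1 (γ⁻¹ • x) ∂haar = haar L := by
  obtain ⟨α, hα, -⟩ := hF'.existsUnique x
  have hset : {γ : Γ | γ⁻¹ • x ∈ L • F'} = (α⁻¹ * ·) ⁻¹' L⁻¹ := by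
    ext γ
    have hγ : γ⁻¹ • x ∈ (γ⁻¹ * α) • F' := by
      rw [mul_smul]
      exact Set.smul_mem_smul_set hα
    rw [Set.mem_ofPred_eq, hF'.mem_smul_iff hγ]
    simp
  have hmeas : MeasurableSet {γ : Γ | γ⁻¹ • x ∈ L • F'} :=
    (by fun_prop : Continuous fun γ : Γ => γ⁻¹ • x).measurable hL
  change ∫⁻ γ : Γ, {γ : Γ | γ⁻¹ • x ∈ L • F'}.indicator 1 γ ∂haar = _
  rw [lintegral_indicator_one hmeas, hset, measure_preimage_mul, Measure.measure_inv]

/-- The normalized indicator function of `J F'`. -/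
theorem isAdmissible_indicator [ContinuousSMul Γ X] [MeasurableSpace X] [BorelSpace X]
    [MeasurableSpace Γ] [BorelSpace Γ] [IsTopologicalGroup Γ] (haar : Measure Γ)
    [haar.IsMulLeftInvariant] [haar.IsInvInvariant] (hF' : IsRoughFundamentalDomain Γ F')
    {J : Set Γ} (hJ : IsCompact J) (h0 : haar J ≠ 0) (htop : haar J ≠ ∞) :
    IsAdmissible haar (fun x => (haar.real J)⁻¹ * (J • F').indicator (1 : X → ℝ) x) := by
  have hJm := hF'.measurableSet_smul hJ
  refine ⟨(measurable_one.indicator hJm).const_mul _, ⟨(haar.real J)⁻¹, fun x => ?_⟩, ?_,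
    fun x => ?_⟩
  · have h1 : 0 ≤ (haar.real J)⁻¹ := inv_nonneg.2 measureReal_nonneg
    rw [abs_mul, abs_of_nonneg h1]
    refine mul_le_of_le_one_right h1 ?_
    by_cases hx : x ∈ J • F' <;> simp [hx]
  · refine HasCompactSupport.intro (hF'.isCompact_smul_closure hJ) fun x hx => ?_
    rw [Set.indicator_of_notMem, mul_zero]
    exact fun h => hx (Set.smul_subset_smul_left subset_closure h)
  · rw [integral_const_mul]
    have h1 : ∫ γ : Γ, (J • F').indicator (1 : X → ℝ) (γ⁻¹ • x) ∂haar = haar.real J := by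
      rw [integral_eq_lintegral_of_nonneg_ae (Eventually.of_forall fun γ =>
        Set.indicator_nonneg (fun _ _ => by simp) _), Measure.real,
        ← hF'.lintegral_indicator_smul haar hJm x]
      · congr 1
        refine lintegral_congr fun γ => ?_
        by_cases hγ : γ⁻¹ • x ∈ J • F' <;> simp [hγ]
      · exact ((measurable_one.indicator hJm).comp (by fun_prop : Continuous fun γ : Γ =>
          γ⁻¹ • x).measurable).aestronglyMeasurable
    rw [h1]
    exact inv_mul_cancel₀ (ENNReal.toReal_ne_zero.2 ⟨h0, htop⟩)

end IsRoughFundamentalDomain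

variable [MeasurableSpace X] [BorelSpace X]
  [MeasurableSpace Γ] [BorelSpace Γ] [IsTopologicalGroup Γ] [SecondCountableTopology Γ]
  [ContinuousSMul Γ X] (haar : Measure Γ) [haar.IsInvInvariant] [SFinite haar]
  {m : Measure X} [SFinite m]

/-- Tonelli, invariance of m under each γ, and the inversion γ ↦ γ⁻¹. The symmetry in `f` and `g`
lets the density of m be computed with any test function. -/
theorem lintegral_mul_groupAverage
    (hm : ∀ (γ : Γ) (f : X → ℝ≥0∞), Measurable f → ∫⁻ x, f (γ • x) ∂m = ∫⁻ x, f x ∂m)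
    {f g : X → ℝ≥0∞} (hf : Measurable f) (hg : Measurable g) :
    ∫⁻ x, f x * ∫⁻ γ : Γ, g (γ⁻¹ • x) ∂haar ∂m =
      ∫⁻ x, g x * ∫⁻ γ : Γ, f (γ⁻¹ • x) ∂haar ∂m := by
  have hact : Measurable fun p : X × Γ => p.2⁻¹ • p.1 :=
    (by fun_prop : Continuous fun p : X × Γ => p.2⁻¹ • p.1).measurable
  have hact' : Measurable fun p : X × Γ => p.2 • p.1 :=
    (by fun_prop : Continuous fun p : X × Γ => p.2 • p.1).measurable
  calc ∫⁻ x, f x * ∫⁻ γ : Γ, g (γ⁻¹ • x) ∂haar ∂m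
      = ∫⁻ x, ∫⁻ γ : Γ, f x * g (γ⁻¹ • x) ∂haar ∂m := by
        refine lintegral_congr fun x => (lintegral_const_mul _ ?_).symm
        exact (hg.comp hact).comp measurable_prodMk_left
    _ = ∫⁻ γ : Γ, ∫⁻ x, f x * g (γ⁻¹ • x) ∂m ∂haar :=
        lintegral_lintegral_swap ((hf.comp measurable_fst).mul (hg.comp hact)).aemeasurable
    _ = ∫⁻ γ : Γ, ∫⁻ x, g x * f (γ • x) ∂m ∂haar := by
        refine lintegral_congr fun γ => ?_
        have hmeas : Measurable fun x => f x * g (γ⁻¹ • x) :=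
          hf.mul ((hg.comp hact).comp measurable_prodMk_right)
        rw [← hm γ _ hmeas]
        refine lintegral_congr fun x => ?_
        simp [mul_comm]
    _ = ∫⁻ x, ∫⁻ γ : Γ, g x * f (γ • x) ∂haar ∂m :=
        (lintegral_lintegral_swap ((hg.comp measurable_fst).mul (hf.comp hact')).aemeasurable).symm
    _ = ∫⁻ x, g x * ∫⁻ γ : Γ, f (γ⁻¹ • x) ∂haar ∂m := by
        refine lintegral_congr fun x => ?_
        have hmeas : Measurable fun γ : Γ => f (γ • x) :=
          (hf.comp hact').comp measurable_prodMk_left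
        rw [lintegral_const_mul _ hmeas, ← lintegral_inv_eq_self (fun γ : Γ => f (γ⁻¹ • x))]
        simp only [inv_inv]

variable [haar.IsMulLeftInvariant]

/-- For indicators of L F' and J F' the group averages are the constants |L| and |J|. Cross
multiplication covers sets of measure zero or infinity as well. -/
theorem IsRoughFundamentalDomain.measure_smul_mul (hF' : IsRoughFundamentalDomain Γ F')
    (hm : ∀ (γ : Γ) (f : X → ℝ≥0∞), Measurable f → ∫⁻ x, f (γ • x) ∂m = ∫⁻ x, f x ∂m)
    {L J : Set Γ} (hL : MeasurableSet (L • F')) (hJ : MeasurableSet (J • F')) :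
    m (L • F') * haar J = m (J • F') * haar L := by
  have h := lintegral_mul_groupAverage haar hm (measurable_one.indicator hL)
    (measurable_one.indicator hJ)
  simp only [hF'.lintegral_indicator_smul haar hJ, hF'.lintegral_indicator_smul haar hL] at h
  rwa [lintegral_mul_const _ (measurable_one.indicator hL), lintegral_mul_const _
    (measurable_one.indicator hJ), lintegral_indicator_one hL, lintegral_indicator_one hJ] at h

/-- The exchange formula applied to u⁺ and to u⁻ against the indicator of J F'; their group averages
differ by 1. -/
theorem IsAdmissible.lintegral_mul_measure {u : X → ℝ} (hu : IsAdmissible haar u)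
    (hF' : IsRoughFundamentalDomain Γ F')
    (hm : ∀ (γ : Γ) (f : X → ℝ≥0∞), Measurable f → ∫⁻ x, f (γ • x) ∂m = ∫⁻ x, f x ∂m)
    {J : Set Γ} (hJ : MeasurableSet (J • F')) :
    (∫⁻ x, ENNReal.ofReal (u x) ∂m) * haar J =
      (∫⁻ x, ENNReal.ofReal (-u x) ∂m) * haar J + m (J • F') := by
  have hJm : Measurable ((J • F').indicator (1 : X → ℝ≥0∞)) := measurable_one.indicator hJ
  have hp : Measurable fun x => ENNReal.ofReal (u x) := hu.measurable.ennreal_ofReal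
  have hn : Measurable fun x => ENNReal.ofReal (-u x) := hu.measurable.neg.ennreal_ofReal
  have h1 := lintegral_mul_groupAverage haar hm hp hJm
  have h2 := lintegral_mul_groupAverage haar hm hn hJm
  simp only [hF'.lintegral_indicator_smul haar hJ] at h1 h2
  rw [lintegral_mul_const _ hp] at h1
  rw [lintegral_mul_const _ hn] at h2
  rw [h1, h2]
  simp only [hu.lintegral_posPart haar, mul_add, mul_one]
  rw [lintegral_add_right _ hJm, lintegral_indicator_one hJ]

end FundamentalDomain

end GroupAverage

/-! ### Mean traces of positive invariant fields. -/

section TraceOfPositiveField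

variable {X K : Type*} [MetricSpace X]

theorem Config.entry_self_nonneg (ω : Config X K) {T : ω.ell2 →L[ℂ] ω.ell2} (hT : 0 ≤ T)
    (x : ω.carrier) : 0 ≤ (ω.entry T x x).re := by
  rw [entry_eq_inner]
  exact ((ContinuousLinearMap.nonneg_iff_isPositive _).1 hT).re_inner_nonneg_right _

theorem Config.entry_self_eq_re (ω : Config X K) {T : ω.ell2 →L[ℂ] ω.ell2} (hT : 0 ≤ T)
    (x : ω.carrier) : ω.entry T x x = ((ω.entry T x x).re : ℂ) := by
  rw [entry_eq_inner]
  exact Complex.eq_re_of_ofReal_le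
    (((ContinuousLinearMap.nonneg_iff_isPositive _).1 hT).inner_nonneg_right _)

theorem Config.trace_eq_sum (ω : Config X K) {u : X → ℝ} (hu : HasCompactSupport u)
    (T : ω.ell2 →L[ℂ] ω.ell2) :
    ω.trace u T = ∑ x ∈ (ω.finite_preimage hu).toFinset, (u x : ℂ) * ω.entry T x x := by
  refine finsum_eq_sum_of_support_subset _ fun x hx => ?_
  have : u x ≠ 0 := fun h => hx (by simp [h])
  simp [subset_tsupport u this]

theorem Config.trace_sub (ω : Config X K) {u : X → ℝ} (hu : HasCompactSupport u)
    (S T : ω.ell2 →L[ℂ] ω.ell2) : ω.trace u (S - T) = ω.trace u S - ω.trace u T := by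
  simp only [ω.trace_eq_sum hu, ← Finset.sum_sub_distrib, entry_eq_apply, sub_apply, lp.coeFn_sub,
    Pi.sub_apply, mul_sub]

theorem Config.trace_add (ω : Config X K) {u : X → ℝ} (hu : HasCompactSupport u)
    (S T : ω.ell2 →L[ℂ] ω.ell2) : ω.trace u (S + T) = ω.trace u S + ω.trace u T := by
  simp only [ω.trace_eq_sum hu, ← Finset.sum_add_distrib, entry_eq_apply, add_apply, lp.coeFn_add,
    Pi.add_apply, mul_add]

theorem Config.trace_zero (ω : Config X K) (u : X → ℝ) : ω.trace u 0 = 0 := by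
  simp [trace, entry_eq_apply]

theorem Config.trace_smul (ω : Config X K) {u : X → ℝ} (hu : HasCompactSupport u) (c : ℂ)
    (T : ω.ell2 →L[ℂ] ω.ell2) : ω.trace u (c • T) = c * ω.trace u T := by
  simp only [ω.trace_eq_sum hu, Finset.mul_sum, entry_eq_apply, smul_apply, lp.coeFn_smul,
    Pi.smul_apply, smul_eq_mul, mul_left_comm c]

variable [MeasurableSpace X]

theorem Config.trace_eq_lintegral_sub (ω : Config X K) {T : ω.ell2 →L[ℂ] ω.ell2} (hT : 0 ≤ T)
    {u : X → ℝ} (hu : Measurable u) (huc : HasCompactSupport u) :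
    ω.trace u T = (((∫⁻ x, ENNReal.ofReal (u x) ∂(ω.diagMeasure T)).toReal -
      (∫⁻ x, ENNReal.ofReal (-u x) ∂(ω.diagMeasure T)).toReal : ℝ) : ℂ) := by
  have hmem : ∀ x : ω.carrier, u x ≠ 0 → x ∈ (ω.finite_preimage huc).toFinset := fun x hx => by
    simp [subset_tsupport u hx]
  rw [ω.trace_eq_sum huc, ω.lintegral_diagMeasure_eq_sum T hu.ennreal_ofReal
    (t := (ω.finite_preimage huc).toFinset) (fun x hx => hmem x fun h => hx (by simp [h])),
    ω.lintegral_diagMeasure_eq_sum T (f := fun x => ENNReal.ofReal (-u x)) hu.neg.ennreal_ofReal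
    (t := (ω.finite_preimage huc).toFinset) (fun x hx => hmem x fun h => hx (by simp [h])),
    ENNReal.toReal_sum fun x _ => ENNReal.mul_ne_top ENNReal.ofReal_ne_top ENNReal.ofReal_ne_top,
    ENNReal.toReal_sum fun x _ => ENNReal.mul_ne_top ENNReal.ofReal_ne_top ENNReal.ofReal_ne_top,
    ← Finset.sum_sub_distrib, Complex.ofReal_sum]
  refine Finset.sum_congr rfl fun x _ => ?_
  rw [ω.entry_self_eq_re hT x, ENNReal.toReal_mul, ENNReal.toReal_mul, ENNReal.toReal_ofReal',
    ENNReal.toReal_ofReal', ENNReal.toReal_ofReal', ← mul_sub, max_zero_sub_max_neg_zero_eq_self,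
    max_eq_left (by simpa using ω.entry_self_nonneg hT x), mul_comm]
  simp

variable [LocallyCompactSpace X] [SecondCountableTopology X] [BorelSpace X] [TopologicalSpace K]

/-- Fields of bounded positive operators with invariant diagonal. -/
structure IsPositiveInvariant (Γ : Type*) [Group Γ] [MulAction Γ X] [IsIsometricSMul Γ X]
    (μ : Measure (Config X K)) (T : OperatorField X K) : Prop where
  borel : IsBorelField μ T
  nonneg : ∀ᵐ ω ∂μ, 0 ≤ T ω
  bounded : ∃ C : ℝ, ∀ᵐ ω ∂μ, ‖T ω‖ ≤ C
  diagInvariant : IsDiagInvariant Γ μ T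

variable {μ : Measure (Config X K)} {T : OperatorField X K}
  {Γ : Type*} [Group Γ] [MulAction Γ X] [IsIsometricSMul Γ X]

theorem IsPositiveInvariant.meanMeasure_lt_top [IsFiniteMeasure μ]
    (hT : IsPositiveInvariant Γ μ T) {S : Set X} (hS : IsCompact S) :
    hT.borel.meanMeasure S < ∞ := by
  obtain ⟨C, hC⟩ := hT.bounded
  exact hT.borel.meanMeasure_lt_top hC hS

theorem IsPositiveInvariant.isFiniteMeasureOnCompacts [IsFiniteMeasure μ]
    (hT : IsPositiveInvariant Γ μ T) : IsFiniteMeasureOnCompacts hT.borel.meanMeasure :=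
  ⟨fun _ hS => hT.meanMeasure_lt_top hS⟩

theorem IsPositiveInvariant.lintegral_lt_top [IsFiniteMeasure μ] (hT : IsPositiveInvariant Γ μ T)
    {v : X → ℝ} (hv : HasCompactSupport v) {C : ℝ} (hC : ∀ x, |v x| ≤ C) :
    ∫⁻ x, ENNReal.ofReal (v x) ∂hT.borel.meanMeasure < ∞ := by
  have hle : ∀ x, ENNReal.ofReal (v x) ≤ (tsupport v).indicator (fun _ => ENNReal.ofReal C) x := by
    intro x
    by_cases hx : x ∈ tsupport v
    · rw [Set.indicator_of_mem hx]
      exact ENNReal.ofReal_le_ofReal ((le_abs_self _).trans (hC x))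
    · simp [image_eq_zero_of_notMem_tsupport hx]
  refine (lintegral_mono hle).trans_lt ?_
  rw [lintegral_indicator_const (isClosed_tsupport v).measurableSet]
  exact ENNReal.mul_lt_top ENNReal.ofReal_lt_top (hT.meanMeasure_lt_top hv)

theorem IsPositiveInvariant.integrable_trace [IsFiniteMeasure μ] (hT : IsPositiveInvariant Γ μ T)
    {u : X → ℝ} (hu : Measurable u) (huc : HasCompactSupport u) {C : ℝ} (hC : ∀ x, |u x| ≤ C) :
    Integrable (fun ω => ω.trace u (T ω)) μ ∧ ∫ ω, ω.trace u (T ω) ∂μ =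
      (((∫⁻ x, ENNReal.ofReal (u x) ∂hT.borel.meanMeasure).toReal -
        (∫⁻ x, ENNReal.ofReal (-u x) ∂hT.borel.meanMeasure).toReal : ℝ) : ℂ) := by
  have hpm := hu.ennreal_ofReal
  have hnm : Measurable fun x => ENNReal.ofReal (-u x) := hu.neg.ennreal_ofReal
  have hp := hT.lintegral_lt_top huc hC
  have hn := hT.lintegral_lt_top (v := fun x => -u x) huc.neg (C := C) fun x => by
    rw [abs_neg]
    exact hC x
  have ep := hT.borel.lintegral_meanMeasure hpm
  have en := hT.borel.lintegral_meanMeasure hnm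
  have ap := hT.borel.aemeasurable_lintegral_diagMeasure hpm
  have an := hT.borel.aemeasurable_lintegral_diagMeasure hnm
  have heq : (fun ω => ω.trace u (T ω)) =ᵐ[μ] fun ω =>
      (((∫⁻ x, ENNReal.ofReal (u x) ∂(ω.diagMeasure (T ω))).toReal -
        (∫⁻ x, ENNReal.ofReal (-u x) ∂(ω.diagMeasure (T ω))).toReal : ℝ) : ℂ) := by
    filter_upwards [hT.nonneg] with ω hω
    exact ω.trace_eq_lintegral_sub hω hu huc
  have ip := integrable_toReal_of_lintegral_ne_top ap (ep ▸ hp.ne)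
  have in' := integrable_toReal_of_lintegral_ne_top an (en ▸ hn.ne)
  refine ⟨(ip.sub in').ofReal.congr heq.symm, ?_⟩
  rw [integral_congr_ae heq, integral_complex_ofReal, integral_sub ip in',
    integral_toReal ap (ae_lt_top' ap (ep ▸ hp.ne)),
    integral_toReal an (ae_lt_top' an (en ▸ hn.ne)),
    ep, en]

variable [MetricSpace Γ] [IsTopologicalGroup Γ] [SecondCountableTopology Γ]
  [MeasurableSpace Γ] [BorelSpace Γ] [ContinuousSMul Γ X] {F' : Set X}

/-- The right side does not contain `u`: this is where the trace becomes independent of the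
admissible function. -/
theorem IsPositiveInvariant.integral_trace_of_isAdmissible [IsFiniteMeasure μ]
    [SMulInvariantMeasure Γ (Config X K) μ] (hT : IsPositiveInvariant Γ μ T)
    (haar : Measure Γ) [haar.IsMulLeftInvariant] [haar.IsInvInvariant] [SFinite haar]
    (hF' : IsRoughFundamentalDomain Γ F') {u : X → ℝ} (hu : IsAdmissible haar u) {J : Set Γ}
    (hJ : IsCompact J) (h0 : haar J ≠ 0) (htop : haar J ≠ ∞) :
    ∫ ω, ω.trace u (T ω) ∂μ =
      ((hT.borel.meanMeasure.real (J • F') / haar.real J : ℝ) : ℂ) := by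
  have := hT.isFiniteMeasureOnCompacts
  obtain ⟨C, hC⟩ := hu.bounded
  rw [(hT.integrable_trace hu.measurable hu.hasCompactSupport hC).2]
  congr 1
  have h := hu.lintegral_mul_measure (m := hT.borel.meanMeasure) haar hF'
    (fun γ f hf => hT.borel.lintegral_meanMeasure_smul hT.diagInvariant γ hf)
    (hF'.measurableSet_smul hJ)
  have hn := hT.lintegral_lt_top (v := fun x => -u x) hu.hasCompactSupport.neg (C := C) fun x => by
    rw [abs_neg]
    exact hC x
  have hm : hT.borel.meanMeasure (J • F') ≠ ∞ :=
    ((measure_mono (Set.smul_subset_smul_left subset_closure)).trans_lt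
      (hT.meanMeasure_lt_top (hF'.isCompact_smul_closure hJ))).ne
  have h2 := congrArg ENNReal.toReal h
  rw [ENNReal.toReal_add (ENNReal.mul_ne_top hn.ne htop) hm, ENNReal.toReal_mul,
    ENNReal.toReal_mul] at h2
  have h3 : haar.real J ≠ 0 := ENNReal.toReal_ne_zero.2 ⟨h0, htop⟩
  rw [eq_div_iff h3, sub_mul, Measure.real, Measure.real]
  linarith

end TraceOfPositiveField

/-! ### The trace over a window is bounded by the number of boundary points. -/

section DimensionInequality

theorem starProjection_sub_starProjection {V : Type*} [NormedAddCommGroup V]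
    [InnerProductSpace ℂ V] {A B : Submodule ℂ V} [A.HasOrthogonalProjection]
    [B.HasOrthogonalProjection] [(B ⊓ Aᗮ).HasOrthogonalProjection] (h : A ≤ B) (v : V) :
    (B ⊓ Aᗮ).starProjection v = B.starProjection v - A.starProjection v := by
  have hA := Submodule.starProjection_inner_eq_zero (K := A) v
  have hB := Submodule.starProjection_inner_eq_zero (K := B) v
  refine Submodule.eq_starProjection_of_mem_of_inner_eq_zero ⟨Submodule.sub_mem _
    (Submodule.starProjection_apply_mem _ _) (h (Submodule.starProjection_apply_mem _ _)), ?_⟩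
    fun w hw => ?_
  · rw [SetLike.mem_coe, Submodule.mem_orthogonal']
    intro w hw
    have e : B.starProjection v - A.starProjection v =
        (v - A.starProjection v) - (v - B.starProjection v) := by abel
    rw [e, inner_sub_left, hA w hw, hB w (h hw), sub_zero]
  · have e : v - (B.starProjection v - A.starProjection v) =
        (v - B.starProjection v) + A.starProjection v := by abel
    rw [e, inner_add_left, hB w hw.1,
      (Submodule.mem_orthogonal _ _).1 hw.2 _ (Submodule.starProjection_apply_mem _ _), add_zero]

variable {X K : Type*} [MetricSpace X]

namespace Config

variable (ω : Config X K) (T : ω.ell2 →L[ℂ] ω.ell2)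

theorem apply_eq_zero_of_finiteRange {R : ℝ}
    (hR : ∀ x y : ω.carrier, R ≤ dist (x : X) y → ω.entry T x y = 0) {w : ω.ell2} {x : ω.carrier}
    (hw : ∀ y : ω.carrier, dist (x : X) y < R → w y = 0) : T w x = 0 := by
  have h1 := ((ω.hasSum_delta w).mapL T).mapL (innerSL ℂ (ω.delta x))
  have h2 : ∀ y : ω.carrier, innerSL ℂ (ω.delta x) (T (w y • ω.delta y)) = 0 := fun y => by
    rw [map_smul, innerSL_apply_apply, inner_smul_right, ← entry_eq_inner]
    by_cases hy : dist (x : X) y < R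
    · rw [hw y hy, zero_mul]
    · rw [hR x y (not_lt.1 hy), mul_zero]
  simp only [h2] at h1
  rw [← ω.inner_delta_left]
  exact h1.unique hasSum_zero

theorem sum_sq_norm_le (v : ω.ell2) (t : Finset ω.carrier) : ∑ x ∈ t, ‖v x‖ ^ 2 ≤ ‖v‖ ^ 2 := by
  have := lp.sum_rpow_le_norm_rpow (p := 2) (by simp) v t
  simpa using this

theorem re_entry_starProjection (M : Submodule ℂ ω.ell2) [M.HasOrthogonalProjection]
    (x : ω.carrier) : (ω.entry M.starProjection x x).re = ‖M.starProjection (ω.delta x)‖ ^ 2 := by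
  have h : M.starProjection (M.starProjection (ω.delta x)) = M.starProjection (ω.delta x) :=
    Submodule.starProjection_eq_self_iff.2 (Submodule.starProjection_apply_mem _ _)
  rw [entry_eq_inner, ← h, ← Submodule.inner_starProjection_left_eq_right,
    inner_self_eq_norm_sq_to_K, h, ← Complex.ofReal_re (‖M.starProjection (ω.delta x)‖ ^ 2)]
  push_cast
  rfl

/-- The trace of a projection over a finite set is at most the dimension of a space onto which the
corresponding vectors of its range embed. -/
theorem sum_entry_starProjection_le (M : Submodule ℂ ω.ell2) [M.HasOrthogonalProjection]
    (U B : Finset ω.carrier)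
    (h : ∀ v ∈ M, (∀ x ∈ B, v x = 0) → ∀ x ∈ U, v x = 0) :
    ∑ x ∈ U, (ω.entry M.starProjection x x).re ≤ B.card := by
  classical
  -- Only the span W of the projected unit vectors over U contributes to the trace, and it has
  -- finite dimension even if M does not.
  let W : Submodule ℂ ω.ell2 := Submodule.span ℂ
    (U.image fun x => M.starProjection (ω.delta x) : Set ω.ell2)
  have hWM : W ≤ M := Submodule.span_le.2 fun v hv => by
    obtain ⟨x, -, rfl⟩ := Finset.mem_image.1 hv
    exact Submodule.starProjection_apply_mem _ _
  have hmemW : ∀ x ∈ U, M.starProjection (ω.delta x) ∈ W := fun x hx =>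
    Submodule.subset_span (Finset.mem_coe.2 (Finset.mem_image_of_mem _ hx))
  have hself : ∀ v ∈ W, ∀ x : ω.carrier,
      inner ℂ v (M.starProjection (ω.delta x)) = conj (v x) := fun v hv x => by
    rw [← Submodule.inner_starProjection_left_eq_right,
      Submodule.starProjection_eq_self_iff.2 (hWM hv), inner_delta_right]
  have : FiniteDimensional ℂ W := FiniteDimensional.span_finset ℂ _
  let ev : W →ₗ[ℂ] (B → ℂ) :=
    { toFun := fun v b => (v : ω.ell2) b
      map_add' := fun v w => rfl
      map_smul' := fun c v => rfl }
  -- An element of W vanishing on B vanishes on U, hence is orthogonal to the generators of W, hence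
  -- is zero. So dim W ≤ #B.
  have hinj : Function.Injective ev := by
    rw [← LinearMap.ker_eq_bot, LinearMap.ker_eq_bot']
    intro v hv
    have hU : ∀ x ∈ U, (v : ω.ell2) x = 0 :=
      h v (hWM v.2) fun x hx => congrFun hv ⟨x, hx⟩
    have horth : ∀ w ∈ W, inner ℂ (v : ω.ell2) w = 0 := by
      intro w hw
      induction hw using Submodule.span_induction with
      | mem w hw =>
        obtain ⟨x, hx, rfl⟩ := Finset.mem_image.1 hw
        rw [hself _ v.2, hU x hx, map_zero]
      | zero => exact inner_zero_right _
      | add w w' _ _ h1 h2 => rw [inner_add_right, h1, h2, add_zero]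
      | smul c w _ h1 => rw [inner_smul_right, h1, mul_zero]
    exact Subtype.ext (inner_self_eq_zero.1 (horth v v.2))
  have hdim : Module.finrank ℂ W ≤ B.card := by
    have := LinearMap.finrank_le_finrank_of_injective hinj
    simpa using this
  let b := stdOrthonormalBasis ℂ W
  have hx : ∀ x ∈ U, (ω.entry M.starProjection x x).re = ∑ i, ‖(b i : ω.ell2) x‖ ^ 2 := by
    intro x hx
    rw [re_entry_starProjection]
    have h1 := b.sum_sq_norm_inner_right ⟨_, hmemW x hx⟩
    rw [Submodule.coe_norm] at h1
    rw [← h1]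
    refine Finset.sum_congr rfl fun i _ => ?_
    rw [Submodule.coe_inner, hself _ (b i).2, RCLike.norm_conj]
  -- With an orthonormal basis of W the trace is the sum over basis vectors of their mass on U,
  -- which is at most 1 each.
  rw [Finset.sum_congr rfl hx, Finset.sum_comm]
  calc ∑ i, ∑ x ∈ U, ‖(b i : ω.ell2) x‖ ^ 2 ≤ ∑ _i : Fin (Module.finrank ℂ W), (1 : ℝ) := by
        refine Finset.sum_le_sum fun i _ => (ω.sum_sq_norm_le _ _).trans ?_
        have : ‖(b i : ω.ell2)‖ = 1 := b.orthonormal.1 i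
        rw [this, one_pow]
    _ ≤ B.card := by
        simpa using hdim

theorem compSpan_topologicalClosure_le (lam : ℝ) :
    (ω.compSpan T lam).topologicalClosure ≤ (T - (lam : ℂ) • 1).ker := by
  refine Submodule.topologicalClosure_minimal _ ?_ (ContinuousLinearMap.isClosed_ker _)
  rw [compSpan, Submodule.span_le]
  rintro v ⟨-, hv⟩
  exact mem_ker_sub_smul_one.2 (sub_eq_zero.1 hv)

/-- The eigenvectors of `T` that are orthogonal to the compactly supported ones. -/
def nonCompact (lam : ℝ) : Submodule ℂ ω.ell2 :=
  (T - (lam : ℂ) • 1).ker ⊓ ((ω.compSpan T lam).topologicalClosure)ᗮ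

instance (lam : ℝ) : CompleteSpace (ω.nonCompact T lam) :=
  IsClosed.completeSpace_coe
    (hs := (ContinuousLinearMap.isClosed_ker _).inter (Submodule.isClosed_orthogonal _))

theorem starProjection_nonCompact (lam : ℝ) :
    (ω.nonCompact T lam).starProjection = eigenProjection T lam -
      (ω.compSpan T lam).topologicalClosure.starProjection := by
  have : ((T - (lam : ℂ) • 1).ker ⊓
      ((ω.compSpan T lam).topologicalClosure)ᗮ).HasOrthogonalProjection :=
    inferInstanceAs ((ω.nonCompact T lam).HasOrthogonalProjection)
  exact ContinuousLinearMap.ext fun v =>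
    starProjection_sub_starProjection (ω.compSpan_topologicalClosure_le T lam) v

/-- A vector of `nonCompact` that vanishes near the boundary of L can be cut off at L without
ceasing to be an eigenvector. The cutoff is then orthogonal to the vector itself, which leaves no
mass on L. -/
theorem sum_entry_nonCompact_le {lam R : ℝ}
    (hR : ∀ x y : ω.carrier, R ≤ dist (x : X) y → ω.entry T x y = 0) (L B : Finset ω.carrier)
    (hB : ∀ x ∈ L, ∀ y ∉ L, dist (x : X) y < R → x ∈ B ∧ y ∈ B) :
    ∑ x ∈ L, (ω.entry (ω.nonCompact T lam).starProjection x x).re ≤ B.card := by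
  classical
  refine ω.sum_entry_starProjection_le _ L B fun v hv hvB => ?_
  have hv1 := mem_ker_sub_smul_one.1 hv.1
  have hv2 := hv.2
  let w : ω.ell2 := ∑ x ∈ L, v x • ω.delta x
  have hwL : ∀ x ∈ L, w x = v x := fun x hx => by
    rw [← ω.inner_delta_left, inner_sum, Finset.sum_eq_single_of_mem x hx]
    · rw [inner_smul_right, inner_delta_left, delta_apply_self, mul_one]
    · intro y _ hy
      rw [inner_smul_right, inner_delta_left, ω.delta_apply_ne hy.symm, mul_zero]
  have hwL' : ∀ x ∉ L, w x = 0 := fun x hx => by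
    rw [← ω.inner_delta_left, inner_sum]
    refine Finset.sum_eq_zero fun y hy => ?_
    have hne : x ≠ y := by
      rintro rfl
      exact hx hy
    rw [inner_smul_right, inner_delta_left, ω.delta_apply_ne hne, mul_zero]
  -- At x in L compare T w with T v, at x outside L compare it with 0. In either case the difference
  -- lives, within distance R of x, on boundary points in B, where v vanishes.
  have hTw : T w = (lam : ℂ) • w := by
    ext x
    rw [lp.coeFn_smul, Pi.smul_apply]
    by_cases hx : x ∈ L
    · have h1 : T (v - w) x = 0 := by
        refine ω.apply_eq_zero_of_finiteRange T hR fun y hy => ?_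
        rw [lp.coeFn_sub, Pi.sub_apply]
        by_cases hyL : y ∈ L
        · rw [hwL y hyL, sub_self]
        · rw [hwL' y hyL, sub_zero]
          exact hvB y (hB x hx y hyL hy).2
      rw [map_sub, lp.coeFn_sub, Pi.sub_apply, sub_eq_zero] at h1
      rw [← h1, hv1, lp.coeFn_smul, Pi.smul_apply, hwL x hx]
    · rw [hwL' x hx, smul_zero]
      refine ω.apply_eq_zero_of_finiteRange T hR fun y hy => ?_
      by_cases hyL : y ∈ L
      · rw [hwL y hyL]
        exact hvB y (hB y hyL x hx (by rwa [dist_comm])).1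
      · exact hwL' y hyL
  have hw : w ∈ (ω.compSpan T lam).topologicalClosure := by
    refine Submodule.le_topologicalClosure _ (Submodule.subset_span ⟨?_, sub_eq_zero.2 hTw⟩)
    refine L.finite_toSet.subset fun x hx => ?_
    by_contra hxL
    exact hx (hwL' x hxL)
  have h0 : inner ℂ w v = 0 := (Submodule.mem_orthogonal _ _).1 hv2 w hw
  have hsum : ∑ x ∈ L, ‖v x‖ ^ 2 = 0 := by
    have h1 : inner ℂ w v = ((∑ x ∈ L, ‖v x‖ ^ 2 : ℝ) : ℂ) := by
      rw [sum_inner, Complex.ofReal_sum]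
      refine Finset.sum_congr rfl fun x _ => ?_
      rw [inner_smul_left, inner_delta_left, mul_comm, Complex.mul_conj, Complex.normSq_eq_norm_sq]
    rw [h1] at h0
    exact_mod_cast h0
  intro x hx
  have := (Finset.sum_eq_zero_iff_of_nonneg fun x _ => sq_nonneg ‖v x‖).1 hsum x hx
  simpa using this

end Config

end DimensionInequality

/-! ### Amenability: there are no further eigenvectors. -/

section CompactlySupportedEigenvectors

variable {Γ X K : Type*} [MetricSpace X]

theorem Config.entry_one_self (ω : Config X K) (x : ω.carrier) : ω.entry 1 x x = 1 := by
  rw [entry_eq_apply, one_apply_eq_self, delta_apply_self]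

/-- The boundary estimate behind the choice of a Folner set. -/
theorem IsRoughFundamentalDomain.exists_boundary [Group Γ] [MetricSpace Γ] [IsIsometricSMul Γ Γ]
    [MulAction Γ X] {F' : Set X} (hF' : IsRoughFundamentalDomain Γ F') (R : ℝ) :
    ∃ r : ℝ, 0 ≤ r ∧ ∀ (J : Set Γ) (x y : X), x ∈ (J * Metric.closedBall 1 r) • F' →
      y ∉ (J * Metric.closedBall 1 r) • F' → dist x y < R →
      x ∈ ((J * Metric.closedBall 1 r * Metric.closedBall 1 r) \ J) • F' ∧
      y ∈ ((J * Metric.closedBall 1 r * Metric.closedBall 1 r) \ J) • F' := by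
  obtain ⟨a, b, ha, hb, hab⟩ := hF'.rough
  -- The lower rough isometry bound turns d(x,y) < R into d(α,β) < a(R + b); the maximum with 0 puts
  -- the identity into the ball C.
  refine ⟨max (a * (R + b)) 0, le_max_right _ _, fun J x y hx hy hxy => ?_⟩
  set C : Set Γ := Metric.closedBall 1 (max (a * (R + b)) 0)
  obtain ⟨α, hα, -⟩ := hF'.existsUnique x
  obtain ⟨β, hβ, -⟩ := hF'.existsUnique y
  rw [hF'.mem_smul_iff hα] at hx ⊢
  rw [hF'.mem_smul_iff hβ] at hy ⊢
  have hαβ : dist α β ≤ max (a * (R + b)) 0 := by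
    refine le_max_of_le_left ?_
    have h1 := (hab x y α β hα hβ).1
    have h2 : 1 / a * dist α β < R + b := by linarith
    rw [one_div, inv_mul_lt_iff₀ (by linarith)] at h2
    exact h2.le
  have hβα : α⁻¹ * β ∈ C := by
    rw [Metric.mem_closedBall, ← inv_mul_cancel α, dist_mul_left, dist_comm]
    exact hαβ
  have h1 : (1 : Γ) ∈ C := Metric.mem_closedBall_self (le_max_right _ _)
  have hJC : ∀ γ ∈ J, γ ∈ J * C := fun γ hγ => by simpa using Set.mul_mem_mul hγ h1
  have hprod : β = α * (α⁻¹ * β) := by group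
  -- The window is J C rather than J: from α in J one would get β in J C, so both sides of its
  -- boundary avoid J and lie in J C C.
  refine ⟨⟨by simpa using Set.mul_mem_mul hx h1, fun h => hy ?_⟩, ?_, fun h => hy (hJC _ h)⟩
  · rw [hprod]
    exact Set.mul_mem_mul h hβα
  · rw [hprod]
    exact Set.mul_mem_mul hx hβα

variable [MeasurableSpace X]

theorem Config.diagMeasure_eq_sum (ω : Config X K) (T : ω.ell2 →L[ℂ] ω.ell2) {S : Set X}
    (hS : MeasurableSet S) (hf : (((↑) : ω.carrier → X) ⁻¹' S).Finite) :
    ω.diagMeasure T S = ∑ x ∈ hf.toFinset, ENNReal.ofReal (ω.entry T x x).re := by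
  rw [← lintegral_indicator_one hS, ω.lintegral_diagMeasure_eq_sum T (measurable_one.indicator hS)
    (t := hf.toFinset)]
  · refine Finset.sum_congr rfl fun x hx => ?_
    have : (x : X) ∈ S := by simpa using hx
    simp [this]
  · intro x hx
    simpa using Set.mem_of_indicator_ne_zero hx

/-- If `B` contains both sides of the `R`-boundary of `L`, then the trace over `L` of the projection
onto the eigenvectors orthogonal to the compactly supported ones is at most the number of points of
`B`. -/
theorem Config.diagMeasure_nonCompact_le (ω : Config X K) {T : ω.ell2 →L[ℂ] ω.ell2} {lam R : ℝ}
    (hR : ∀ x y : ω.carrier, R ≤ dist (x : X) y → ω.entry T x y = 0) {L B : Set X}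
    (hLm : MeasurableSet L) (hBm : MeasurableSet B)
    (hL : (((↑) : ω.carrier → X) ⁻¹' L).Finite) (hB : (((↑) : ω.carrier → X) ⁻¹' B).Finite)
    (h : ∀ x ∈ L, ∀ y ∉ L, dist x y < R → x ∈ B ∧ y ∈ B) :
    ω.diagMeasure (ω.nonCompact T lam).starProjection L ≤ ω.diagMeasure 1 B := by
  rw [ω.diagMeasure_eq_sum _ hLm hL, ω.diagMeasure_eq_sum _ hBm hB]
  simp only [entry_one_self, Complex.one_re, ENNReal.ofReal_one, Finset.sum_const, nsmul_eq_mul,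
    mul_one]
  rw [← ENNReal.ofReal_sum_of_nonneg fun x _ => ?_, ← ENNReal.ofReal_natCast]
  · refine ENNReal.ofReal_le_ofReal (ω.sum_entry_nonCompact_le T hR _ _ fun x hx y hy hxy => ?_)
    simp only [Set.Finite.mem_toFinset, Set.mem_preimage] at hx hy ⊢
    exact h x hx y hy hxy
  · rw [re_entry_starProjection]
    positivity

/-- The diagonal entry of a projection at x is the squared norm of the projected unit vector, so a
vanishing diagonal kills all unit vectors. -/
theorem Config.eq_zero_of_diagMeasure_eq_zero (ω : Config X K) (M : Submodule ℂ ω.ell2)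
    [M.HasOrthogonalProjection] (h : ω.diagMeasure M.starProjection Set.univ = 0) :
    M.starProjection = 0 := by
  rw [← lintegral_indicator_one MeasurableSet.univ, Set.indicator_univ,
    ω.lintegral_diagMeasure _ measurable_one, ENNReal.tsum_eq_zero] at h
  have hd : ∀ x, M.starProjection (ω.delta x) = 0 := fun x => by
    have h1 := h x
    rw [Pi.one_apply, mul_one, ENNReal.ofReal_eq_zero, re_entry_starProjection] at h1
    rw [← norm_eq_zero]
    exact pow_eq_zero_iff two_ne_zero |>.1 (le_antisymm h1 (sq_nonneg _))
  ext1 v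
  have h1 := (ω.hasSum_delta v).mapL M.starProjection
  simp only [map_smul, hd, smul_zero] at h1
  exact h1.unique hasSum_zero

variable [LocallyCompactSpace X] [SecondCountableTopology X] [BorelSpace X]
  [Group Γ] [MetricSpace Γ] [IsTopologicalGroup Γ] [ProperSpace Γ]
  [MeasurableSpace Γ] [BorelSpace Γ] [MulAction Γ X] [ContinuousSMul Γ X] [IsIsometricSMul Γ X]
  {haar : Measure Γ} [haar.IsHaarMeasure] [haar.IsInvInvariant]
  {F' : Set X} [TopologicalSpace K] {μ : Measure (Config X K)} [IsFiniteMeasure μ]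
  [SMulInvariantMeasure Γ (Config X K) μ]

theorem IsPositiveInvariant.measure_smul_mul {T : OperatorField X K}
    (hT : IsPositiveInvariant Γ μ T) (hF' : IsRoughFundamentalDomain Γ F') {L J : Set Γ}
    (hL : MeasurableSet (L • F')) (hJ : MeasurableSet (J • F')) :
    hT.borel.meanMeasure (L • F') * haar J = hT.borel.meanMeasure (J • F') * haar L := by
  have := hT.isFiniteMeasureOnCompacts
  exact hF'.measure_smul_mul haar
    (fun γ f hf => hT.borel.lintegral_meanMeasure_smul hT.diagInvariant γ hf) hL hJ

variable [IsIsometricSMul Γ Γ]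

/-- Fields of eigenvectors of an operator of finite range that are orthogonal to all compactly
supported eigenvectors vanish, by amenability. -/
theorem starProjection_nonCompact_ae_eq_zero (hamenable : IsAmenable haar)
    (hF' : IsRoughFundamentalDomain Γ F') {H : OperatorField X K} {lam R : ℝ}
    (hR : ∀ᵐ ω ∂μ, ∀ x y : ω.carrier, R ≤ dist (x : X) y → ω.entry (H ω) x y = 0)
    (hQ : IsPositiveInvariant Γ μ fun ω => (ω.nonCompact (H ω) lam).starProjection)
    (hone : IsPositiveInvariant Γ μ fun _ => 1) :
    ∀ᵐ ω ∂μ, (ω.nonCompact (H ω) lam).starProjection = 0 := by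
  obtain ⟨I, hI⟩ := hamenable
  obtain ⟨r, hr, hbd⟩ := hF'.exists_boundary R
  set C : Set Γ := Metric.closedBall 1 r
  have hC : IsCompact C := isCompact_closedBall 1 r
  have hCne : C.Nonempty := ⟨1, Metric.mem_closedBall_self hr⟩
  have hfin : ∀ (ω : Config X K) {J : Set Γ}, IsCompact J →
      (((↑) : ω.carrier → X) ⁻¹' (J • F')).Finite := fun ω J hJ =>
    (ω.finite_preimage (hF'.isCompact_smul_closure hJ)).subset
      (Set.preimage_mono (Set.smul_subset_smul_left subset_closure))
  -- The dimension inequality, averaged over μ, with window (J C) F' and boundary (J C C \ J) F'.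
  -- The number of boundary points is the diagonal measure of the identity field.
  have key : ∀ J : Set Γ, IsCompact J → hQ.borel.meanMeasure (J • F') ≤
      hone.borel.meanMeasure (((J * C * C) \ J) • F') ∧ MeasurableSet (((J * C * C) \ J) • F') := by
    intro J hJ
    have hJC := hJ.mul hC
    have hset : ((J * C * C) \ J) • F' = (J * C * C) • F' \ J • F' := by
      ext x
      obtain ⟨α, hα, -⟩ := hF'.existsUnique x
      rw [Set.mem_sdiff, hF'.mem_smul_iff hα, hF'.mem_smul_iff hα, hF'.mem_smul_iff hα,
        Set.mem_sdiff]
    have hm : MeasurableSet (((J * C * C) \ J) • F') := by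
      rw [hset]
      exact (hF'.measurableSet_smul (hJC.mul hC)).diff (hF'.measurableSet_smul hJ)
    refine ⟨?_, hm⟩
    have hsub : J • F' ⊆ (J * C) • F' := Set.smul_subset_smul_right fun γ hγ => by
      simpa using Set.mul_mem_mul hγ (Metric.mem_closedBall_self hr : (1 : Γ) ∈ C)
    refine (measure_mono hsub).trans ?_
    rw [hQ.borel.meanMeasure_apply (hF'.measurableSet_smul hJC), hone.borel.meanMeasure_apply hm]
    refine lintegral_mono_ae ?_
    filter_upwards [hR] with ω hω
    refine ω.diagMeasure_nonCompact_le hω (hF'.measurableSet_smul hJC) hm (hfin ω hJC)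
      ((hfin ω (hJC.mul hC)).subset (Set.preimage_mono (Set.smul_subset_smul_right
        Set.sdiff_subset))) fun x hx y hy hxy => hbd J x y hx hy hxy
  have hzero : ∀ J₀ : Set Γ, IsCompact J₀ → hQ.borel.meanMeasure (J₀ • F') = 0 := by
    intro J₀ hJ₀
    have hfin₁ : hone.borel.meanMeasure (J₀ • F') ≠ ∞ :=
      ((measure_mono (Set.smul_subset_smul_left subset_closure)).trans_lt
        (hone.meanMeasure_lt_top (hF'.isCompact_smul_closure hJ₀))).ne
    have hle : ∀ ε : ℝ, 0 < ε → hQ.borel.meanMeasure (J₀ • F') ≤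
        hone.borel.meanMeasure (J₀ • F') * ENNReal.ofReal ε := by
      intro ε hε
      obtain ⟨n, hn⟩ :=
        (hI.small (C⁻¹ * C⁻¹) (hC.inv.mul hC.inv) (hCne.inv.mul hCne.inv) ε hε).exists
      -- The Folner condition concerns multiplication from the left, the window is thickened from
      -- the right; inversion exchanges the two and preserves Haar measure.
      set J : Set Γ := (I n)⁻¹
      have hJ : IsCompact J := (hI.isCompact n).inv
      have hJI : haar J = haar (I n) := Measure.measure_inv _ _
      have h0 : haar J ≠ 0 := fun h => by
        rw [hJI] at h
        rw [h, mul_zero] at hn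
        exact not_lt_zero hn
      have hbdry : haar ((J * C * C) \ J) ≤ ENNReal.ofReal ε * haar J := by
        rw [hJI, ← Measure.measure_inv]
        refine (measure_mono ?_).trans hn.le
        have : ((J * C * C) \ J)⁻¹ = (C⁻¹ * C⁻¹ * I n) \ I n := by
          have h1 : (J * C * C)⁻¹ = C⁻¹ * C⁻¹ * I n := by
            simp only [J, mul_inv_rev, inv_inv, mul_assoc]
          rw [← h1]
          ext γ
          simp only [J, Set.mem_inv, Set.mem_sdiff, inv_inv]
        rw [this]
        exact Set.subset_union_right
      obtain ⟨hk1, hk2⟩ := key J hJ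
      -- Proportionality carries the estimate from the large set J to the fixed set J₀, at the cost
      -- of a factor ε.
      have h1 : hQ.borel.meanMeasure (J₀ • F') * haar J ≤
          hone.borel.meanMeasure (J₀ • F') * ENNReal.ofReal ε * haar J :=
        calc _ = hQ.borel.meanMeasure (J • F') * haar J₀ :=
              hQ.measure_smul_mul hF' (hF'.measurableSet_smul hJ₀) (hF'.measurableSet_smul hJ)
          _ ≤ hone.borel.meanMeasure (((J * C * C) \ J) • F') * haar J₀ := mul_le_mul_left hk1 _
          _ = hone.borel.meanMeasure (J₀ • F') * haar ((J * C * C) \ J) :=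
              hone.measure_smul_mul hF' hk2 (hF'.measurableSet_smul hJ₀)
          _ ≤ hone.borel.meanMeasure (J₀ • F') * (ENNReal.ofReal ε * haar J) :=
              mul_le_mul_right hbdry _
          _ = _ := (mul_assoc _ _ _).symm
      exact (ENNReal.mul_le_mul_iff_left h0 hJ.measure_lt_top.ne).1 h1
    have hlim : Tendsto (fun n : ℕ => hone.borel.meanMeasure (J₀ • F') *
        ENNReal.ofReal (1 / ((n : ℝ) + 1))) atTop (𝓝 0) := by
      have := ENNReal.Tendsto.const_mul (ENNReal.tendsto_ofReal
        tendsto_one_div_add_atTop_nhds_zero_nat) (Or.inr hfin₁)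
      simpa using this
    exact le_antisymm (ge_of_tendsto' hlim fun n => hle _ (by positivity)) zero_le
  have huniv : hQ.borel.meanMeasure Set.univ = 0 := by
    have : (Set.univ : Set X) = ⋃ n : ℕ, (Metric.closedBall (1 : Γ) n) • F' := by
      refine (Set.eq_univ_of_forall fun x => ?_).symm
      obtain ⟨α, hα, -⟩ := hF'.existsUnique x
      obtain ⟨n, hn⟩ := exists_nat_ge (dist α 1)
      exact Set.mem_iUnion.2 ⟨n, (hF'.mem_smul_iff hα _).2 hn⟩
    rw [this]
    exact measure_iUnion_null fun n => hzero _ (isCompact_closedBall _ _)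
  rw [hQ.borel.meanMeasure_apply MeasurableSet.univ,
    lintegral_eq_zero_iff' (hQ.borel.aemeasurable_diagMeasure MeasurableSet.univ)] at huniv
  filter_upwards [huniv] with ω hω
  exact ω.eq_zero_of_diagMeasure_eq_zero _ hω

end CompactlySupportedEigenvectors

/-! ### The density of states measure and its atoms. -/

section DensityOfStates

section Intertwining

variable {X K : Type*} [MetricSpace X] [TopologicalSpace K] {μ : Measure (Config X K)}
  {Γ : Type*} [Group Γ] [MulAction Γ X] [IsIsometricSMul Γ X] {s : Γ → X → Circle}

variable {H : OperatorField X K}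

theorem ConditionA.ae_apply_transport (hH : ConditionA μ s H)
    (hsupport : ∀ᵐ ω ∂μ, ω ∈ μ.support) (γ : Γ) :
    ∀ᵐ ω ∂μ, ∀ v, H (γ • ω) (ω.transport s γ v) = ω.transport s γ (H ω v) := by
  filter_upwards [hsupport] with ω hω
  exact hH.toIsEquivariantField.apply_transport γ hω

theorem ConditionA.exists_ae_norm_le (hH : ConditionA μ s H)
    (hsupport : ∀ᵐ ω ∂μ, ω ∈ μ.support) : ∃ C : ℝ, ∀ᵐ ω ∂μ, ‖H ω‖ ≤ C := by
  obtain ⟨C, hC⟩ := hH.bounded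
  exact ⟨C, hsupport.mono hC⟩

/-- Traces of contractions against a function of compact support are uniformly bounded. -/
theorem Config.exists_norm_trace_le (K : Type*) {u : X → ℝ} (hu : HasCompactSupport u) {C : ℝ}
    (hC : ∀ x, |u x| ≤ C) :
    ∃ M : ℝ, ∀ (ω : Config X K) (T : ω.ell2 →L[ℂ] ω.ell2), ‖T‖ ≤ 1 → ‖ω.trace u T‖ ≤ M := by
  obtain ⟨N, hN⟩ := exists_encard_le (K := K) hu
  refine ⟨N * |C|, fun ω T hT => ?_⟩
  rw [ω.trace_eq_sum hu]
  have hcard : ((ω.finite_preimage hu).toFinset.card : ℝ) ≤ N := by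
    have h := hN ω
    rw [(ω.finite_preimage hu).encard_eq_coe_toFinset_card] at h
    exact_mod_cast h
  refine (norm_sum_le _ _).trans <| (Finset.sum_le_card_nsmul _ _ |C| fun x _ => ?_).trans ?_
  · rw [norm_mul, Complex.norm_real, Real.norm_eq_abs]
    exact (mul_le_of_le_one_right (abs_nonneg _) ((ω.norm_entry_le T x x).trans hT)).trans
      ((hC x).trans (le_abs_self C))
  · rw [nsmul_eq_mul]
    exact mul_le_mul_of_nonneg_right hcard (abs_nonneg C)

variable [MeasurableSpace X]

theorem IsBorelField.isPositiveInvariant {T : OperatorField X K} (hT : IsBorelField μ T)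
    (h0 : ∀ᵐ ω ∂μ, 0 ≤ T ω) {C : ℝ} (hC : ∀ᵐ ω ∂μ, ‖T ω‖ ≤ C)
    (h : ∀ γ : Γ, ∀ᵐ ω ∂μ, ∀ v, T (γ • ω) (ω.transport s γ v) = ω.transport s γ (T ω v)) :
    IsPositiveInvariant Γ μ T where
  borel := hT
  nonneg := h0
  bounded := ⟨C, hC⟩
  diagInvariant γ := by
    filter_upwards [h γ] with ω hω x
    exact ω.entry_smulPoint hω x

theorem starProjection_nonneg {V : Type*} [NormedAddCommGroup V] [InnerProductSpace ℂ V]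
    [CompleteSpace V] (M : Submodule ℂ V) [M.HasOrthogonalProjection] :
    0 ≤ M.starProjection :=
  isStarProjection_starProjection.nonneg

variable [LocallyCompactSpace X] [BorelSpace X] [CompactSpace K] [T2Space K]

variable (Γ μ) in
theorem isPositiveInvariant_one : IsPositiveInvariant Γ μ fun _ => 1 :=
  IsBorelField.one.isPositiveInvariant (s := fun _ _ => 1) (.of_forall fun _ => zero_le_one)
    (C := 1) (.of_forall fun _ => ContinuousLinearMap.norm_id_le) fun _ => .of_forall fun _ _ => rfl

variable [SecondCountableTopology X]

theorem ConditionA.isEquivariantField_compProjection (hH : ConditionA μ s H)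
    (hsupport : ∀ᵐ ω ∂μ, ω ∈ μ.support) (lam : ℝ) :
    IsEquivariantField μ s (compProjection H lam) where
  measurable := by
    obtain ⟨C, hC⟩ := hH.exists_ae_norm_le hsupport
    exact (hH.measurable.isBorelField.compProjection hC lam).isMeasurableField
  bounded := ⟨1, fun ω _ => Submodule.starProjection_norm_le _⟩
  equivariant γ ω hω := (ω.equivariant_iff s γ).2
    (ω.compProjection_transport s γ (hH.toIsEquivariantField.apply_transport γ hω) lam)

theorem ConditionA.isPositiveInvariant_compProjection (hH : ConditionA μ s H)
    (hsupport : ∀ᵐ ω ∂μ, ω ∈ μ.support) (lam : ℝ) :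
    IsPositiveInvariant Γ μ (compProjection H lam) := by
  have h := hH.isEquivariantField_compProjection hsupport lam
  refine h.measurable.isBorelField.isPositiveInvariant (s := s)
    (.of_forall fun ω => starProjection_nonneg _) (C := 1)
    (.of_forall fun ω => Submodule.starProjection_norm_le _) fun γ => ?_
  filter_upwards [hsupport] with ω hω
  exact h.apply_transport γ hω

theorem ConditionA.isPositiveInvariant_nonCompact (hH : ConditionA μ s H)
    (hsupport : ∀ᵐ ω ∂μ, ω ∈ μ.support) (lam : ℝ) :
    IsPositiveInvariant Γ μ fun ω => (ω.nonCompact (H ω) lam).starProjection := by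
  obtain ⟨C, hC⟩ := hH.exists_ae_norm_le hsupport
  have hB := hH.measurable.isBorelField
  have h : IsBorelField μ fun ω => (ω.nonCompact (H ω) lam).starProjection :=
    ((hB.eigenProjection hH.selfAdjoint hC lam).sub (hB.compProjection hC lam)).congr_ae
      (.of_forall fun ω => (ω.starProjection_nonCompact (H ω) lam).symm)
  refine h.isPositiveInvariant (s := s) (.of_forall fun ω => starProjection_nonneg _) (C := 1)
    (.of_forall fun ω => Submodule.starProjection_norm_le _) fun γ => ?_
  filter_upwards [hH.ae_apply_transport hsupport γ] with ω hω v
  rw [Config.starProjection_nonCompact, Config.starProjection_nonCompact, sub_apply, sub_apply,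
    ω.eigenProjection_transport s γ hω, ω.compProjection_transport s γ hω, map_sub]

theorem ConditionA.isPositiveInvariant_contFun (hH : ConditionA μ s H)
    (hsupport : ∀ᵐ ω ∂μ, ω ∈ μ.support) {φ : ℝ → ℝ} (hφ : Continuous φ) (h0 : ∀ t, 0 ≤ φ t)
    {c : ℝ} (hc : ∀ t, |φ t| ≤ c) :
    IsPositiveInvariant Γ μ fun ω => contFun φ (H ω) := by
  obtain ⟨C, hC⟩ := hH.exists_ae_norm_le hsupport
  refine (hH.measurable.isBorelField.contFun hH.selfAdjoint hC hφ).isPositiveInvariant (s := s)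
    (.of_forall fun ω => contFun_nonneg h0 _) (.of_forall fun ω => norm_contFun_le hc _)
    fun γ => ?_
  filter_upwards [hH.ae_apply_transport hsupport γ, hH.selfAdjoint] with ω hω hsa v
  exact contFun_conj (ω.transport s γ) hφ hsa hω v

end Intertwining


theorem distribution_sub_leftLim (ν : Measure ℝ) [IsFiniteMeasure ν] (t : ℝ) :
    distribution ν t - Function.leftLim (distribution ν) t = ν.real {t} := by
  have hmono : Monotone (distribution ν) := fun a b hab =>
    measureReal_mono (Set.Iic_subset_Iic.2 hab)
  obtain ⟨u, hu, hut, hlim⟩ := exists_seq_strictMono_tendsto t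
  have h1 : Tendsto (fun n => distribution ν (u n)) atTop
      (𝓝 (Function.leftLim (distribution ν) t)) :=
    (hmono.tendsto_leftLim t).comp (tendsto_nhdsWithin_iff.2 ⟨hlim, .of_forall hut⟩)
  have h2 : Tendsto (fun n => distribution ν (u n)) atTop (𝓝 (ν.real (Set.Iio t))) := by
    rw [← iUnion_Iic_eq_Iio_of_lt_of_tendsto hut hlim]
    exact (ENNReal.tendsto_toReal (measure_ne_top ν _)).comp (tendsto_measure_iUnion_atTop
      fun i j hij => Set.Iic_subset_Iic.2 (hu.monotone hij))
  have h3 : Set.Iic t = Set.Iio t ∪ {t} := Set.Iio_union_right.symm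
  rw [tendsto_nhds_unique h1 h2, distribution, h3,
    measureReal_union (by simp) (measurableSet_singleton t), add_sub_cancel_left]

/-- Inner regularity of the whole line by compact sets, each dominated by a cutoff function with
values in [0, 1]. -/
theorem isFiniteMeasure_of_integral_le (ν : Measure ℝ) [IsLocallyFiniteMeasure ν] {M : ℝ}
    (h : ∀ φ : C_c(ℝ, ℝ), (∀ t, 0 ≤ φ t) → (∀ t, φ t ≤ 1) → ∫ t, φ t ∂ν ≤ M) :
    IsFiniteMeasure ν := by
  refine ⟨lt_of_le_of_lt ?_ (ENNReal.ofReal_lt_top (r := M))⟩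
  rw [isOpen_univ.measure_eq_iSup_isCompact]
  refine iSup₂_le fun S _ => iSup_le fun hS => ?_
  obtain ⟨f, hf1, -, hfc, hf⟩ := exists_continuous_one_zero_of_isCompact hS isClosed_empty
    (Set.disjoint_empty S)
  let φ : C_c(ℝ, ℝ) := ⟨f, hfc⟩
  have hle : ∀ t, S.indicator (1 : ℝ → ℝ≥0∞) t ≤ ENNReal.ofReal (φ t) := fun t => by
    by_cases ht : t ∈ S
    · have : φ t = 1 := hf1 ht
      simp [this, ht]
    · simp [ht]
  rw [← lintegral_indicator_one hS.measurableSet]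
  refine (lintegral_mono hle).trans ?_
  have hint := ofReal_integral_eq_lintegral_ofReal (μ := ν) (f := φ)
    (φ.continuous.integrable_of_hasCompactSupport φ.hasCompactSupport)
    (.of_forall fun t => (hf t).1)
  rw [← hint]
  exact ENNReal.ofReal_le_ofReal (h φ (fun t => (hf t).1) fun t => (hf t).2)

theorem measure_closedBall_one_ne_zero {Γ : Type*} [Group Γ] [MetricSpace Γ] [MeasurableSpace Γ]
    (haar : Measure Γ) [haar.IsOpenPosMeasure] : haar (Metric.closedBall (1 : Γ) 1) ≠ 0 :=
  (Metric.measure_closedBall_pos haar 1 one_pos).ne'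

theorem measure_closedBall_one_ne_top {Γ : Type*} [Group Γ] [MetricSpace Γ] [ProperSpace Γ]
    [MeasurableSpace Γ] (haar : Measure Γ) [IsFiniteMeasureOnCompacts haar] :
    haar (Metric.closedBall (1 : Γ) 1) ≠ ∞ :=
  (isCompact_closedBall (1 : Γ) 1).measure_lt_top.ne

section Existence

variable {X : Type*} [MetricSpace X] [MeasurableSpace X]
  {Γ : Type*} [Group Γ] [MetricSpace Γ] [MeasurableSpace Γ] {haar : Measure Γ} [MulAction Γ X]
  {F' : Set X} {K : Type*} [TopologicalSpace K] {μ : Measure (Config X K)}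
  {s : Γ → X → Circle} {H : OperatorField X K}

/-- Atoms of the density of states measure are traces of eigenprojections. -/
theorem IsDensityOfStates.measureReal_singleton [IsFiniteMeasure μ] {ν : Measure ℝ}
    (hν : IsDensityOfStates haar F' μ H ν) (hsa : ∀ᵐ ω ∂μ, IsSelfAdjoint (H ω)) {u : X → ℝ}
    (hu : IsAdmissible haar u) (lam : ℝ) :
    (ν.real {lam} : ℂ) = tau haar F' μ u fun ω => eigenProjection (H ω) lam := by
  have := hν.locallyFinite
  obtain ⟨C, hC⟩ := hu.bounded
  obtain ⟨M, hM⟩ := Config.exists_norm_trace_le K hu.hasCompactSupport hC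
  have h1 : Tendsto (fun n => ((∫ t, tent lam n t ∂ν : ℝ) : ℂ)) atTop (𝓝 (ν.real {lam} : ℂ)) :=
    (Complex.continuous_ofReal.tendsto _).comp (tendsto_integral_tent ν lam)
  refine tendsto_nhds_unique h1 ?_
  simp only [hν.integral_eq u hu]
  -- Tents of H_ω are contractions, so their traces against `u` share one constant bound, integrable
  -- because μ is finite.
  refine Tendsto.const_mul _ (tendsto_integral_of_dominated_convergence (fun _ => M)
    (fun n => (hν.integrable u hu (tent lam n)).aestronglyMeasurable) (integrable_const M)
    (fun n => .of_forall fun ω => hM ω _ (norm_contFun_tent_le _ lam n)) ?_)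
  filter_upwards [hsa] with ω hω
  simp only [ω.trace_eq_sum hu.hasCompactSupport, applyFun_eq_contFun]
  refine tendsto_finsetSum _ fun x _ => Tendsto.const_mul _ ?_
  simp only [Config.entry_eq_inner]
  exact tendsto_const_nhds.inner (tendsto_contFun_tent hω lam _)

variable [IsTopologicalGroup Γ] [ProperSpace Γ] [BorelSpace Γ] [haar.IsHaarMeasure]
  [haar.IsInvInvariant] [ContinuousSMul Γ X] [BorelSpace X]

variable (haar) in
theorem IsRoughFundamentalDomain.exists_isAdmissible (hF' : IsRoughFundamentalDomain Γ F') :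
    ∃ u : X → ℝ, IsAdmissible haar u :=
  ⟨_, hF'.isAdmissible_indicator haar (isCompact_closedBall 1 1)
    (measure_closedBall_one_ne_zero haar)
    (measure_closedBall_one_ne_top haar)⟩

theorem IsDensityOfStates.eq (hF' : IsRoughFundamentalDomain Γ F') {ν ν' : Measure ℝ}
    (hν : IsDensityOfStates haar F' μ H ν) (hν' : IsDensityOfStates haar F' μ H ν') : ν = ν' := by
  have := hν.locallyFinite
  have := hν'.locallyFinite
  obtain ⟨u, hu⟩ := hF'.exists_isAdmissible haar
  refine Measure.ext_of_integral_eq_on_compactlySupported fun φ => ?_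
  rw [← Complex.ofReal_inj, hν.integral_eq u hu, hν'.integral_eq u hu]

/-- For 0 ≤ φ ≤ 1 the operator φ(H_ω) is a contraction, so its trace against `u` is bounded by a
constant independent of φ and ω. -/
theorem IsDensityOfStates.isFiniteMeasure [IsProbabilityMeasure μ]
    (hF' : IsRoughFundamentalDomain Γ F') {ν : Measure ℝ}
    (hν : IsDensityOfStates haar F' μ H ν) : IsFiniteMeasure ν := by
  have := hν.locallyFinite
  have hd : 0 ≤ density haar F' μ := ENNReal.toReal_nonneg
  obtain ⟨u, hu⟩ := hF'.exists_isAdmissible haar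
  obtain ⟨C, hC⟩ := hu.bounded
  obtain ⟨M, hM⟩ := Config.exists_norm_trace_le K hu.hasCompactSupport hC
  refine isFiniteMeasure_of_integral_le ν (M := (density haar F' μ)⁻¹ * M) fun φ h0 h1 => ?_
  have hφ : ∀ ω : Config X K, ‖ω.trace u (applyFun φ (H ω))‖ ≤ M := fun ω =>
    hM ω _ (norm_contFun_le (fun t => abs_le.2 ⟨by linarith [h0 t], h1 t⟩) _)
  have h2 := norm_integral_le_of_norm_le_const (μ := μ) (.of_forall hφ)
  rw [probReal_univ, mul_one] at h2
  have h3 := congrArg norm (hν.integral_eq u hu φ)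
  rw [tau, norm_mul, norm_inv, Complex.norm_real, Complex.norm_real, Real.norm_eq_abs,
    Real.norm_eq_abs, abs_of_nonneg hd] at h3
  calc ∫ t, φ t ∂ν ≤ |∫ t, φ t ∂ν| := le_abs_self _
    _ ≤ _ := h3.trans_le (mul_le_mul_of_nonneg_left h2 (inv_nonneg.2 hd))

variable [LocallyCompactSpace X] [SecondCountableTopology X] [IsIsometricSMul Γ X]
  [IsProbabilityMeasure μ] [SMulInvariantMeasure Γ (Config X K) μ]

theorem IsPositiveInvariant.exists_integral_trace {T : OperatorField X K}
    (hT : IsPositiveInvariant Γ μ T) (hF' : IsRoughFundamentalDomain Γ F') :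
    ∃ r : ℝ, 0 ≤ r ∧ ∀ u : X → ℝ, IsAdmissible haar u →
      Integrable (fun ω => ω.trace u (T ω)) μ ∧ ∫ ω, ω.trace u (T ω) ∂μ = (r : ℂ) := by
  refine ⟨_, div_nonneg measureReal_nonneg measureReal_nonneg, fun u hu => ⟨?_,
    hT.integral_trace_of_isAdmissible haar hF' hu (isCompact_closedBall 1 1)
      (measure_closedBall_one_ne_zero haar) (measure_closedBall_one_ne_top haar)⟩⟩
  obtain ⟨C, hC⟩ := hu.bounded
  exact (hT.integrable_trace hu.measurable hu.hasCompactSupport hC).1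

variable [CompactSpace K] [T2Space K]

/-- Mean measures exist only for positive fields, hence the split into positive and negative parts
of φ. The value `r` is quantified before `u`, which records independence of `u`. -/
theorem ConditionA.exists_integral_trace_applyFun (hH : ConditionA μ s H)
    (hsupport : ∀ᵐ ω ∂μ, ω ∈ μ.support) (hF' : IsRoughFundamentalDomain Γ F') (φ : C_c(ℝ, ℝ)) :
    ∃ r : ℝ, ((∀ t, 0 ≤ φ t) → 0 ≤ r) ∧ ∀ u : X → ℝ, IsAdmissible haar u →
      Integrable (fun ω => ω.trace u (applyFun φ (H ω))) μ ∧
      ∫ ω, ω.trace u (applyFun φ (H ω)) ∂μ = (r : ℂ) := by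
  obtain ⟨c, hc⟩ := φ.hasCompactSupport.exists_bound_of_continuous φ.continuous
  have hc' : ∀ t, |max (φ t) 0| ≤ c ∧ |max (-φ t) 0| ≤ c := fun t => by
    have h1 := abs_le.1 (hc t)
    have h2 := (abs_nonneg (φ t)).trans (hc t)
    rw [abs_of_nonneg (le_max_right _ _), abs_of_nonneg (le_max_right _ _)]
    exact ⟨max_le h1.2 h2, max_le (by linarith) h2⟩
  have hp : Continuous fun t => max (φ t) 0 := φ.continuous.max continuous_const
  have hn : Continuous fun t => max (-φ t) 0 := φ.continuous.neg.max continuous_const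
  obtain ⟨p, hp0, hpu⟩ := (hH.isPositiveInvariant_contFun hsupport hp
    (fun _ => le_max_right _ _) fun t => (hc' t).1).exists_integral_trace (haar := haar) hF'
  obtain ⟨n, -, hnu⟩ := (hH.isPositiveInvariant_contFun hsupport hn
    (fun _ => le_max_right _ _) fun t => (hc' t).2).exists_integral_trace (haar := haar) hF'
  have hsub : ∀ u : X → ℝ, IsAdmissible haar u → ∀ ω : Config X K,
      ω.trace u (applyFun φ (H ω)) = ω.trace u (contFun (fun t => max (φ t) 0) (H ω)) -
        ω.trace u (contFun (fun t => max (-φ t) 0) (H ω)) := fun u hu ω => by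
    rw [← ω.trace_sub hu.hasCompactSupport, ← contFun_sub hp hn, applyFun_eq_contFun]
    simp only [max_zero_sub_max_neg_zero_eq_self]
  refine ⟨p - n, fun h0 => ?_, fun u hu => ?_⟩
  · obtain ⟨u, hu⟩ := hF'.exists_isAdmissible haar
    -- For φ ≥ 0 the negative part is the zero field; an admissible function, needed to read off its
    -- value, exists by normalizing an indicator.
    have h1 : (fun t => max (-φ t) 0) = fun _ => 0 :=
      funext fun t => max_eq_right (neg_nonpos.2 (h0 t))
    have h2 := (hnu u hu).2
    simp only [h1, contFun, cfc_const_zero, (fun ω : Config X K => ω.trace_zero u),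
      integral_zero] at h2
    rw [← Complex.ofReal_zero, Complex.ofReal_inj] at h2
    rwa [← h2, sub_zero]
  · simp only [hsub u hu]
    exact ⟨(hpu u hu).1.sub (hnu u hu).1, by
      rw [integral_sub (hpu u hu).1 (hnu u hu).1, (hpu u hu).2, (hnu u hu).2, Complex.ofReal_sub]⟩

/-- Riesz–Markov for φ ↦ dens(m)⁻¹ r(φ). Linearity is checked with one fixed admissible function,
which suffices since r does not depend on it. -/
theorem ConditionA.exists_isDensityOfStates (hH : ConditionA μ s H)
    (hsupport : ∀ᵐ ω ∂μ, ω ∈ μ.support) (hF' : IsRoughFundamentalDomain Γ F') :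
    ∃ ν : Measure ℝ, IsDensityOfStates haar F' μ H ν := by
  choose r hr0 hr using hH.exists_integral_trace_applyFun hsupport hF' (haar := haar)
  obtain ⟨u, hu⟩ := hF'.exists_isAdmissible haar
  let Λ : C_c(ℝ, ℝ) →ₚ[ℝ] ℝ := PositiveLinearMap.mk₀
    { toFun := fun φ => (density haar F' μ)⁻¹ * r φ
      map_add' := fun φ ψ => by
        have h : ∀ ω : Config X K, ω.trace u (applyFun (φ + ψ) (H ω)) =
            ω.trace u (applyFun φ (H ω)) + ω.trace u (applyFun ψ (H ω)) := fun ω => by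
          rw [applyFun_add, ω.trace_add hu.hasCompactSupport]
        have h1 := (hr (φ + ψ) u hu).2
        simp only [h] at h1
        rw [integral_add (hr φ u hu).1 (hr ψ u hu).1, (hr φ u hu).2, (hr ψ u hu).2,
          ← Complex.ofReal_add, Complex.ofReal_inj] at h1
        rw [← h1, mul_add]
      map_smul' := fun c φ => by
        have h : ∀ ω : Config X K, ω.trace u (applyFun (c • φ) (H ω)) =
            (c : ℂ) * ω.trace u (applyFun φ (H ω)) := fun ω => by
          rw [applyFun_smul, ω.trace_smul hu.hasCompactSupport]
        have h1 := (hr (c • φ) u hu).2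
        simp only [h] at h1
        rw [integral_const_mul, (hr φ u hu).2, ← Complex.ofReal_mul, Complex.ofReal_inj] at h1
        rw [← h1, RingHom.id_apply, smul_eq_mul, mul_left_comm] }
    fun φ hφ => mul_nonneg (inv_nonneg.2 ENNReal.toReal_nonneg) (hr0 φ hφ)
  refine ⟨RealRMK.rieszMeasure Λ, inferInstance, fun u hu φ => (hr φ u hu).1, fun u hu φ => ?_⟩
  rw [RealRMK.integral_rieszMeasure, tau, (hr φ u hu).2]
  change (((density haar F' μ)⁻¹ * r φ : ℝ) : ℂ) = _
  push_cast
  rfl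

end Existence

end DensityOfStates

end DiscreteHamiltonian

end

/-! ### The theorem. -/

open DiscreteHamiltonian in
theorem theorem2p2
    {X : Type*} [MetricSpace X] [LocallyCompactSpace X] [SecondCountableTopology X]
    [MeasurableSpace X] [BorelSpace X]
    {Γ : Type*} [Group Γ] [MetricSpace Γ] [IsTopologicalGroup Γ] [ProperSpace Γ]
    [IsIsometricSMul Γ Γ] [MeasurableSpace Γ] [BorelSpace Γ]
    (haar : Measure Γ) [haar.IsHaarMeasure] [haar.IsMulRightInvariant]
    (hamenable : IsAmenable haar)
    [MulAction Γ X] [ContinuousSMul Γ X] [IsIsometricSMul Γ X]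
    (F' : Set X) (hF' : IsRoughFundamentalDomain Γ F')
    {K : Type*} [TopologicalSpace K] [CompactSpace K] [T2Space K]
    (μ : Measure (Config X K)) [IsProbabilityMeasure μ] [SMulInvariantMeasure Γ (Config X K) μ]
    (hsupport : ∀ᵐ ω ∂μ, ω ∈ μ.support)
    (hnonempty : ∃ ω ∈ μ.support, ω.carrier.Nonempty)
    (s : Γ → X → Circle) (H : OperatorField X K) (hH : ConditionA μ s H) (lam : ℝ) :
    IsEquivariantField μ s (compProjection H lam) ∧
    (∀ᵐ ω ∂μ, spectralProjection (H ω) {lam} = compProjection H lam ω) ∧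
    (∃! ν : Measure ℝ, IsDensityOfStates haar F' μ H ν) ∧
    ∀ ν : Measure ℝ, IsDensityOfStates haar F' μ H ν →
      IsFiniteMeasure ν ∧
      ∀ u : X → ℝ, IsAdmissible haar u →
        Integrable (fun ω => ω.trace u (compProjection H lam ω)) μ ∧
        ((distribution ν lam - Function.leftLim (distribution ν) lam : ℝ) : ℂ) =
          tau haar F' μ u (compProjection H lam) := by
  have hinv : haar.IsInvInvariant := isInvInvariant_of_unimodular haar
  have hzero : ∀ᵐ ω ∂μ, (ω.nonCompact (H ω) lam).starProjection = 0 := by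
    obtain ⟨R, hR⟩ := hH.finiteRange
    exact starProjection_nonCompact_ae_eq_zero hamenable hF' (hsupport.mono hR)
      (hH.isPositiveInvariant_nonCompact hsupport lam) (isPositiveInvariant_one μ Γ)
  -- The vanishing of Q_ω, read as equality of the full eigenprojection with P_comp; both the
  -- spectral identity and the jump formula follow from it.
  have heigen : ∀ᵐ ω ∂μ, eigenProjection (H ω) lam = compProjection H lam ω := by
    filter_upwards [hzero] with ω hω
    rw [Config.starProjection_nonCompact] at hω
    exact sub_eq_zero.1 hω
  refine ⟨hH.isEquivariantField_compProjection hsupport lam, ?_, ?_, fun ν hν => ?_⟩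
  · filter_upwards [heigen, hH.selfAdjoint] with ω hω hsa
    rw [spectralProjection_singleton hsa, hω]
  · obtain ⟨ν, hν⟩ := hH.exists_isDensityOfStates hsupport hF' (haar := haar)
    exact ⟨ν, hν, fun ν' hν' => hν'.eq hF' hν⟩
  · have hfin := hν.isFiniteMeasure hF'
    refine ⟨hfin, fun u hu => ⟨?_, ?_⟩⟩
    · obtain ⟨r, -, hr⟩ := (hH.isPositiveInvariant_compProjection hsupport
        lam).exists_integral_trace (haar := haar) hF'
      exact (hr u hu).1
    · rw [distribution_sub_leftLim, hν.measureReal_singleton hH.selfAdjoint hu, tau, tau]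
      congr 1
      refine integral_congr_ae ?_
      filter_upwards [heigen] with ω hω
      rw [hω]
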